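/- Definitions. A \emph{straight-line drawing} of a finite simple graph places the vertices at distinct points of the plane and draws every edge as the segment between its end vertices, such that no vertex lies in the relative interior of an edge. Two distinct edges \emph{cross} if their relative interiors share a point. The \emph{outer cell} of the drawing is the unbounded connected component of the complement of the drawing, and a vertex is \emph{incident} to the outer cell if it lies in its closure. The drawing is \emph{outer-RAC} if every two crossing edges cross at a right angle and every vertex is incident to the outer cell; it is \emph{outer-apRAC} if, in addition, every edge that takes part in a crossing has slope $1$ or $-1$. For $k\ge 2$, the \emph{linked-$K_{2,3}$ graph} $L_k$ has the $5k$ vertices $s_i,t_i,x_i,y_i,z_i$ $(1\le i\le k)$ and consists, for each $i$, of the three paths $(s_i,x_i,t_i)$, $(s_i,y_i,t_i)$, $(s_i,z_i,t_i)$ (a copy of $K_{2,3}$) and the \emph{link} $t_is_{i+1}$, where indices are taken modulo $k$. In the SPQR-tree of $L_k$ there is an S-node $\sigma_k$ whose skeleton is the cycle $(s_1,t_1,s_2,t_2,\ldots,s_k,t_k)$, consisting of the virtual edges $s_it_i$ and the edges $t_is_{i+1}$ standing for the links. In a straight-line drawing of $L_k$, this skeleton is drawn with its vertices at their positions in the drawing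 and each of its edges, virtual or not, as the straight-line segment between its end vertices. Theorem. (1) If $k\ge 9$, then in every outer-apRAC drawing of $L_k$ the skeleton of $\sigma_k$ has crossings, i.e. two distinct edges of the cycle $(s_1,t_1,\ldots,s_k,t_k)$ have a common point in their relative interiors. (2) For every $k\ge 2$, $L_k$ admits an outer-apRAC drawing. -/

import Mathlib

/-- The Euclidean plane. -/
abbrev Plane : Type := EuclideanSpace ℝ (Fin 2)

/-- A straight-line drawing of a simple graph: the vertices are distinct points of the plane, every
edge is the segment between its end vertices, and no vertex lies in the relative interior of an
edge. (In particular no two edges overlap in more than a point.) -/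
structure StraightLineDrawing {V : Type*} (G : SimpleGraph V) where
  pos : V → Plane
  pos_injective : Function.Injective pos
  vertex_notMem_edge : ∀ u v w : V, G.Adj u v → pos w ∉ openSegment ℝ (pos u) (pos v)

/-- With the vertices placed at `pos`, the straight-line edges `uv` and `u'v'` cross: they are
different edges, and their relative interiors have a common point. -/
def EdgesCross {V : Type*} (pos : V → Plane) (u v u' v' : V) : Prop :=
  s(u, v) ≠ s(u', v') ∧
    (openSegment ℝ (pos u) (pos v) ∩ openSegment ℝ (pos u') (pos v')).Nonempty

/-- Two edges of `G` cross when `G` is drawn with straight-line edges and its vertices placed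
at `pos`. -/
def HasCrossing {V : Type*} (G : SimpleGraph V) (pos : V → Plane) : Prop :=
  ∃ u v u' v' : V, G.Adj u v ∧ G.Adj u' v' ∧ EdgesCross pos u v u' v'

/-- The line through `p` and `q` is non-vertical and has slope `m`. -/
def HasSlope (p q : Plane) (m : ℝ) : Prop :=
  p 0 ≠ q 0 ∧ q 1 - p 1 = m * (q 0 - p 0)

namespace StraightLineDrawing

variable {V : Type*} {G : SimpleGraph V}

/-- The set of all points of the plane covered by the drawing. -/
def carrier (D : StraightLineDrawing G) : Set Plane :=
  Set.range D.pos ∪ {p | ∃ u v : V, G.Adj u v ∧ p ∈ segment ℝ (D.pos u) (D.pos v)}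

/-- The outer cell: the points in an unbounded connected component of the complement of the drawing.
(For a finite graph there is exactly one such component.) -/
def outerCell (D : StraightLineDrawing G) : Set Plane :=
  {p | p ∈ D.carrierᶜ ∧ ¬ Bornology.IsBounded (connectedComponentIn D.carrierᶜ p)}

/-- Outer-RAC: all crossings occur at a right angle and all vertices are incident to the
outer cell. -/
structure IsOuterRAC (D : StraightLineDrawing G) : Prop where
  right_angle : ∀ u v u' v' : V, G.Adj u v → G.Adj u' v' → EdgesCross D.pos u v u' v' →
    inner ℝ (D.pos v - D.pos u) (D.pos v' - D.pos u') = 0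
  outer : ∀ v : V, D.pos v ∈ closure D.outerCell

/-- Outer-apRAC: outer-RAC, and every edge that takes part in a crossing has slope `1` or `-1`. -/
structure IsOuterApRAC (D : StraightLineDrawing G) : Prop extends D.IsOuterRAC where
  slope : ∀ u v u' v' : V, G.Adj u v → G.Adj u' v' → EdgesCross D.pos u v u' v' →
    HasSlope (D.pos u) (D.pos v) 1 ∨ HasSlope (D.pos u) (D.pos v) (-1)

end StraightLineDrawing

/-- The vertices of the linked `K_{2,3}` graph; indices are taken modulo `k`. -/
inductive LinkedVertex (k : ℕ) : Type
  | s (i : ZMod k)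
  | t (i : ZMod k)
  | x (i : ZMod k)
  | y (i : ZMod k)
  | z (i : ZMod k)

/-- The edges of the linked `K_{2,3}` graph, each listed in one direction: for every `i` the paths
`s i, x i, t i` and `s i, y i, t i` and `s i, z i, t i`, and the link from `t i` to `s (i + 1)`. -/
inductive LinkedRel (k : ℕ) : LinkedVertex k → LinkedVertex k → Prop
  | sx (i : ZMod k) : LinkedRel k (.s i) (.x i)
  | xt (i : ZMod k) : LinkedRel k (.x i) (.t i)
  | sy (i : ZMod k) : LinkedRel k (.s i) (.y i)
  | yt (i : ZMod k) : LinkedRel k (.y i) (.t i)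
  | sz (i : ZMod k) : LinkedRel k (.s i) (.z i)
  | zt (i : ZMod k) : LinkedRel k (.z i) (.t i)
  | link (i : ZMod k) : LinkedRel k (.t i) (.s (i + 1))

/-- The linked `K_{2,3}` graph `L_k`. -/
def linkedGraph (k : ℕ) : SimpleGraph (LinkedVertex k) := SimpleGraph.fromRel (LinkedRel k)

/-- The vertices of the skeleton of the S-node `σ_k` in the SPQR-tree of `L_k`. -/
inductive SigmaVertex (k : ℕ) : Type
  | s (i : ZMod k)
  | t (i : ZMod k)

/-- The skeleton vertices as vertices of `L_k`. -/
def SigmaVertex.toLinked {k : ℕ} : SigmaVertex k → LinkedVertex k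
  | .s i => .s i
  | .t i => .t i

/-- The edges of the skeleton of `σ_k`, each listed in one direction. -/
inductive SigmaRel (k : ℕ) : SigmaVertex k → SigmaVertex k → Prop
  | virtual (i : ZMod k) : SigmaRel k (.s i) (.t i)
  | link (i : ZMod k) : SigmaRel k (.t i) (.s (i + 1))

/-- The skeleton of the S-node `σ_k`: the cycle `s_1, t_1, s_2, t_2, …, s_k, t_k`. -/
def sigmaSkeleton (k : ℕ) : SimpleGraph (SigmaVertex k) := SimpleGraph.fromRel (SigmaRel k)

/-- The skeleton is what the decomposition of `L_k` produces on the vertices `s_i`, `t_i`: two of them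
are joined by a skeleton edge exactly if `L_k` has a path between them with no other skeleton
vertex on it. -/
theorem sigmaSkeleton_adj_iff {k : ℕ} (u v : SigmaVertex k) :
    (sigmaSkeleton k).Adj u v ↔ u ≠ v ∧ ∃ w : (linkedGraph k).Walk u.toLinked v.toLinked,
      w.IsPath ∧ ∀ c : SigmaVertex k, c.toLinked ∈ w.support → c = u ∨ c = v := by
  constructor
  · intro h
    refine ⟨h.ne, ?_⟩
    have key : ∀ a b : SigmaVertex k, a ≠ b → SigmaRel k a b →
        ∃ w : (linkedGraph k).Walk a.toLinked b.toLinked,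
          w.IsPath ∧ ∀ c : SigmaVertex k, c.toLinked ∈ w.support → c = a ∨ c = b := by
      intro a b hab hr
      cases hr with
      | virtual i =>
        have h1 : (linkedGraph k).Adj (.s i) (.x i) := by
          simp [linkedGraph, LinkedRel.sx]
        have h2 : (linkedGraph k).Adj (.x i) (.t i) := by
          simp [linkedGraph, LinkedRel.xt]
        refine ⟨.cons h1 (.cons h2 .nil), ?_, ?_⟩
        · simp [SimpleGraph.Walk.isPath_def, SigmaVertex.toLinked]
        · intro c hc
          cases c <;> simpa [SigmaVertex.toLinked] using hc
      | link i =>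
        have h1 : (linkedGraph k).Adj (.t i) (.s (i + 1)) := by
          simp [linkedGraph, LinkedRel.link]
        refine ⟨.cons h1 .nil, ?_, ?_⟩
        · simp [SimpleGraph.Walk.isPath_def, SigmaVertex.toLinked]
        · intro c hc
          cases c <;> simpa [SigmaVertex.toLinked] using hc
    rcases h.2 with hr | hr
    · exact key u v h.ne hr
    · obtain ⟨w, hw, hc⟩ := key v u h.ne.symm hr
      exact ⟨w.reverse, hw.reverse, fun c hcm => (hc c (by simpa using hcm)).symm⟩
  · rintro ⟨huv, w, hw, hc⟩
    have inj : ∀ a b : SigmaVertex k, a.toLinked = b.toLinked → a = b := by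
      intro a b hab
      cases a <;> cases b <;> simp_all [SigmaVertex.toLinked]
    have nb : ∀ (a : SigmaVertex k) (q : LinkedVertex k), (linkedGraph k).Adj a.toLinked q →
        (∀ c : SigmaVertex k, c.toLinked ≠ q) → ∀ r, (linkedGraph k).Adj q r →
        ∃ b : SigmaVertex k, b.toLinked = r ∧ (a = b ∨ SigmaRel k a b ∨ SigmaRel k b a) := by
      intro a q h1 hq r h2
      have f1 := h1.2
      have f2 := h2.2
      cases q with
      | s j => exact absurd rfl (hq (.s j))
      | t j => exact absurd rfl (hq (.t j))
      | _ j =>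
      cases a <;> cases r <;> rcases f1 with f1 | f1 <;> cases f1 <;>
        rcases f2 with f2 | f2 <;> cases f2 <;>
        first
        | exact ⟨.s _, rfl, .inl rfl⟩
        | exact ⟨.t _, rfl, .inl rfl⟩
        | exact ⟨.t _, rfl, .inr (.inl (.virtual _))⟩
        | exact ⟨.s _, rfl, .inr (.inr (.virtual _))⟩
    have real : ∀ a b : SigmaVertex k, (linkedGraph k).Adj a.toLinked b.toLinked →
        SigmaRel k a b ∨ SigmaRel k b a := by
      intro a b h1
      have f1 := h1.2
      cases a <;> cases b <;> rcases f1 with f1 | f1 <;> cases f1 <;>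
        first
        | exact .inl (.link _)
        | exact .inr (.link _)
    refine ⟨huv, ?_⟩
    generalize hp : u.toLinked = p at w
    generalize hr : v.toLinked = r at w
    cases w with
    | nil => exact absurd (inj _ _ (hp.trans hr.symm)) huv
    | @cons _ q _ h1 w1 =>
      subst hp hr
      by_cases hq : ∃ c : SigmaVertex k, c.toLinked = q
      · obtain ⟨c, rfl⟩ := hq
        rcases hc c (by simp) with rfl | rfl
        · exact absurd rfl h1.ne
        · exact real _ _ h1
      · push Not at hq
        generalize hr : v.toLinked = r at w1
        cases w1 with
        | nil => exact absurd hr (hq v)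
        | cons h2 w2 =>
          subst hr
          obtain ⟨b, rfl, hb⟩ := nb u q h1 hq _ h2
          have hub : u ≠ b := by
            rintro rfl
            simp [SimpleGraph.Walk.isPath_def] at hw
          rcases hc b (by simp) with rfl | rfl
          · exact absurd rfl hub
          · exact hb.resolve_left hub

/-! After a rotation by −π/4, crossings only occur between a horizontal and a vertical edge.
Incidence to the outer cell enters (1) through one consequence: a closed polygon covered by the
drawing has winding number zero around every vertex off the polygon
(`StraightLineDrawing.windingSum_eq_zero`). It is combined with a discrete form of Hopf's Umlaufsatz
(`sum_turn_eq_cyc`): a simple closed polygon turns by ±2π in total, and the sign can be read off at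
any polygon vertex from which a segment runs to such a drawing vertex without meeting the other
sides.

For (1), summing this identity over the three four-cycles of an uncrossed K_{2,3} gives a
contradiction, so every copy contains a crossing of some sa with some tb, at a point c
(`AxisDrawing.exists_crossing`). The edges ta and sb are hypotenuses of right triangles with
axis-parallel legs, hence uncrossed, and sa and tb have no other crossing, since an edge entering
one of the triangles scb, cat could not leave it. If the skeleton has no crossing, then the links do
not cross each other, and the polygon s₁c₁t₁s₂c₂t₂… is simple. The edge sb leaves it on the outer
side, so all right angles at the points c turn in the same sense as the whole polygon. The edge sd
either leaves on the outer side as well, which forces the link at s to cross td, or it is itself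
crossed by the link at t. In both cases that link is axis-parallel and makes another quarter turn in
the same sense (`GadgetCycle.exists_parallel`). So each gadget has positive net turning, as the
remaining turn is larger than −π, and of any two consecutive links one is axis-parallel. Between
axis-parallel links the net turning is a positive multiple of π/2. Nine consecutive links contain
five axis-parallel ones, which already use up the full turn 2π although the polygon has not closed
yet (`false_of_quarter_turns`).

For (2), the cycle is folded flat: the copies lie at positions 0, 2, 4, … on the way out and …, 5,
3, 1 on the way back. Copies are put on both sides of the diagonal, so that in the frame of each
copy all others lie below or to the right. The link at o runs along a frame axis and crosses pd at a
right angle, and every vertex can escape upwards or to the upper left. -/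

/-! ### Angles seen from a point -/

/-- The oriented angle, in `(-π, π]`, under which the step from `x` to `y` is seen from `p`. -/
noncomputable def ang (p x y : ℂ) : ℝ := Complex.arg ((y - p) / (x - p))

/-- A real-linear functional on ℂ has the form x ↦ Re (r x). Writing it this way makes `arg (r * x)`
a branch of the argument without jumps on the half-plane. -/
theorem exists_halfPlane {S : Set ℂ} (hc : Convex ℝ S) (hk : IsClosed S) (h0 : (0 : ℂ) ∉ S) :
    ∃ r : ℂ, ∀ x ∈ S, 0 < (r * x).re := by
  obtain ⟨f, u, hu, hf⟩ := geometric_hahn_banach_point_closed hc hk h0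
  refine ⟨⟨f 1, -f Complex.I⟩, fun x hx => ?_⟩
  have h1 := hf x hx
  rw [map_zero] at hu
  have h2 : f x = x.re * f 1 + x.im * f Complex.I := by
    conv_lhs => rw [← Complex.re_add_im x]
    have e1 : ((x.re : ℂ)) = x.re • (1 : ℂ) := by simp
    have e2 : ((x.im : ℂ)) * Complex.I = x.im • Complex.I := by simp
    rw [map_add, e2, e1, map_smul, map_smul]
    simp
  rw [Complex.mul_re]
  simp only
  linarith

theorem arg_lt_of_re_pos {z : ℂ} (h : 0 < z.re) :
    -(Real.pi / 2) < z.arg ∧ z.arg < Real.pi / 2 :=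
  abs_lt.mp (Complex.abs_arg_lt_pi_div_two_iff.mpr (.inl h))

/-- Both arguments on the right lie in (−π/2, π/2), so their difference needs no correction by 2π.
-/
theorem arg_div_of_re_pos {r a b : ℂ} (ha : 0 < (r * a).re) (hb : 0 < (r * b).re) :
    Complex.arg (b / a) = Complex.arg (r * b) - Complex.arg (r * a) := by
  have ha' := arg_lt_of_re_pos ha
  have hb' := arg_lt_of_re_pos hb
  have ra : r * a ≠ 0 := fun h => by simp [h] at ha
  have rb : r * b ≠ 0 := fun h => by simp [h] at hb
  have hr : r ≠ 0 := left_ne_zero_of_mul ra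
  have e : b / a = (r * b) * (r * a)⁻¹ := by
    rw [← div_eq_mul_inv, mul_div_mul_left _ _ hr]
  have hpi := Real.pi_pos
  have hi : (r * a)⁻¹.arg = -(r * a).arg := by
    rw [Complex.arg_inv, if_neg]; linarith
  rw [e, Complex.arg_mul rb (inv_ne_zero ra), hi]
  · ring
  · rw [hi]; constructor <;> linarith

open scoped Pointwise in
theorem convex_isClosed_segment_sub (x y u v : ℂ) :
    Convex ℝ (segment ℝ x y - segment ℝ u v) ∧ IsClosed (segment ℝ x y - segment ℝ u v) := by
  refine ⟨(convex_segment x y).sub (convex_segment u v), ?_⟩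
  have hk : ∀ a b : ℂ, IsCompact (segment ℝ a b) := fun a b => by
    rw [← convexHull_pair (𝕜 := ℝ)]; exact (Set.toFinite {a, b}).isCompact_convexHull ℝ
  rw [sub_eq_add_neg]
  exact ((hk x y).add (hk u v).neg).isClosed

open scoped Pointwise in
theorem exists_halfPlane_of_disjoint {x y u v : ℂ}
    (h : Disjoint (segment ℝ u v) (segment ℝ x y)) :
    ∃ r : ℂ, 0 < (r * (x - u)).re ∧ 0 < (r * (y - u)).re ∧ 0 < (r * (x - v)).re ∧
      0 < (r * (y - v)).re := by
  obtain ⟨hc, hk⟩ := convex_isClosed_segment_sub x y u v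
  obtain ⟨r, hr⟩ := exists_halfPlane hc hk (by
    rintro ⟨a, ha, b, hb, hab⟩
    rw [sub_eq_zero] at hab
    exact Set.disjoint_left.mp h hb (hab ▸ ha))
  refine ⟨r, ?_, ?_, ?_, ?_⟩ <;>
    exact hr _ (Set.sub_mem_sub (by simp [left_mem_segment, right_mem_segment])
      (by simp [left_mem_segment, right_mem_segment]))

/-- The differences between points of two disjoint segments form a compact convex set without 0,
hence lie in an open half-plane. With one branch of the argument there, both sides are the same
alternating sum of four arguments. This replaces homotopy arguments throughout: an observer moves
along a segment, and the corrections telescope along the polygon. -/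
theorem ang_sub_ang_of_disjoint {x y u v : ℂ} (h : Disjoint (segment ℝ u v) (segment ℝ x y)) :
    ang v x y - ang u x y = ang y u v - ang x u v := by
  obtain ⟨r, h1, h2, h3, h4⟩ := exists_halfPlane_of_disjoint h
  have e1 : ang y u v = Complex.arg ((y - v) / (y - u)) := by
    rw [ang, ← neg_sub y v, ← neg_sub y u, neg_div_neg_eq]
  have e2 : ang x u v = Complex.arg ((x - v) / (x - u)) := by
    rw [ang, ← neg_sub x v, ← neg_sub x u, neg_div_neg_eq]
  rw [e1, e2, ang, ang, arg_div_of_re_pos h3 h4, arg_div_of_re_pos h1 h2, arg_div_of_re_pos h2 h4,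
    arg_div_of_re_pos h1 h3]
  ring

theorem exists_halfPlane_of_notMem {p x y : ℂ} (h : p ∉ segment ℝ x y) :
    ∃ r : ℂ, 0 < (r * (x - p)).re ∧ 0 < (r * (y - p)).re := by
  obtain ⟨r, h1, h2, -, -⟩ := exists_halfPlane_of_disjoint (x := x) (y := y) (u := p) (v := p)
    (by simpa [segment_same] using h)
  exact ⟨r, h1, h2⟩

theorem div_mem_slitPlane {p x y : ℂ} (h : p ∉ segment ℝ x y) :
    (y - p) / (x - p) ∈ Complex.slitPlane := by
  obtain ⟨r, h1, h2⟩ := exists_halfPlane_of_notMem h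
  have hx : x - p ≠ 0 := fun h => by simp [h] at h1
  have hy : y - p ≠ 0 := fun h => by simp [h] at h2
  rw [Complex.mem_slitPlane_iff_arg, arg_div_of_re_pos h1 h2]
  have := arg_lt_of_re_pos h1
  have := arg_lt_of_re_pos h2
  exact ⟨fun h => by linarith, div_ne_zero hy hx⟩

theorem ang_swap {p x y : ℂ} (h : p ∉ segment ℝ x y) : ang p y x = -ang p x y := by
  have := (Complex.mem_slitPlane_iff_arg.mp (div_mem_slitPlane h)).1
  rw [ang, ← inv_div, Complex.arg_inv, if_neg this, ang]

/-- The angle of a path `x, x + y, y` seen from the origin. -/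
theorem arg_add_div_add_arg {x y : ℂ} (h : (0 : ℂ) ∉ segment ℝ x y) :
    Complex.arg ((x + y) / x) + Complex.arg (y / (x + y)) = Complex.arg (y / x) := by
  obtain ⟨r, h1, h2⟩ := exists_halfPlane_of_notMem h
  rw [sub_zero] at h1 h2
  have h3 : 0 < (r * (x + y)).re := by rw [mul_add, Complex.add_re]; linarith
  rw [arg_div_of_re_pos h1 h3, arg_div_of_re_pos h3 h2, arg_div_of_re_pos h1 h2]
  ring

/-! ### Winding sums of closed polygons -/

/-- The total angle swept along the closed polygon `p 0, …, p n = p 0`, seen from `z`. -/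
noncomputable def windingSum (p : ℕ → ℂ) (n : ℕ) (z : ℂ) : ℝ :=
  ∑ j ∈ Finset.range n, ang z (p j) (p (j + 1))

theorem windingSum_mem {p : ℕ → ℂ} {n : ℕ} (hp : p n = p 0) {z : ℂ}
    (hz : ∀ j < n, z ∉ segment ℝ (p j) (p (j + 1))) :
    ∃ m : ℤ, windingSum p n z = m * (2 * Real.pi) := by
  have h : ((windingSum p n z : ℝ) : Real.Angle) = 0 := by
    have e : ((windingSum p n z : ℝ) : Real.Angle) =
        ∑ j ∈ Finset.range n, (((p (j + 1) - z).arg : Real.Angle) - ((p j - z).arg : Real.Angle)) := by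
      rw [windingSum, ← Real.Angle.coe_coeHom, map_sum]
      refine Finset.sum_congr rfl fun j hj => ?_
      rw [Real.Angle.coe_coeHom]
      have hj := hz j (Finset.mem_range.mp hj)
      refine Complex.arg_div_coe_angle ?_ ?_
      · exact fun h => hj (by rw [← sub_eq_zero.mp h]; exact right_mem_segment _ _ _)
      · exact fun h => hj (by rw [← sub_eq_zero.mp h]; exact left_mem_segment _ _ _)
    rw [e, Finset.sum_range_sub (fun j => (((p j - z).arg : ℝ) : Real.Angle)), hp, sub_self]
  obtain ⟨m, hm⟩ := Real.Angle.coe_eq_zero_iff.mp h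
  exact ⟨m, by rw [← hm]; simp⟩

theorem continuousAt_windingSum {p : ℕ → ℂ} {n : ℕ} {z : ℂ}
    (hz : ∀ j < n, z ∉ segment ℝ (p j) (p (j + 1))) : ContinuousAt (windingSum p n) z := by
  refine tendsto_finsetSum _ fun j hj => ?_
  have hj := hz j (Finset.mem_range.mp hj)
  have h1 : p j - z ≠ 0 := fun h => hj (by rw [← sub_eq_zero.mp h]; exact left_mem_segment _ _ _)
  have h2 : ContinuousAt (fun w => (p (j + 1) - w) / (p j - w)) z :=
    ((continuous_const.sub continuous_id).continuousAt).div
      ((continuous_const.sub continuous_id).continuousAt) h1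
  exact ContinuousAt.comp (f := fun w => (p (j + 1) - w) / (p j - w))
    (Complex.continuousAt_arg (div_mem_slitPlane hj)) h2

/-- Seen from `z`, the polygon lies in the half-plane facing the origin. One branch of the argument
serves all vertices, and the sum telescopes. -/
theorem windingSum_eq_zero_of_norm_lt {p : ℕ → ℂ} {n : ℕ} (hp : p n = p 0) {z : ℂ}
    (hz : ∀ j ≤ n, ‖p j‖ < ‖z‖) : windingSum p n z = 0 := by
  have key : ∀ j ≤ n, 0 < ((-(starRingEnd ℂ z)) * (p j - z)).re := by
    intro j hj
    have h1 := hz j hj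
    have h2 : ((-(starRingEnd ℂ z)) * (p j - z)).re = ‖z‖ ^ 2 - (starRingEnd ℂ z * p j).re := by
      rw [← Complex.normSq_eq_norm_sq, Complex.normSq_apply]
      simp; ring
    have h3 : (starRingEnd ℂ z * p j).re ≤ ‖z‖ * ‖p j‖ := by
      refine (Complex.re_le_norm _).trans ?_
      rw [norm_mul, Complex.norm_conj]
    have h0 := norm_nonneg (p j)
    rw [h2]
    nlinarith
  have e : windingSum p n z = ∑ j ∈ Finset.range n,
      (((-(starRingEnd ℂ z)) * (p (j + 1) - z)).arg - ((-(starRingEnd ℂ z)) * (p j - z)).arg) := by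
    refine Finset.sum_congr rfl fun j hj => ?_
    have hj := Finset.mem_range.mp hj
    exact arg_div_of_re_pos (key j (by omega)) (key (j + 1) (by omega))
  rw [e, Finset.sum_range_sub (fun j => ((-(starRingEnd ℂ z)) * (p j - z)).arg), hp, sub_self]

/-- The total angle swept along the polygon, seen from its vertex `p 0`; the polygon has `m + 2`
sides. -/
noncomputable def vertexSum (p : ℕ → ℂ) (m : ℕ) : ℝ :=
  ∑ j ∈ Finset.range m, ang (p 0) (p (j + 1)) (p (j + 2))

/-- The turning angle at the vertex `p (r + 1)`. -/
noncomputable def turn (p : ℕ → ℂ) (r : ℕ) : ℝ :=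
  Complex.arg ((p (r + 2) - p (r + 1)) / (p (r + 1) - p r))

/-- The observer moves from `z` to the vertex `p 0`. For the sides not at `p 0` the change
telescopes by `ang_sub_ang_of_disjoint`; the two sides at `p 0` disappear and are accounted for by
angle sums in the triangles they span with `z`. -/
theorem windingSum_eq_vertexSum {p : ℕ → ℂ} {m : ℕ} (hp : p (m + 2) = p 0) {z : ℂ}
    (h1 : (0 : ℂ) ∉ segment ℝ (p (m + 1) - p 0) (-(z - p 0)))
    (h2 : (0 : ℂ) ∉ segment ℝ (-(z - p 0)) (p 1 - p 0))
    (hd : ∀ j < m, Disjoint (segment ℝ (p 0) z) (segment ℝ (p (j + 1)) (p (j + 2)))) :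
    windingSum p (m + 2) z = vertexSum p m + Complex.arg (-(z - p 0) / (p (m + 1) - p 0)) +
      Complex.arg (-(p 1 - p 0) / (z - p 0)) := by
  have e1 := arg_add_div_add_arg h1
  have e2 := arg_add_div_add_arg h2
  have s1 : ∑ j ∈ Finset.range m, ang z (p (j + 1)) (p (j + 2)) - vertexSum p m =
      ang (p (m + 1)) (p 0) z - ang (p 1) (p 0) z := by
    rw [vertexSum, ← Finset.sum_sub_distrib,
      ← Finset.sum_range_sub (fun j => ang (p (j + 1)) (p 0) z)]
    exact Finset.sum_congr rfl fun j hj =>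
      ang_sub_ang_of_disjoint (hd j (Finset.mem_range.mp hj))
  rw [windingSum, Finset.sum_range_succ, Finset.sum_range_succ', hp]
  have hi : Complex.arg ((p 1 - p 0) / (-(z - p 0) + (p 1 - p 0))) = -ang (p 1) (p 0) z := by
    have : p 1 ∉ segment ℝ (p 0) z := by
      rw [mem_segment_iff_sameRay]
      rw [mem_segment_iff_sameRay] at h2
      intro h; apply h2
      rw [zero_sub, neg_neg, sub_zero]
      by_cases hz : z - p 0 = 0
      · rw [hz]; exact .zero_left _
      · by_cases hw : p 1 - p 0 = 0
        · rw [hw]; exact .zero_right _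
        · have h' : SameRay ℝ (z - p 1 + (p 1 - p 0)) (p 1 - p 0) :=
            SameRay.add_left h.symm .rfl
          simpa using h'
    rw [← ang_swap this, ang]
    rw [← neg_div_neg_eq]; ring_nf
  have a1 : ang (p (m + 1)) (p 0) z =
      Complex.arg ((p (m + 1) - p 0 + -(z - p 0)) / (p (m + 1) - p 0)) := by
    rw [ang, ← neg_div_neg_eq]; ring_nf
  have a2 : ang z (p (m + 1)) (p 0) =
      Complex.arg (-(z - p 0) / (p (m + 1) - p 0 + -(z - p 0))) := by
    rw [ang]; ring_nf
  have a3 : ang z (p 0) (p 1) = Complex.arg ((-(z - p 0) + (p 1 - p 0)) / -(z - p 0)) := by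
    rw [ang]; ring_nf
  have a4 : Complex.arg (-(p 1 - p 0) / (z - p 0)) = Complex.arg ((p 1 - p 0) / -(z - p 0)) := by
    rw [neg_div, div_neg]
  rw [a4, ← e1, ← e2, ← a1, ← a2, ← a3, hi]
  simp only [zero_add]
  linarith

/-- The total turning angle of a closed polygon that does not meet itself, in terms of the angle
swept along the polygon as seen from one of its vertices. -/
theorem sum_turn_eq {p : ℕ → ℂ} {m : ℕ} (hm : m ≠ 0) (hp : p (m + 2) = p 0) (hp' : p (m + 3) = p 1)
    (ht : ∀ r < m + 2, (0 : ℂ) ∉ segment ℝ (p (r + 1) - p r) (p (r + 2) - p (r + 1)))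
    (hd : ∀ i j, i + 2 ≤ j → j < m + 2 → j ≤ i + m →
      Disjoint (segment ℝ (p i) (p (i + 1))) (segment ℝ (p j) (p (j + 1)))) :
    ∑ r ∈ Finset.range (m + 2), turn p r = 2 * vertexSum p m + 2 * turn p (m + 1) := by
  -- The exterior angle of a triangle is the sum of the two remote interior angles.
  have tri : ∀ r < m + 2, turn p r =
      ang (p r) (p (r + 1)) (p (r + 2)) + ang (p (r + 2)) (p r) (p (r + 1)) := by
    intro r hr
    rw [turn, ← arg_add_div_add_arg (ht r hr), ang, ang,
      ← neg_div_neg_eq (p (r + 1) - p (r + 2))]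
    ring_nf
  -- Hopf's secant argument: turning along an initial piece equals the rotation of the secant when
  -- first its far end and then its near end moves. The induction step moves the far observer along
  -- the side from `p (q + 1)` to `p (q + 2)`.
  have claim : ∀ q ≤ m, ∑ r ∈ Finset.range q, turn p r =
      ∑ j ∈ Finset.range q, ang (p 0) (p (j + 1)) (p (j + 2)) +
      ∑ i ∈ Finset.range q, ang (p (q + 1)) (p i) (p (i + 1)) := by
    intro q
    induction q with
    | zero => simp
    | succ q ih =>
      intro hq
      have s : ∑ i ∈ Finset.range q, (ang (p (q + 2)) (p i) (p (i + 1)) -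
          ang (p (q + 1)) (p i) (p (i + 1))) =
          ang (p q) (p (q + 1)) (p (q + 2)) - ang (p 0) (p (q + 1)) (p (q + 2)) := by
        rw [← Finset.sum_range_sub (fun i => ang (p i) (p (q + 1)) (p (q + 2)))]
        refine Finset.sum_congr rfl fun i hi => ?_
        have := Finset.mem_range.mp hi
        exact (ang_sub_ang_of_disjoint (hd i (q + 1) (by omega) (by omega) (by omega))).symm
      rw [Finset.sum_sub_distrib] at s
      rw [Finset.sum_range_succ, ih (by omega), tri q (by omega), Finset.sum_range_succ,
        Finset.sum_range_succ]
      linarith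
  obtain ⟨l, rfl⟩ : ∃ l, m = l + 1 := ⟨m - 1, by omega⟩
  have c := claim (l + 1) le_rfl
  -- The closing side shares `p 0` with the first side, so the observer's last move is compared with
  -- the sides from `p 1` on only.
  have s : ∑ i ∈ Finset.range l, (ang (p (l + 3)) (p (i + 1)) (p (i + 2)) -
      ang (p (l + 2)) (p (i + 1)) (p (i + 2))) =
      ang (p (l + 1)) (p (l + 2)) (p (l + 3)) - ang (p 1) (p (l + 2)) (p (l + 3)) := by
    rw [← Finset.sum_range_sub (fun i => ang (p (i + 1)) (p (l + 2)) (p (l + 3)))]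
    refine Finset.sum_congr rfl fun i hi => ?_
    have := Finset.mem_range.mp hi
    exact (ang_sub_ang_of_disjoint (hd (i + 1) (l + 2) (by omega) (by omega) (by omega))).symm
  rw [Finset.sum_sub_distrib] at s
  have t1 := tri (l + 1) (by omega)
  have t2 : turn p (l + 2) = ang (p 1) (p (l + 2)) (p 0) + ang (p (l + 2)) (p 0) (p 1) := by
    have := arg_add_div_add_arg (ht (l + 2) (by omega))
    rw [turn, ← this, show l + 2 + 1 = l + 1 + 2 by ring, show l + 2 + 2 = l + 1 + 3 by ring, hp,
      hp', add_comm, ang, ang, ← neg_div_neg_eq (p 0 - p 1)]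
    ring_nf
  have v1 : vertexSum p (l + 1) = ∑ j ∈ Finset.range (l + 1), ang (p 0) (p (j + 1)) (p (j + 2)) := rfl
  have hp3 : p (l + 3) = p 0 := hp
  simp only [hp3, add_assoc, Nat.reduceAdd] at s t1 c v1 ⊢
  rw [Finset.sum_range_succ, Finset.sum_range_succ, c, t1, t2, v1]
  rw [Finset.sum_range_succ, Finset.sum_range_succ']
  simp only [add_assoc, Nat.reduceAdd, zero_add] at *
  linarith


/-! ### The cyclic order of three directions -/

/-- For pairwise different directions `w`, `u`, `z` this is `π` or `-π`, according to their cyclic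
order. -/
noncomputable def cyc (w u z : ℂ) : ℝ :=
  Complex.arg (-z / w) + Complex.arg (-u / z) + Complex.arg (-w / u)

/-- The nonzero vectors `a` and `b` have different directions. -/
def DirNe (a b : ℂ) : Prop := (0 : ℂ) ∉ segment ℝ a (-b)

theorem dirNe_iff {a b : ℂ} : DirNe a b ↔ ¬ SameRay ℝ a b := by
  rw [DirNe, mem_segment_iff_sameRay, zero_sub, sub_zero, sameRay_neg_iff]

theorem DirNe.symm {a b : ℂ} (h : DirNe a b) : DirNe b a := by
  rw [dirNe_iff] at *
  exact fun h' => h h'.symm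

theorem DirNe.left_ne {a b : ℂ} (h : DirNe a b) : a ≠ 0 := by
  rintro rfl; exact h (left_mem_segment _ _ _)

theorem DirNe.right_ne {a b : ℂ} (h : DirNe a b) : b ≠ 0 := h.symm.left_ne

theorem DirNe.arg_ne {a b : ℂ} (h : DirNe a b) : Complex.arg (-b / a) ≠ Real.pi := by
  have := div_mem_slitPlane h
  rw [sub_zero, sub_zero] at this
  exact (Complex.mem_slitPlane_iff_arg.mp this).1

theorem DirNe.arg_swap {a b : ℂ} (h : DirNe a b) :
    Complex.arg (-b / a) = -Complex.arg (-a / b) := by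
  have := Complex.arg_inv (-b / a)
  rw [if_neg h.arg_ne, inv_div, ← neg_div_neg_eq, neg_neg] at this
  linarith

theorem cyc_rotate (w u z : ℂ) : cyc w u z = cyc u z w := by
  rw [cyc, cyc]; ring

theorem cyc_swap {w u z : ℂ} (h1 : DirNe w u) (h2 : DirNe u z) (h3 : DirNe w z) :
    cyc w u z = -cyc u w z := by
  rw [cyc, cyc, h1.arg_swap, h2.arg_swap, h3.arg_swap]; ring

/-- The three quotients have product −1, so the sum is π modulo 2π, and it lies strictly between −3π
and 3π because the first argument is not π. -/
theorem cyc_eq_or {w u z : ℂ} (h1 : DirNe w u) (h2 : DirNe u z) (h3 : DirNe w z) :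
    cyc w u z = Real.pi ∨ cyc w u z = -Real.pi := by
  have hw := h1.left_ne
  have hu := h1.right_ne
  have hz := h2.right_ne
  have hc : ((cyc w u z : ℝ) : Real.Angle) = (Real.pi : ℝ) := by
    rw [cyc, Real.Angle.coe_add, Real.Angle.coe_add,
      ← Complex.arg_mul_coe_angle (div_ne_zero (neg_ne_zero.mpr hz) hw)
        (div_ne_zero (neg_ne_zero.mpr hu) hz), ← Complex.arg_mul_coe_angle _
        (div_ne_zero (neg_ne_zero.mpr hw) hu), ← Complex.arg_neg_one]
    · congr 2
      field_simp
    · exact mul_ne_zero (div_ne_zero (neg_ne_zero.mpr hz) hw)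
        (div_ne_zero (neg_ne_zero.mpr hu) hz)
  obtain ⟨m, hm⟩ := Real.Angle.angle_eq_iff_two_pi_dvd_sub.mp hc
  have a1 := Complex.arg_mem_Ioc (-z / w)
  have a2 := Complex.arg_mem_Ioc (-u / z)
  have a3 := Complex.arg_mem_Ioc (-w / u)
  have b1 := lt_of_le_of_ne a1.2 h3.arg_ne
  have hpi := Real.pi_pos
  have l1 : cyc w u z < 3 * Real.pi := by rw [cyc]; linarith [a2.2, a3.2]
  have l2 : -(3 * Real.pi) < cyc w u z := by rw [cyc]; linarith [a1.1, a2.1, a3.1]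
  have m1 : m < 1 := by
    by_contra h
    have : (1 : ℝ) ≤ m := by exact_mod_cast not_lt.mp h
    nlinarith
  have m2 : -2 < m := by
    by_contra h
    have : (m : ℝ) ≤ -2 := by exact_mod_cast not_lt.mp h
    nlinarith
  obtain rfl | rfl : m = 0 ∨ m = -1 := by omega
  · left; simpa [sub_eq_zero] using hm
  · right; push_cast at hm; linarith

/-! ### Crossing segments -/

theorem arg_pos_of_im_pos {z : ℂ} (h : 0 < z.im) : 0 < z.arg :=
  lt_of_le_of_ne (Complex.arg_nonneg_iff.mpr h.le) fun e => by
    have := Complex.arg_eq_zero_iff.mp e.symm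
    linarith [this.2]

theorem im_div_eq (z w : ℂ) :
    (z / w).im = (w.re * z.im - w.im * z.re) / Complex.normSq w := by
  rw [Complex.div_im]; ring

theorem arg_div_pos {z w : ℂ} (h : 0 < w.re * z.im - w.im * z.re) : 0 < (z / w).arg := by
  apply arg_pos_of_im_pos
  rw [im_div_eq]
  refine div_pos h (Complex.normSq_pos.mpr ?_)
  rintro rfl; simp at h

theorem arg_div_neg {z w : ℂ} (h : w.re * z.im - w.im * z.re < 0) : (z / w).arg < 0 := by
  rw [Complex.arg_neg_iff, im_div_eq]
  refine div_neg_of_neg_of_pos h (Complex.normSq_pos.mpr ?_)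
  rintro rfl; simp at h

/-- The crossing places `u`, `v` on opposite sides of `xy`, and `x`, `y` on opposite sides of `uv`.
The signs of the four angles are those of ±δ, and they are such that all terms of the defect have
the same sign. -/
theorem ang_defect_ne_zero {u v x y h : ℂ} (h1 : h ∈ openSegment ℝ u v)
    (h2 : h ∈ openSegment ℝ x y)
    (hd : (v - u).re * (y - x).im - (v - u).im * (y - x).re ≠ 0) :
    ang v x y - ang u x y - (ang y u v - ang x u v) ≠ 0 := by
  obtain ⟨b, a, hb, ha, hab, rfl⟩ := h1
  obtain ⟨d, c, hd', hc, hcd, he⟩ := h2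
  obtain rfl : b = 1 - a := by linarith
  obtain rfl : d = 1 - c := by linarith
  have er := congrArg Complex.re he
  have ei := congrArg Complex.im he
  simp only [Complex.add_re, Complex.add_im, Complex.real_smul, Complex.mul_re, Complex.mul_im,
    Complex.ofReal_re, Complex.ofReal_im] at er ei
  simp only [Complex.sub_re, Complex.sub_im] at hd
  set δ := (v.re - u.re) * (y.im - x.im) - (v.im - u.im) * (y.re - x.re) with hδ
  have k1 : (x - v).re * (y - v).im - (x - v).im * (y - v).re = -((1 - a) * δ) := by
    simp only [Complex.sub_re, Complex.sub_im, hδ]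
    linear_combination (y.im - x.im) * er - (y.re - x.re) * ei
  have k2 : (x - u).re * (y - u).im - (x - u).im * (y - u).re = a * δ := by
    simp only [Complex.sub_re, Complex.sub_im, hδ]
    linear_combination (y.im - x.im) * er - (y.re - x.re) * ei
  have k3 : (u - y).re * (v - y).im - (u - y).im * (v - y).re = (1 - c) * δ := by
    simp only [Complex.sub_re, Complex.sub_im, hδ]
    linear_combination -(v.im - u.im) * er + (v.re - u.re) * ei
  have k4 : (u - x).re * (v - x).im - (u - x).im * (v - x).re = -(c * δ) := by
    simp only [Complex.sub_re, Complex.sub_im, hδ]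
    linear_combination -(v.im - u.im) * er + (v.re - u.re) * ei
  rcases lt_or_gt_of_ne hd with hn | hp
  · have g1 : 0 < ang v x y := arg_div_pos (by rw [k1]; linarith [mul_neg_of_pos_of_neg hb hn])
    have g2 : ang u x y < 0 := arg_div_neg (by rw [k2]; exact mul_neg_of_pos_of_neg ha hn)
    have g3 : ang y u v < 0 := arg_div_neg (by rw [k3]; exact mul_neg_of_pos_of_neg hd' hn)
    have g4 : 0 < ang x u v := arg_div_pos (by rw [k4]; linarith [mul_neg_of_pos_of_neg hc hn])
    intro h; linarith
  · have g1 : ang v x y < 0 := arg_div_neg (by rw [k1]; linarith [mul_pos hb hp])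
    have g2 : 0 < ang u x y := arg_div_pos (by rw [k2]; exact mul_pos ha hp)
    have g3 : 0 < ang y u v := arg_div_pos (by rw [k3]; exact mul_pos hd' hp)
    have g4 : ang x u v < 0 := arg_div_neg (by rw [k4]; linarith [mul_pos hc hp])
    intro h; linarith

/-- The winding sums at the ends of a segment that crosses exactly one side are different. -/
theorem windingSum_ne_of_crossing {p : ℕ → ℂ} {n : ℕ} (hp : p n = p 0) {u v h : ℂ} {i : ℕ}
    (hi : i < n) (h1 : h ∈ openSegment ℝ u v) (h2 : h ∈ openSegment ℝ (p i) (p (i + 1)))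
    (hd : (v - u).re * (p (i + 1) - p i).im - (v - u).im * (p (i + 1) - p i).re ≠ 0)
    (ho : ∀ j < n, j ≠ i → Disjoint (segment ℝ u v) (segment ℝ (p j) (p (j + 1)))) :
    windingSum p n u ≠ windingSum p n v := by
  intro he
  have hdef := ang_defect_ne_zero h1 h2 hd
  apply hdef
  -- The correction terms telescope around the closed polygon, so equal winding sums make the total
  -- defect zero; disjoint sides contribute nothing, which leaves the crossed side alone.
  have hs : ∑ j ∈ Finset.range n, (ang v (p j) (p (j + 1)) - ang u (p j) (p (j + 1)) -
      (ang (p (j + 1)) u v - ang (p j) u v)) = 0 := by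
    rw [Finset.sum_sub_distrib, Finset.sum_sub_distrib,
      Finset.sum_range_sub (fun j => ang (p j) u v), hp, sub_self, sub_zero]
    exact sub_eq_zero.mpr he.symm
  rwa [Finset.sum_eq_single i] at hs
  · intro j hj hji
    rw [ang_sub_ang_of_disjoint (ho j (Finset.mem_range.mp hj) hji), sub_self]
  · intro hn; exact absurd (Finset.mem_range.mpr hi) hn


/-! ### Drawings with axis-parallel crossings in the complex plane -/

/-- A straight-line drawing in the complex plane in which crossing edges are axis-parallel and
perpendicular, and closed polygons covered by the drawing do not wind around vertices. -/
structure AxisDrawing {V : Type*} (G : SimpleGraph V) (q : V → ℂ) : Prop where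
  injective : Function.Injective q
  notMem : ∀ u v w : V, G.Adj u v → q w ∉ openSegment ℝ (q u) (q v)
  cross : ∀ u v u' v' : V, G.Adj u v → G.Adj u' v' → s(u, v) ≠ s(u', v') →
    ∀ h ∈ openSegment ℝ (q u) (q v), h ∈ openSegment ℝ (q u') (q v') →
    ((q v - q u).re = 0 ∧ (q v' - q u').im = 0) ∨ ((q v - q u).im = 0 ∧ (q v' - q u').re = 0)
  outer : ∀ (p : ℕ → ℂ) (n : ℕ), p n = p 0 →
    (∀ j < n, ∃ u v, G.Adj u v ∧ segment ℝ (p j) (p (j + 1)) ⊆ segment ℝ (q u) (q v)) →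
    ∀ w, (∀ j < n, q w ∉ segment ℝ (p j) (p (j + 1))) → windingSum p n (q w) = 0

/-- The plane, rotated by `-π/4` and scaled by `√2`: lines of slope `1` become horizontal and lines
of slope `-1` vertical. -/
noncomputable def rotatePlane : Plane ≃L[ℝ] ℂ :=
  LinearEquiv.toContinuousLinearEquiv
  { toFun := fun p => ⟨p 0 + p 1, p 1 - p 0⟩
    invFun := fun z => !₂[(z.re - z.im) / 2, (z.re + z.im) / 2]
    map_add' := fun p p' => by apply Complex.ext <;> simp <;> ring
    map_smul' := fun c p => by apply Complex.ext <;> simp <;> ring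
    left_inv := fun p => by ext i; fin_cases i <;> simp <;> ring
    right_inv := fun z => by apply Complex.ext <;> simp <;> ring }

theorem rotatePlane_re (p : Plane) : (rotatePlane p).re = p 0 + p 1 := rfl

theorem rotatePlane_im (p : Plane) : (rotatePlane p).im = p 1 - p 0 := rfl

theorem rotatePlane_mem_openSegment {p x y : Plane} :
    rotatePlane p ∈ openSegment ℝ (rotatePlane x) (rotatePlane y) ↔ p ∈ openSegment ℝ x y := by
  have := image_openSegment ℝ rotatePlane.toLinearEquiv.toLinearMap.toAffineMap x y
  simp only [LinearMap.coe_toAffineMap, LinearEquiv.coe_coe, ContinuousLinearEquiv.coe_toLinearEquiv]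
    at this
  rw [← this, rotatePlane.injective.mem_set_image]

theorem rotatePlane_mem_segment {p x y : Plane} :
    rotatePlane p ∈ segment ℝ (rotatePlane x) (rotatePlane y) ↔ p ∈ segment ℝ x y := by
  have := image_segment ℝ rotatePlane.toLinearEquiv.toLinearMap.toAffineMap x y
  simp only [LinearMap.coe_toAffineMap, LinearEquiv.coe_coe, ContinuousLinearEquiv.coe_toLinearEquiv]
    at this
  rw [← this, rotatePlane.injective.mem_set_image]

theorem isDiscrete_multiples : IsDiscrete {x : ℝ | ∃ m : ℤ, x = m * (2 * Real.pi)} := by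
  have e : {x : ℝ | ∃ m : ℤ, x = m * (2 * Real.pi)} =
      (AddSubgroup.zmultiples (2 * Real.pi) : Set ℝ) := by
    ext x
    simp [AddSubgroup.mem_zmultiples_iff, eq_comm]
  rw [e]
  exact ⟨inferInstanceAs (DiscreteTopology (AddSubgroup.zmultiples (2 * Real.pi)))⟩

/-- Off the polygon the winding sum is continuous with values in 2πℤ, hence constant on a component
of the complement of the drawing. If it is nonzero at `v`, it is nonzero on a component of the outer
cell that comes close to `v`; but it vanishes far away, so this component would be bounded. -/
theorem StraightLineDrawing.windingSum_eq_zero {V : Type*} {G : SimpleGraph V}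
    (D : StraightLineDrawing G) {p : ℕ → ℂ} {n : ℕ} (hp : p n = p 0)
    (hc : ∀ j < n, ∀ x, rotatePlane x ∈ segment ℝ (p j) (p (j + 1)) → x ∈ D.carrier) {v : Plane}
    (hv : v ∈ closure D.outerCell) (hv' : ∀ j < n, rotatePlane v ∉ segment ℝ (p j) (p (j + 1))) :
    windingSum p n (rotatePlane v) = 0 := by
  by_contra hne
  have hcont : ∀ x, (∀ j < n, rotatePlane x ∉ segment ℝ (p j) (p (j + 1))) →
      ContinuousAt (fun x => windingSum p n (rotatePlane x)) x := fun x hx =>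
    ContinuousAt.comp (g := windingSum p n) (continuousAt_windingSum hx)
      rotatePlane.continuous.continuousAt
  obtain ⟨x, hx, hxO⟩ := mem_closure_iff_nhds.mp hv _
    ((hcont v hv').eventually_ne hne)
  obtain ⟨hx1, hx2⟩ := hxO
  set C := connectedComponentIn D.carrierᶜ x with hC
  have hCs : ∀ y ∈ C, ∀ j < n, rotatePlane y ∉ segment ℝ (p j) (p (j + 1)) := fun y hy j hj h =>
    connectedComponentIn_subset _ _ hy (hc j hj y h)
  have hconst : ∀ y ∈ C, windingSum p n (rotatePlane y) = windingSum p n (rotatePlane x) :=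
    fun y hy => (isPreconnected_connectedComponentIn.constant_of_mapsTo isDiscrete_multiples
      (fun z hz => (hcont z (hCs z hz)).continuousWithinAt)
      (fun z hz => windingSum_mem hp (hCs z hz)) hy (mem_connectedComponentIn hx1))
  apply hx2
  obtain ⟨R, hR⟩ := ((Set.finite_Iic n).image (fun j => ‖p j‖)).bddAbove
  have hsub : C ⊆ rotatePlane.symm '' Metric.closedBall 0 R := by
    intro y hy
    refine ⟨rotatePlane y, ?_, by simp⟩
    rw [mem_closedBall_zero_iff]
    by_contra hlt
    apply hx
    rw [← hconst y hy]
    exact windingSum_eq_zero_of_norm_lt hp fun j hj =>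
      (hR (Set.mem_image_of_mem _ hj)).trans_lt (not_le.mp hlt)
  exact (((isCompact_closedBall _ _).image rotatePlane.symm.continuous).isBounded).subset hsub

theorem StraightLineDrawing.IsOuterApRAC.axisDrawing {V : Type*} {G : SimpleGraph V}
    {D : StraightLineDrawing G} (h : D.IsOuterApRAC) :
    AxisDrawing G (fun v => rotatePlane (D.pos v)) where
  injective := rotatePlane.injective.comp D.pos_injective
  notMem u v w huv := by
    rw [rotatePlane_mem_openSegment]; exact D.vertex_notMem_edge u v w huv
  cross u v u' v' h1 h2 hne z hz hz' := by
    obtain ⟨x, rfl⟩ := rotatePlane.surjective z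
    rw [rotatePlane_mem_openSegment] at hz hz'
    have hX : EdgesCross D.pos u v u' v' := ⟨hne, x, hz, hz'⟩
    have hr := h.right_angle u v u' v' h1 h2 hX
    simp only [PiLp.inner_apply, Fin.sum_univ_two, PiLp.sub_apply, RCLike.inner_apply,
      conj_trivial] at hr
    simp only [Complex.sub_re, Complex.sub_im, rotatePlane_re, rotatePlane_im]
    rcases h.slope u v u' v' h1 h2 hX with ⟨hn, hs⟩ | ⟨hn, hs⟩
    · right
      refine ⟨by linarith, ?_⟩
      have : (D.pos v 0 - D.pos u 0) * ((D.pos v' 0 + D.pos v' 1) - (D.pos u' 0 + D.pos u' 1)) = 0 := by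
        rw [hs] at hr; linarith
      exact (mul_eq_zero.mp this).resolve_left (sub_ne_zero.mpr hn.symm)
    · left
      refine ⟨by linarith, ?_⟩
      have : (D.pos v 0 - D.pos u 0) * ((D.pos v' 1 - D.pos v' 0) - (D.pos u' 1 - D.pos u' 0)) = 0 := by
        rw [hs] at hr; linarith
      exact (mul_eq_zero.mp this).resolve_left (sub_ne_zero.mpr hn.symm)
  outer p n hp hc w hw := by
    refine D.windingSum_eq_zero hp (fun j hj x hx => ?_) (h.outer w) hw
    obtain ⟨u, v, huv, hs⟩ := hc j hj
    exact .inr ⟨u, v, huv, rotatePlane_mem_segment.mp (hs hx)⟩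


/-! ### Turning sense of closed polygons -/

/-- Winding sum zero at `z` determines `vertexSum` through `windingSum_eq_vertexSum`; inserting this
into `sum_turn_eq` leaves only the three angles at `p 0`. Since `cyc` is ±π, the total is ±2π, with
a sign that records on which side `z` is seen from `p 0`. -/
theorem sum_turn_eq_cyc {p : ℕ → ℂ} {m : ℕ} (hm : m ≠ 0) (hp : p (m + 2) = p 0)
    (hp' : p (m + 3) = p 1)
    (ht : ∀ r < m + 2, (0 : ℂ) ∉ segment ℝ (p (r + 1) - p r) (p (r + 2) - p (r + 1)))
    (hd : ∀ i j, i + 2 ≤ j → j < m + 2 → j ≤ i + m →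
      Disjoint (segment ℝ (p i) (p (i + 1))) (segment ℝ (p j) (p (j + 1))))
    {z : ℂ} (h1 : DirNe (p (m + 1) - p 0) (z - p 0)) (h2 : DirNe (p 1 - p 0) (z - p 0))
    (hz : ∀ j < m, Disjoint (segment ℝ (p 0) z) (segment ℝ (p (j + 1)) (p (j + 2))))
    (hw : windingSum p (m + 2) z = 0) :
    ∑ r ∈ Finset.range (m + 2), turn p r =
      -2 * cyc (p (m + 1) - p 0) (p 1 - p 0) (z - p 0) := by
  have e := windingSum_eq_vertexSum hp h1 (by rw [segment_symm]; exact h2) hz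
  have h3 : DirNe (p (m + 1) - p 0) (p 1 - p 0) := by
    have := ht (m + 1) (by omega)
    rw [show m + 1 + 1 = m + 2 by ring, show m + 1 + 2 = m + 3 by ring, hp, hp'] at this
    rw [dirNe_iff]
    rw [mem_segment_iff_sameRay, zero_sub, sub_zero, neg_sub] at this
    exact this
  have t : turn p (m + 1) = -Complex.arg (-(p (m + 1) - p 0) / (p 1 - p 0)) := by
    rw [← h3.arg_swap, turn, show m + 1 + 1 = m + 2 by ring, show m + 1 + 2 = m + 3 by ring, hp, hp',
      ← neg_div_neg_eq]
    ring_nf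
  rw [sum_turn_eq hm hp hp' ht hd, t, cyc]
  rw [hw] at e
  linarith

/-- The closed polygon with three given vertices. -/
def triangle (x y z : ℂ) : ℕ → ℂ := fun j => if j % 3 = 0 then x else if j % 3 = 1 then y else z

/-- The closed polygon with four given vertices. -/
def quad (x y z w : ℂ) : ℕ → ℂ := fun j =>
  if j % 4 = 0 then x else if j % 4 = 1 then y else if j % 4 = 2 then z else w

theorem segment_subset_left {x y c : ℂ} (h : c ∈ openSegment ℝ x y) :
    segment ℝ x c ⊆ segment ℝ x y :=
  (convex_segment x y).segment_subset (left_mem_segment _ _ _) (openSegment_subset_segment _ _ _ h)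

namespace AxisDrawing

variable {V : Type*} {G : SimpleGraph V} {q : V → ℂ}

theorem eq_of_mem_segment (H : AxisDrawing G q) {u v w : V} (h : G.Adj u v)
    (hw : q w ∈ segment ℝ (q u) (q v)) : w = u ∨ w = v := by
  rw [← insert_endpoints_openSegment] at hw
  rcases hw with hw | hw | hw
  · exact .inl (H.injective hw)
  · exact .inr (H.injective hw)
  · exact absurd hw (H.notMem u v w h)

/-- Of two edges with the same direction at a common vertex, one would contain the far end of the
other. -/
theorem dirNe (H : AxisDrawing G q) {u v v' : V} (h : G.Adj u v) (h' : G.Adj u v') (hne : v ≠ v') :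
    DirNe (q v - q u) (q v' - q u) := by
  rw [dirNe_iff]
  intro hr
  have h0 : ∀ {v}, G.Adj u v → q v - q u ≠ 0 := fun h h' =>
    h.ne (H.injective (sub_eq_zero.mp h')).symm
  obtain ⟨r, hr0, hr⟩ := hr.exists_pos_left (h0 h) (h0 h')
  rcases le_total r 1 with h1 | h1
  · have : q v' ∈ segment ℝ (q u) (q v) := by
      rw [mem_segment_iff_sameRay, ← hr]
      have e : q v - q v' = (1 - r) • (q v - q u) := by
        rw [sub_smul, one_smul, hr]; ring
      rw [e]
      exact (SameRay.sameRay_pos_smul_left _ hr0).trans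
        (SameRay.sameRay_nonneg_smul_right _ (by linarith)) (fun h' => absurd h' (h0 h))
    rcases H.eq_of_mem_segment h this with e | e
    · exact h'.ne e.symm
    · exact hne e.symm
  · have : q v ∈ segment ℝ (q u) (q v') := by
      rw [mem_segment_iff_sameRay]
      have e : q v' - q v = (r - 1) • (q v - q u) := by
        rw [sub_smul, one_smul, hr]; ring
      rw [e]
      exact SameRay.sameRay_nonneg_smul_right _ (by linarith)
    rcases H.eq_of_mem_segment h' this with e | e
    · exact h.ne e.symm
    · exact hne e

/-- An interior common point of two edges at `u` would make them collinear, while crossing edges are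
perpendicular. -/
theorem not_cross_of_common (H : AxisDrawing G q) {u v v' : V} (h : G.Adj u v) (h' : G.Adj u v')
    (hne : v ≠ v') : Disjoint (openSegment ℝ (q u) (q v)) (openSegment ℝ (q u) (q v')) := by
  rw [Set.disjoint_left]
  intro z hz hz'
  have hs : s(u, v) ≠ s(u, v') := by
    intro e; rcases Sym2.eq_iff.mp e with ⟨-, e⟩ | ⟨e1, e2⟩
    · exact hne e
    · exact hne (e2.trans e1)
  have hx := H.cross u v u v' h h' hs z hz hz'
  obtain ⟨b, a, hb, ha, hab, rfl⟩ := hz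
  obtain ⟨d, c, hd, hc, hcd, he⟩ := hz'
  obtain rfl : b = 1 - a := by linarith
  obtain rfl : d = 1 - c := by linarith
  have e : (a : ℂ) * (q v - q u) = c * (q v' - q u) := by
    simp only [Complex.real_smul] at he
    push_cast at he
    linear_combination -he
  have er := congrArg Complex.re e
  have ei := congrArg Complex.im e
  simp only [Complex.re_ofReal_mul, Complex.im_ofReal_mul] at er ei
  have h0 : q v - q u ≠ 0 := fun h' => h.ne (H.injective (sub_eq_zero.mp h')).symm
  apply h0
  rcases hx with ⟨h1, h2⟩ | ⟨h1, h2⟩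
  · rw [h2, mul_zero] at ei
    exact Complex.ext h1 ((mul_eq_zero.mp ei).resolve_left ha.ne')
  · rw [h2, mul_zero] at er
    exact Complex.ext ((mul_eq_zero.mp er).resolve_left ha.ne') h1

theorem inter_cases (H : AxisDrawing G q) {u v u' v' : V} (h : G.Adj u v) (h' : G.Adj u' v') {z : ℂ}
    (hz : z ∈ segment ℝ (q u) (q v)) (hz' : z ∈ segment ℝ (q u') (q v')) :
    (z ∈ openSegment ℝ (q u) (q v) ∧ z ∈ openSegment ℝ (q u') (q v')) ∨
      ∃ w, z = q w ∧ (w = u ∨ w = v) ∧ (w = u' ∨ w = v') := by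
  have k := hz
  have k' := hz'
  rw [← insert_endpoints_openSegment] at k k'
  rcases k with rfl | rfl | k
  · exact .inr ⟨u, rfl, .inl rfl, H.eq_of_mem_segment h' hz'⟩
  · exact .inr ⟨v, rfl, .inr rfl, H.eq_of_mem_segment h' hz'⟩
  rcases k' with rfl | rfl | k'
  · exact .inr ⟨u', rfl, H.eq_of_mem_segment h hz, .inl rfl⟩
  · exact .inr ⟨v', rfl, H.eq_of_mem_segment h hz, .inr rfl⟩
  exact .inl ⟨k, k'⟩

/-- Two edges without a common vertex that do not cross are disjoint. -/
theorem disjoint_segment (H : AxisDrawing G q) {u v u' v' : V} (h : G.Adj u v) (h' : G.Adj u' v')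
    (hx : Disjoint (openSegment ℝ (q u) (q v)) (openSegment ℝ (q u') (q v')))
    (h1 : u ≠ u') (h2 : u ≠ v') (h3 : v ≠ u') (h4 : v ≠ v') :
    Disjoint (segment ℝ (q u) (q v)) (segment ℝ (q u') (q v')) := by
  rw [Set.disjoint_left]
  intro z hz hz'
  rcases H.inter_cases h h' hz hz' with ⟨k, k'⟩ | ⟨w, rfl, k, k'⟩
  · exact Set.disjoint_left.mp hx k k'
  · rcases k with rfl | rfl <;> rcases k' with rfl | rfl <;> contradiction

theorem eq_of_mem_common (H : AxisDrawing G q) {u v v' : V} (h : G.Adj u v) (h' : G.Adj u v')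
    (hne : v ≠ v') {z : ℂ} (hz : z ∈ segment ℝ (q u) (q v)) (hz' : z ∈ segment ℝ (q u) (q v')) :
    z = q u := by
  rcases H.inter_cases h h' hz hz' with ⟨k, k'⟩ | ⟨w, rfl, k, k'⟩
  · exact absurd k' (Set.disjoint_left.mp (H.not_cross_of_common h h' hne) k)
  · rcases k with rfl | rfl
    · rfl
    · rcases k' with rfl | rfl
      · rfl
      · contradiction

/-- An uncrossed four-cycle turns towards the side on which it has no third neighbour `w`. -/
theorem sum_turn_quad (H : AxisDrawing G q) {s t a b w : V} (hsa : G.Adj s a) (hta : G.Adj t a)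
    (hsb : G.Adj s b) (htb : G.Adj t b) (hsw : G.Adj s w) (hst : s ≠ t) (hab : a ≠ b) (haw : a ≠ w)
    (hbw : b ≠ w) (htw : G.Adj t w)
    (hx : ∀ x y, (x = a ∨ x = b ∨ x = w) → (y = a ∨ y = b ∨ y = w) → x ≠ y →
      Disjoint (openSegment ℝ (q s) (q x)) (openSegment ℝ (q t) (q y))) :
    Complex.arg ((q t - q a) / (q a - q s)) + Complex.arg ((q b - q t) / (q t - q a)) +
      Complex.arg ((q s - q b) / (q b - q t)) + Complex.arg ((q a - q s) / (q s - q b)) =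
      -2 * cyc (q b - q s) (q a - q s) (q w - q s) := by
  have seg : ∀ x y, (x = a ∨ x = b ∨ x = w) → (y = a ∨ y = b ∨ y = w) → x ≠ y →
      Disjoint (segment ℝ (q s) (q x)) (segment ℝ (q t) (q y)) := by
    intro x y h1 h2 hne
    have hax : G.Adj s x := by rcases h1 with rfl | rfl | rfl <;> assumption
    have hay : G.Adj t y := by rcases h2 with rfl | rfl | rfl <;> assumption
    have hay' : G.Adj s y := by rcases h2 with rfl | rfl | rfl <;> assumption
    have hax' : G.Adj t x := by rcases h1 with rfl | rfl | rfl <;> assumption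
    exact H.disjoint_segment hax hay (hx x y h1 h2 hne) hst hay'.ne hax'.ne.symm hne
  have dn : ∀ {u v v' : V}, G.Adj u v → G.Adj u v' → v ≠ v' →
      (0 : ℂ) ∉ segment ℝ (q u - q v) (q v' - q u) := by
    intro u v v' h h' hne
    have := H.dirNe h h' hne
    rw [dirNe_iff] at this
    rw [mem_segment_iff_sameRay]
    simpa using this
  have key := sum_turn_eq_cyc (p := quad (q s) (q a) (q t) (q b)) (m := 2) (z := q w) two_ne_zero
    (by simp [quad]) (by simp [quad]) ?_ ?_ ?_ ?_ ?_ ?_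
  · simpa [Finset.sum_range_succ, quad, turn] using key
  · intro r hr
    interval_cases r <;> simp only [quad] <;> norm_num
    · exact dn hsa.symm hta.symm hst
    · exact dn hta htb hab
    · exact dn htb.symm hsb.symm hst.symm
    · exact dn hsb hsa hab.symm
  · intro i j h1 h2 h3
    obtain ⟨rfl, rfl⟩ | ⟨rfl, rfl⟩ : (i = 0 ∧ j = 2) ∨ (i = 1 ∧ j = 3) := by omega
    · simpa [quad] using seg a b (by simp) (by simp) hab
    · simp only [quad]; norm_num
      rw [segment_symm, segment_symm ℝ (q b)]
      exact (seg b a (by simp) (by simp) hab.symm).symm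
  · simpa [quad] using H.dirNe hsb hsw hbw
  · simpa [quad] using H.dirNe hsa hsw haw
  · intro j hj
    interval_cases j <;> simp only [quad] <;> norm_num
    · rw [segment_symm ℝ (q a)]; exact seg w a (by simp) (by simp) haw.symm
    · exact seg w b (by simp) (by simp) hbw.symm
  · refine H.outer _ _ (by simp [quad]) ?_ w ?_
    · intro j hj
      interval_cases j <;> simp only [quad] <;> norm_num
      exacts [⟨s, a, hsa, le_rfl⟩, ⟨a, t, hta.symm, le_rfl⟩, ⟨t, b, htb, le_rfl⟩,
        ⟨b, s, hsb.symm, le_rfl⟩]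
    · have ne : ∀ {u v}, G.Adj u v → w ≠ u → w ≠ v → q w ∉ segment ℝ (q u) (q v) := by
        intro u v h h1 h2 hm
        rcases H.eq_of_mem_segment h hm with h | h
        exacts [h1 h, h2 h]
      intro j hj
      interval_cases j <;> simp only [quad] <;> norm_num
      exacts [ne hsa hsw.ne.symm haw.symm, ne hta.symm haw.symm htw.ne.symm,
        ne htb htw.ne.symm hbw.symm, ne hsb.symm hbw.symm hsw.ne.symm]

theorem arg_turn_reverse (H : AxisDrawing G q) {s t a : V} (h : G.Adj a s) (h' : G.Adj a t)
    (hst : s ≠ t) : Complex.arg ((q s - q a) / (q a - q t)) =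
      -Complex.arg ((q t - q a) / (q a - q s)) := by
  have := (H.dirNe h h' hst).arg_swap
  rw [← neg_div_neg_eq (q s - q a), ← neg_div_neg_eq (q t - q a)]
  rw [neg_sub (q a) (q t), neg_sub (q a) (q s)]
  linarith

/-- In an outer drawing of `K_{2,3}` there is a crossing. -/
theorem exists_crossing (H : AxisDrawing G q) {s t x y z : V} (hsx : G.Adj s x) (htx : G.Adj t x)
    (hsy : G.Adj s y) (hty : G.Adj t y) (hsz : G.Adj s z) (htz : G.Adj t z) (hst : s ≠ t)
    (hxy : x ≠ y) (hxz : x ≠ z) (hyz : y ≠ z) :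
    ∃ a b, (a = x ∨ a = y ∨ a = z) ∧ (b = x ∨ b = y ∨ b = z) ∧ a ≠ b ∧
      (openSegment ℝ (q s) (q a) ∩ openSegment ℝ (q t) (q b)).Nonempty := by
  by_contra hcon
  push Not at hcon
  have hx : ∀ a b, (a = x ∨ a = y ∨ a = z) → (b = x ∨ b = y ∨ b = z) → a ≠ b →
      Disjoint (openSegment ℝ (q s) (q a)) (openSegment ℝ (q t) (q b)) := fun a b h1 h2 h3 =>
    Set.disjoint_iff_inter_eq_empty.mpr (hcon a b h1 h2 h3)
  have q1 := H.sum_turn_quad hsx htx hsy hty hsz hst hxy hxz hyz htz hx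
  have q2 := H.sum_turn_quad hsy hty hsz htz hsx hst hyz hxy.symm hxz.symm htx
    (fun a b h1 h2 => hx a b (by tauto) (by tauto))
  have q3 := H.sum_turn_quad hsz htz hsx htx hsy hst hxz.symm hyz.symm hxy hty
    (fun a b h1 h2 => hx a b (by tauto) (by tauto))
  -- Each middle vertex lies on two of the four-cycles, which pass through it in opposite
  -- directions, so its turns cancel. The turns at `s` and `t` combine to one `cyc` each.
  have r1 := H.arg_turn_reverse hsx.symm htx.symm hst
  have r2 := H.arg_turn_reverse hsy.symm hty.symm hst
  have r3 := H.arg_turn_reverse hsz.symm htz.symm hst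
  have c1 := cyc_swap (H.dirNe hsy hsx hxy.symm) (H.dirNe hsx hsz hxz) (H.dirNe hsy hsz hyz)
  have d1 := cyc_rotate (q z - q s) (q y - q s) (q x - q s)
  have d2 := cyc_rotate (q y - q s) (q x - q s) (q z - q s)
  have d3 := cyc_rotate (q x - q s) (q z - q s) (q y - q s)
  have a1 := cyc_eq_or (H.dirNe hsy hsx hxy.symm) (H.dirNe hsx hsz hxz) (H.dirNe hsy hsz hyz)
  have a2 := cyc_eq_or (H.dirNe hty htx hxy.symm) (H.dirNe htx htz hxz) (H.dirNe hty htz hyz)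
  have e1 : cyc (q x - q s) (q y - q s) (q z - q s) =
      Complex.arg ((q x - q s) / (q s - q y)) + Complex.arg ((q y - q s) / (q s - q z)) +
      Complex.arg ((q z - q s) / (q s - q x)) := by
    rw [cyc, ← neg_div_neg_eq (q x - q s), ← neg_div_neg_eq (q y - q s),
      ← neg_div_neg_eq (q z - q s), neg_sub (q s), neg_sub (q s), neg_sub (q s)]
    ring
  have e2 : cyc (q y - q t) (q x - q t) (q z - q t) =
      Complex.arg ((q y - q t) / (q t - q x)) + Complex.arg ((q z - q t) / (q t - q y)) +
      Complex.arg ((q x - q t) / (q t - q z)) := by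
    rw [cyc, ← neg_div_neg_eq (q x - q t), ← neg_div_neg_eq (q y - q t),
      ← neg_div_neg_eq (q z - q t), neg_sub (q t), neg_sub (q t), neg_sub (q t)]
    ring
  -- By rotation the three right-hand sides are equal and add up to ±6π, but the left-hand sides add
  -- up to at most 2π in absolute value.
  have hpi := Real.pi_pos
  rcases a1 with a1 | a1 <;> rcases a2 with a2 | a2 <;> linarith

end AxisDrawing


/-! ### Axis-parallel perpendicular vectors and edges entering polygons -/

/-- One of two vectors is vertical and the other one is horizontal. -/
def AxisPerp (x y : ℂ) : Prop := (x.re = 0 ∧ y.im = 0) ∨ (x.im = 0 ∧ y.re = 0)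

theorem AxisPerp.det_ne {x y : ℂ} (h : AxisPerp x y) (hx : x ≠ 0) (hy : y ≠ 0) :
    x.re * y.im - x.im * y.re ≠ 0 := by
  rcases h with ⟨h1, h2⟩ | ⟨h1, h2⟩
  · have hx' : x.im ≠ 0 := fun h => hx (Complex.ext h1 h)
    have hy' : y.re ≠ 0 := fun h => hy (Complex.ext h h2)
    rw [h1, h2]; simpa using ⟨hx', hy'⟩
  · have hx' : x.re ≠ 0 := fun h => hx (Complex.ext h h1)
    have hy' : y.im ≠ 0 := fun h => hy (Complex.ext h2 h)
    rw [h1, h2]; simpa using ⟨hx', hy'⟩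

theorem AxisPerp.symm {x y : ℂ} (h : AxisPerp x y) : AxisPerp y x := by
  rcases h with ⟨h1, h2⟩ | ⟨h1, h2⟩
  exacts [.inr ⟨h2, h1⟩, .inl ⟨h2, h1⟩]

/-- There are only two axis directions, so two edges crossing the same edge are parallel to each
other. -/
theorem AxisPerp.not_axisPerp {x y z : ℂ} (h : AxisPerp x y) (h' : AxisPerp x z) (hx : x ≠ 0)
    (hy : y ≠ 0) (hz : z ≠ 0) : ¬ AxisPerp y z := by
  intro h''
  rcases h with ⟨h1, h2⟩ | ⟨h1, h2⟩ <;> rcases h' with ⟨h3, h4⟩ | ⟨h3, h4⟩ <;>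
    rcases h'' with ⟨h5, h6⟩ | ⟨h5, h6⟩ <;>
    first
    | exact hx (Complex.ext (by assumption) (by assumption))
    | exact hy (Complex.ext (by assumption) (by assumption))
    | exact hz (Complex.ext (by assumption) (by assumption))

theorem exists_of_mem_openSegment {c x y : ℂ} (h : c ∈ openSegment ℝ x y) :
    ∃ r : ℝ, 0 < r ∧ r < 1 ∧ c - x = r * (y - x) ∧ y - c = (1 - r : ℝ) * (y - x) := by
  obtain ⟨b, a, hb, ha, hab, rfl⟩ := h
  obtain rfl : b = 1 - a := by linarith
  refine ⟨a, ha, by linarith, ?_, ?_⟩ <;> simp only [Complex.real_smul] <;> push_cast <;> ring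

theorem AxisPerp.real_mul_left {x y : ℂ} (h : AxisPerp x y) (r : ℝ) : AxisPerp (r * x) y := by
  rcases h with ⟨h1, h2⟩ | ⟨h1, h2⟩
  · exact .inl ⟨by simp [h1], h2⟩
  · exact .inr ⟨by simp [h1], h2⟩

theorem re_eq_of_mem_segment {x y z : ℂ} (h : z ∈ segment ℝ x y) (h0 : (y - x).re = 0) :
    z.re = x.re := by
  obtain ⟨b, a, hb, ha, hab, rfl⟩ := h
  obtain rfl : b = 1 - a := by linarith
  simp only [Complex.sub_re, Complex.add_re, Complex.real_smul, Complex.re_ofReal_mul] at *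
  linear_combination a * h0

theorem im_eq_of_mem_segment {x y z : ℂ} (h : z ∈ segment ℝ x y) (h0 : (y - x).im = 0) :
    z.im = x.im := by
  obtain ⟨b, a, hb, ha, hab, rfl⟩ := h
  obtain rfl : b = 1 - a := by linarith
  simp only [Complex.sub_im, Complex.add_im, Complex.real_smul, Complex.im_ofReal_mul] at *
  linear_combination a * h0

theorem left_notMem_segment {c x y : ℂ} (h : c ∈ openSegment ℝ x y) (hxy : x ≠ y) :
    x ∉ segment ℝ c y := by
  intro hm
  obtain ⟨r, h0, h1, h2, h3⟩ := exists_of_mem_openSegment h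
  obtain ⟨b, a, hb, ha, hab, he⟩ := hm
  have hk : ((b * r + a : ℝ) : ℂ) * (y - x) = 0 := by
    simp only [Complex.real_smul] at he
    have hab' : (b : ℂ) + a = 1 := by exact_mod_cast hab
    push_cast
    linear_combination he - (b : ℂ) * h2 - x * hab'
  rcases mul_eq_zero.mp hk with hk | hk
  · have : b * r + a = 0 := by exact_mod_cast hk
    have : 0 ≤ b * r := by positivity
    have ha0 : a = 0 := by linarith
    have hb1 : b = 1 := by linarith
    subst ha0 hb1; linarith
  · exact hxy (sub_eq_zero.mp hk).symm

theorem DirNe.real_mul_left {x y : ℂ} (h : DirNe x y) {r : ℝ} (hr : 0 < r) : DirNe (r * x) y := by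
  rw [dirNe_iff] at *
  intro h'
  rw [← Complex.real_smul] at h'
  have := h'.pos_smul_left (inv_pos.mpr hr)
  rw [inv_smul_smul₀ hr.ne'] at this
  exact h this

namespace AxisDrawing

variable {V : Type*} {G : SimpleGraph V} {q : V → ℂ}

theorem sub_ne (H : AxisDrawing G q) {u v : V} (h : u ≠ v) : q v - q u ≠ 0 := fun e =>
  h (H.injective (sub_eq_zero.mp e)).symm

theorem ne_of_cross (H : AxisDrawing G q) {x y v w : V} (h : G.Adj x y) (h' : G.Adj v w)
    (hne : s(x, y) ≠ s(v, w)) {z : ℂ} (hz : z ∈ openSegment ℝ (q x) (q y))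
    (hz' : z ∈ openSegment ℝ (q v) (q w)) : x ≠ v ∧ x ≠ w ∧ y ≠ v ∧ y ≠ w := by
  have key : ∀ {x y v w}, G.Adj x y → G.Adj v w → s(x, y) ≠ s(v, w) →
      z ∈ openSegment ℝ (q x) (q y) → z ∈ openSegment ℝ (q v) (q w) → x ≠ v := by
    rintro x y v w h h' hne hz hz' rfl
    exact Set.disjoint_left.mp (H.not_cross_of_common h h' (fun e => hne (by rw [e]))) hz hz'
  have hz2 := hz
  have hz2' := hz'
  rw [openSegment_symm] at hz2 hz2'
  have e1 : s(x, y) = s(y, x) := Sym2.eq_swap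
  have e2 : s(v, w) = s(w, v) := Sym2.eq_swap
  exact ⟨key h h' hne hz hz', key h h'.symm (e2 ▸ hne) hz hz2', key h.symm h' (e1 ▸ hne) hz2 hz',
    key h.symm h'.symm (e1 ▸ e2 ▸ hne) hz2 hz2'⟩

theorem axisPerp (H : AxisDrawing G q) {x y v w : V} (h : G.Adj x y) (h' : G.Adj v w)
    (hne : s(x, y) ≠ s(v, w)) {z : ℂ} (hz : z ∈ openSegment ℝ (q x) (q y))
    (hz' : z ∈ openSegment ℝ (q v) (q w)) : AxisPerp (q y - q x) (q w - q v) :=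
  H.cross x y v w h h' hne z hz hz'

/-- An edge that is not axis-parallel is not crossed. -/
theorem disjoint_of_not_axis (H : AxisDrawing G q) {x y v w : V} (h : G.Adj x y) (h' : G.Adj v w)
    (hre : (q y - q x).re ≠ 0) (him : (q y - q x).im ≠ 0) (hne : s(x, y) ≠ s(v, w)) :
    Disjoint (openSegment ℝ (q x) (q y)) (openSegment ℝ (q v) (q w)) := by
  rw [Set.disjoint_left]
  intro z hz hz'
  rcases H.axisPerp h h' hne hz hz' with h | h
  exacts [hre h.1, him h.1]

/-- An edge cannot enter a closed polygon that is covered by the drawing. -/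
theorem not_enter (H : AxisDrawing G q) {p : ℕ → ℂ} {n : ℕ} (hp : p n = p 0)
    (hc : ∀ j < n, ∃ u v, G.Adj u v ∧ segment ℝ (p j) (p (j + 1)) ⊆ segment ℝ (q u) (q v))
    {v w : V} (hvw : v ≠ w) (hn : 0 < n) (h10 : p 1 - p 0 ≠ 0) {h : ℂ} (h1 : h ∈ openSegment ℝ (q v) (q w))
    (h2 : h ∈ openSegment ℝ (p 0) (p 1)) (hx : AxisPerp (q w - q v) (p 1 - p 0))
    (hv : q v ∉ segment ℝ (p 0) (p 1)) (hw : q w ∉ segment ℝ (p 0) (p 1))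
    (ho : ∀ j < n, j ≠ 0 → Disjoint (segment ℝ (q v) (q w)) (segment ℝ (p j) (p (j + 1)))) :
    False := by
  have hv' : ∀ j < n, q v ∉ segment ℝ (p j) (p (j + 1)) := by
    intro j hj
    rcases eq_or_ne j 0 with rfl | hj0
    · exact hv
    · exact Set.disjoint_left.mp (ho j hj hj0) (left_mem_segment _ _ _)
  have hw' : ∀ j < n, q w ∉ segment ℝ (p j) (p (j + 1)) := by
    intro j hj
    rcases eq_or_ne j 0 with rfl | hj0
    · exact hw
    · exact Set.disjoint_left.mp (ho j hj hj0) (right_mem_segment _ _ _)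
  -- A single crossing changes the winding sum, whereas both ends must have winding sum zero.
  refine windingSum_ne_of_crossing hp hn h1 h2 (hx.det_ne (H.sub_ne hvw) h10) ho ?_
  rw [H.outer p n hp hc v hv', H.outer p n hp hc w hw']

end AxisDrawing


/-! ### A single copy of K_{2,3} with its crossing -/

/-- A copy of `K_{2,3}` in a drawing, in which the edges `sa` and `tb` cross at `c`. -/
structure Gadget {V : Type*} (G : SimpleGraph V) (q : V → ℂ) (s t a b d : V) (c : ℂ) : Prop where
  drawing : AxisDrawing G q
  adj_sa : G.Adj s a
  adj_ta : G.Adj t a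
  adj_sb : G.Adj s b
  adj_tb : G.Adj t b
  adj_sd : G.Adj s d
  adj_td : G.Adj t d
  hst : s ≠ t
  hab : a ≠ b
  had : a ≠ d
  hbd : b ≠ d
  nbr_a : ∀ w, G.Adj a w → w = s ∨ w = t
  nbr_b : ∀ w, G.Adj b w → w = s ∨ w = t
  nbr_d : ∀ w, G.Adj d w → w = s ∨ w = t
  mem_sa : c ∈ openSegment ℝ (q s) (q a)
  mem_tb : c ∈ openSegment ℝ (q t) (q b)

namespace Gadget

variable {V : Type*} {G : SimpleGraph V} {q : V → ℂ} {s t a b d : V} {c : ℂ}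

theorem symm (g : Gadget G q s t a b d c) : Gadget G q t s b a d c where
  drawing := g.drawing
  adj_sa := g.adj_tb
  adj_ta := g.adj_sb
  adj_sb := g.adj_ta
  adj_tb := g.adj_sa
  adj_sd := g.adj_td
  adj_td := g.adj_sd
  hst := g.hst.symm
  hab := g.hab.symm
  had := g.hbd
  hbd := g.had
  nbr_a w h := (g.nbr_b w h).symm
  nbr_b w h := (g.nbr_a w h).symm
  nbr_d w h := (g.nbr_d w h).symm
  mem_sa := g.mem_tb
  mem_tb := g.mem_sa

theorem edge_ne (g : Gadget G q s t a b d c) : s(s, a) ≠ s(t, b) := by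
  intro e
  rcases Sym2.eq_iff.mp e with ⟨h, -⟩ | ⟨h, -⟩
  exacts [g.hst h, g.adj_sb.ne h]

theorem perp_edges (g : Gadget G q s t a b d c) : AxisPerp (q a - q s) (q b - q t) :=
  g.drawing.axisPerp g.adj_sa g.adj_tb g.edge_ne g.mem_sa g.mem_tb

theorem sub_left (g : Gadget G q s t a b d c) : ∃ r : ℝ, 0 < r ∧ c - q s = r * (q a - q s) := by
  obtain ⟨r, h0, -, h, -⟩ := exists_of_mem_openSegment g.mem_sa
  exact ⟨r, h0, h⟩

theorem sub_left_ne (g : Gadget G q s t a b d c) : c - q s ≠ 0 := by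
  obtain ⟨r, h0, h⟩ := g.sub_left
  rw [h]
  exact mul_ne_zero (by exact_mod_cast h0.ne') (g.drawing.sub_ne g.adj_sa.ne)

theorem perp (g : Gadget G q s t a b d c) : AxisPerp (c - q s) (c - q t) := by
  obtain ⟨r, h0, h⟩ := g.sub_left
  obtain ⟨r', h0', h'⟩ := g.symm.sub_left
  rw [h, h']
  exact ((g.perp_edges.real_mul_left r).symm.real_mul_left r').symm

/-- The segment from `t` to `a` is the hypotenuse of the right triangle with axis-parallel legs `tc`
and `ca`. Hence `ta`, and by symmetry `sb`, cannot take part in a crossing. -/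
theorem not_axis (g : Gadget G q s t a b d c) : (q a - q t).re ≠ 0 ∧ (q a - q t).im ≠ 0 := by
  obtain ⟨r, h0, h1, h, h'⟩ := exists_of_mem_openSegment g.mem_sa
  have hne := g.drawing.sub_ne g.adj_sa.ne
  have hne' := g.symm.sub_left_ne
  have e : q a - q t = (1 - r : ℝ) * (q a - q s) + (c - q t) := by rw [← h']; ring
  have er := congrArg Complex.re e
  have ei := congrArg Complex.im e
  rw [Complex.add_re, Complex.re_ofReal_mul] at er
  rw [Complex.add_im, Complex.im_ofReal_mul] at ei
  have hr : (1 - r) ≠ 0 := by linarith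
  have hp : AxisPerp (q a - q s) (c - q t) := by
    obtain ⟨r', h0', h'⟩ := g.symm.sub_left
    rw [h']
    exact (g.perp_edges.symm.real_mul_left r').symm
  rw [er, ei]
  rcases hp with ⟨h2, h3⟩ | ⟨h2, h3⟩
  · rw [h2, h3, mul_zero, zero_add, add_zero]
    exact ⟨fun h => hne' (Complex.ext h h3), mul_ne_zero hr fun h => hne (Complex.ext h2 h)⟩
  · rw [h2, h3, mul_zero, zero_add, add_zero]
    exact ⟨mul_ne_zero hr fun h => hne (Complex.ext h h2), fun h => hne' (Complex.ext h3 h)⟩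

theorem uncrossed_ta (g : Gadget G q s t a b d c) {v w : V} (h : G.Adj v w)
    (hne : s(t, a) ≠ s(v, w)) :
    Disjoint (openSegment ℝ (q t) (q a)) (openSegment ℝ (q v) (q w)) :=
  g.drawing.disjoint_of_not_axis g.adj_ta h g.not_axis.1 g.not_axis.2 hne

theorem uncrossed_sb (g : Gadget G q s t a b d c) {v w : V} (h : G.Adj v w)
    (hne : s(s, b) ≠ s(v, w)) :
    Disjoint (openSegment ℝ (q s) (q b)) (openSegment ℝ (q v) (q w)) :=
  g.symm.uncrossed_ta h hne

theorem segment_subset_tb (g : Gadget G q s t a b d c) :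
    segment ℝ c (q b) ⊆ segment ℝ (q t) (q b) :=
  (convex_segment _ _).segment_subset (openSegment_subset_segment _ _ _ g.mem_tb)
    (right_mem_segment _ _ _)

theorem segment_subset_sa (g : Gadget G q s t a b d c) :
    segment ℝ (q s) c ⊆ segment ℝ (q s) (q a) := segment_subset_left g.mem_sa

theorem segment_subset_ct (g : Gadget G q s t a b d c) :
    segment ℝ c (q t) ⊆ segment ℝ (q t) (q b) := by
  rw [segment_symm]; exact g.symm.segment_subset_sa

/-- The edge `sa` is crossed by `tb` only. -/
theorem uncrossed_sa (g : Gadget G q s t a b d c) {v w : V} (h : G.Adj v w)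
    (hne : s(s, a) ≠ s(v, w)) (hne' : s(t, b) ≠ s(v, w)) :
    Disjoint (openSegment ℝ (q s) (q a)) (openSegment ℝ (q v) (q w)) := by
  have H := g.drawing
  rw [Set.disjoint_left]
  intro z hz hz'
  have hP := H.axisPerp g.adj_sa h hne hz hz'
  have h0 := H.sub_ne g.adj_sa.ne
  have h0' := H.sub_ne g.adj_tb.ne
  have h0'' := H.sub_ne h.ne
  -- An edge crossing `sa` is parallel to `tb`, so it does not cross `tb` as well.
  have hntb : Disjoint (openSegment ℝ (q t) (q b)) (openSegment ℝ (q v) (q w)) := by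
    rw [Set.disjoint_left]
    intro y hy hy'
    exact g.perp_edges.not_axisPerp hP h0 h0' h0'' (H.axisPerp g.adj_tb h hne' hy hy')
  have hzc : z ≠ c := by
    rintro rfl
    exact Set.disjoint_left.mp hntb g.mem_tb hz'
  obtain ⟨n1, n2, n3, n4⟩ := H.ne_of_cross g.adj_sa h hne hz hz'
  -- An edge at `t` that crosses `sa` would run along the line of `tb` and meet `sa` at `c`.
  have ht : ∀ {v w}, G.Adj v w → z ∈ openSegment ℝ (q v) (q w) →
      AxisPerp (q a - q s) (q w - q v) → t ≠ v := by
    rintro _ w h hz' hP rfl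
    apply hzc
    have m1 := openSegment_subset_segment _ _ _ hz
    have m2 := openSegment_subset_segment _ _ _ hz'
    have m3 := openSegment_subset_segment _ _ _ g.mem_sa
    have m4 := openSegment_subset_segment _ _ _ g.mem_tb
    have hQ := g.perp_edges
    have h0'' := H.sub_ne h.ne
    rcases hP with ⟨h1, h2⟩ | ⟨h1, h2⟩ <;> rcases hQ with ⟨h3, h4⟩ | ⟨h3, h4⟩
    · exact Complex.ext ((re_eq_of_mem_segment m1 h1).trans (re_eq_of_mem_segment m3 h1).symm)
        ((im_eq_of_mem_segment m2 h2).trans (im_eq_of_mem_segment m4 h4).symm)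
    · exact absurd (Complex.ext h1 h3) h0
    · exact absurd (Complex.ext h3 h1) h0
    · exact Complex.ext ((re_eq_of_mem_segment m2 h2).trans (re_eq_of_mem_segment m4 h4).symm)
        ((im_eq_of_mem_segment m1 h1).trans (im_eq_of_mem_segment m3 h1).symm)
  have n5 : t ≠ v := ht h hz' hP
  have n6 : t ≠ w := by
    refine ht h.symm (by rwa [openSegment_symm]) ?_
    have := (hP.symm.real_mul_left (-1)).symm
    simpa using this
  have hb : ∀ {v w}, G.Adj v w → s ≠ w → s(t, b) ≠ s(v, w) → b ≠ v := by
    rintro _ w h hs hne rfl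
    rcases g.nbr_b w h with rfl | rfl
    exacts [hs rfl, hne Sym2.eq_swap]
  have n7 : b ≠ v := hb h n2 hne'
  have n8 : b ≠ w := hb h.symm n1 (by rwa [Sym2.eq_swap (a := w)])
  have dtb := H.disjoint_segment g.adj_tb h hntb n5 n6 n7 n8
  have dsb := H.disjoint_segment g.adj_sb h (g.uncrossed_sb h (by
    intro e; rcases Sym2.eq_iff.mp e with ⟨e, -⟩ | ⟨e, -⟩
    exacts [n1 e, n2 e])) n1 n2 n7 n8
  have dta := H.disjoint_segment g.adj_ta h (g.uncrossed_ta h (by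
    intro e; rcases Sym2.eq_iff.mp e with ⟨e, -⟩ | ⟨e, -⟩
    exacts [n5 e, n6 e])) n5 n6 n3 n4
  have nv : ∀ x ∈ segment ℝ (q s) (q a), x ≠ q v ∧ x ≠ q w := by
    intro x hx
    constructor
    · rintro rfl
      rcases H.eq_of_mem_segment g.adj_sa hx with e | e
      exacts [n1 e.symm, n3 e.symm]
    · rintro rfl
      rcases H.eq_of_mem_segment g.adj_sa hx with e | e
      exacts [n2 e.symm, n4 e.symm]
  have hca : segment ℝ c (q a) ⊆ segment ℝ (q s) (q a) := g.symm.segment_subset_tb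
  obtain ⟨r, hr0, hr1, hr, hr'⟩ := exists_of_mem_openSegment g.mem_sa
  have hc : c ∈ Set.range (AffineMap.lineMap (q s) (q a) : ℝ → ℂ) := by
    refine ⟨r, ?_⟩
    rw [AffineMap.lineMap_apply, vsub_eq_sub, vadd_eq_add, Complex.real_smul, ← hr]; ring
  -- Depending on the side of `c` on which the crossing lies, the edge enters the triangle `s c b`
  -- or the triangle `c a t`, whose other two sides it cannot meet.
  rcases openSegment_subset_union _ _ hc hz with hz1 | hz1 | hz1
  · exact hzc hz1
  · refine H.not_enter (p := triangle (q s) c (q b)) (n := 3) rfl ?_ h.ne (by norm_num)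
      g.sub_left_ne hz' hz1 ?_ ?_ ?_ ?_
    · intro j hj
      interval_cases j <;> simp only [triangle] <;> norm_num
      exacts [⟨s, a, g.adj_sa, g.segment_subset_sa⟩, ⟨t, b, g.adj_tb, g.segment_subset_tb⟩,
        ⟨b, s, g.adj_sb.symm, le_rfl⟩]
    · have := (hP.real_mul_left r).symm
      rwa [← hr] at this
    · exact fun hm => (nv _ (g.segment_subset_sa hm)).1 rfl
    · exact fun hm => (nv _ (g.segment_subset_sa hm)).2 rfl
    · intro j hj hj0
      obtain rfl | rfl : j = 1 ∨ j = 2 := by omega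
      all_goals simp only [triangle]; norm_num
      · exact (dtb.mono_left g.segment_subset_tb).symm
      · rw [segment_symm ℝ (q b)]; exact dsb.symm
  · refine H.not_enter (p := triangle c (q a) (q t)) (n := 3) rfl ?_ h.ne (by norm_num)
      ?_ hz' hz1 ?_ ?_ ?_ ?_
    · intro j hj
      interval_cases j <;> simp only [triangle] <;> norm_num
      exacts [⟨s, a, g.adj_sa, hca⟩, ⟨a, t, g.adj_ta.symm, le_rfl⟩,
        ⟨b, t, g.adj_tb.symm, by
          rw [segment_symm ℝ (q b)]; exact g.symm.segment_subset_sa⟩]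
    · change q a - c ≠ 0
      rw [hr']
      exact mul_ne_zero (by exact_mod_cast (by linarith : (1 - r) ≠ 0)) h0
    · have := (hP.real_mul_left (1 - r)).symm
      rwa [← hr'] at this
    · exact fun hm => (nv _ (hca hm)).1 rfl
    · exact fun hm => (nv _ (hca hm)).2 rfl
    · intro j hj hj0
      obtain rfl | rfl : j = 1 ∨ j = 2 := by omega
      all_goals simp only [triangle]; norm_num
      · rw [segment_symm ℝ (q a)]; exact dta.symm
      · rw [segment_symm ℝ (q t)]; exact (dtb.mono_left g.segment_subset_ct).symm

theorem uncrossed_tb (g : Gadget G q s t a b d c) {v w : V} (h : G.Adj v w)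
    (hne : s(s, a) ≠ s(v, w)) (hne' : s(t, b) ≠ s(v, w)) :
    Disjoint (openSegment ℝ (q t) (q b)) (openSegment ℝ (q v) (q w)) :=
  g.symm.uncrossed_sa h hne' hne

/-- Only edges at `s` cross the edge `td`. -/
theorem eq_of_cross_td (g : Gadget G q s t a b d c) {v w : V} (h : G.Adj v w)
    (hne : s(t, d) ≠ s(v, w)) {z : ℂ} (hz : z ∈ openSegment ℝ (q t) (q d))
    (hz' : z ∈ openSegment ℝ (q v) (q w)) : s = v ∨ s = w := by
  by_contra hcon
  push Not at hcon
  obtain ⟨m1, m2⟩ := hcon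
  have H := g.drawing
  obtain ⟨n1, n2, n3, n4⟩ := H.ne_of_cross g.adj_td h hne hz hz'
  have ha : ∀ {v w}, G.Adj v w → s ≠ w → t ≠ w → a ≠ v := by
    rintro _ w h hs ht rfl
    rcases g.nbr_a w h with rfl | rfl <;> contradiction
  have hb : ∀ {v w}, G.Adj v w → s ≠ w → t ≠ w → b ≠ v := by
    rintro _ w h hs ht rfl
    rcases g.nbr_b w h with rfl | rfl <;> contradiction
  have ne : ∀ {x y}, x ≠ v → x ≠ w → s(x, y) ≠ s(v, w) := by
    intro x y h1 h2 e
    rcases Sym2.eq_iff.mp e with ⟨e, -⟩ | ⟨e, -⟩ <;> contradiction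
  have hP := H.axisPerp g.adj_td h hne hz hz'
  have dsa := H.disjoint_segment g.adj_sa h (g.uncrossed_sa h (ne m1 m2) (ne n1 n2)) m1 m2
    (ha h m2 n2) (ha h.symm m1 n1)
  have dtb := H.disjoint_segment g.adj_tb h (g.uncrossed_tb h (ne m1 m2) (ne n1 n2)) n1 n2
    (hb h m2 n2) (hb h.symm m1 n1)
  -- An edge crossing both `td` and `sd` would make these parallel to one axis, and then `s - t` as
  -- well; but `st` is the hypotenuse of the right triangle `s c t`.
  have dsd : Disjoint (segment ℝ (q s) (q d)) (segment ℝ (q v) (q w)) := by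
    refine H.disjoint_segment g.adj_sd h ?_ m1 m2 n3 n4
    rw [Set.disjoint_left]
    intro y hy hy'
    have hP' := H.axisPerp g.adj_sd h (ne m1 m2) hy hy'
    have h0 := H.sub_ne h.ne
    have e : q s - q t = (c - q t) - (c - q s) := by ring
    have l1 := g.sub_left_ne
    have l2 := g.symm.sub_left_ne
    have er := congrArg Complex.re e
    have ei := congrArg Complex.im e
    simp only [Complex.sub_re, Complex.sub_im] at er ei
    rcases hP with ⟨h1, h2⟩ | ⟨h1, h2⟩ <;> rcases hP' with ⟨h3, h4⟩ | ⟨h3, h4⟩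
    · rcases g.perp with ⟨h5, h6⟩ | ⟨h5, h6⟩
      · refine l2 (Complex.ext ?_ h6)
        simp only [Complex.sub_re, Complex.zero_re] at *; linarith
      · refine l1 (Complex.ext ?_ h5)
        simp only [Complex.sub_re, Complex.zero_re] at *; linarith
    · exact h0 (Complex.ext h4 h2)
    · exact h0 (Complex.ext h2 h4)
    · rcases g.perp with ⟨h5, h6⟩ | ⟨h5, h6⟩
      · refine l1 (Complex.ext h5 ?_)
        simp only [Complex.sub_im, Complex.zero_im] at *; linarith
      · refine l2 (Complex.ext h6 ?_)
        simp only [Complex.sub_im, Complex.zero_im] at *; linarith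
  have nv : ∀ {x}, (x = v ∨ x = w) → q x ∉ segment ℝ (q t) (q d) := by
    intro x hx hm
    rcases H.eq_of_mem_segment g.adj_td hm with rfl | rfl <;> rcases hx with rfl | rfl <;>
      contradiction
  -- The edge would enter the quadrilateral `t d s c` through `td` and could not leave it.
  refine H.not_enter (p := quad (q t) (q d) (q s) c) (n := 4) rfl ?_ h.ne (by norm_num)
    (H.sub_ne g.adj_td.ne) hz' hz hP.symm (nv (.inl rfl)) (nv (.inr rfl)) ?_
  · intro j hj
    interval_cases j <;> simp only [quad] <;> norm_num
    exacts [⟨t, d, g.adj_td, le_rfl⟩, ⟨d, s, g.adj_sd.symm, le_rfl⟩,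
      ⟨s, a, g.adj_sa, g.segment_subset_sa⟩, ⟨t, b, g.adj_tb, g.segment_subset_ct⟩]
  · intro j hj hj0
    obtain rfl | rfl | rfl : j = 1 ∨ j = 2 ∨ j = 3 := by omega
    all_goals simp only [quad]; norm_num
    · rw [segment_symm ℝ (q d)]; exact dsd.symm
    · exact (dsa.mono_left g.segment_subset_sa).symm
    · exact (dtb.mono_left g.segment_subset_ct).symm

end Gadget


/-! ### Further edges at s and their crossings with td -/

namespace Gadget

variable {V : Type*} {G : SimpleGraph V} {q : V → ℂ} {s t a b d : V} {c : ℂ}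

/-- An edge at `s` that crosses `td` is parallel to `ct`. -/
theorem sub_eq_of_cross (g : Gadget G q s t a b d c) {w : V} (h : G.Adj s w)
    {z : ℂ} (hz : z ∈ openSegment ℝ (q t) (q d)) (hz' : z ∈ openSegment ℝ (q s) (q w)) :
    ∃ r : ℝ, 0 < r ∧ q w - q s = r * (q t - c) := by
  have H := g.drawing
  have hne : s(t, d) ≠ s(s, w) := by
    intro e
    rcases Sym2.eq_iff.mp e with ⟨e, -⟩ | ⟨-, e⟩
    exacts [g.hst e.symm, g.adj_sd.ne e.symm]
  have hP := H.axisPerp g.adj_td h hne hz hz'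
  have m1 := openSegment_subset_segment _ _ _ hz
  have m2 := openSegment_subset_segment _ _ _ hz'
  have hzc : z ≠ c := by
    rintro rfl
    exact Set.disjoint_left.mp (H.not_cross_of_common g.adj_tb g.adj_td g.hbd) g.mem_tb hz
  obtain ⟨r, hr0, hr1, hr, -⟩ := exists_of_mem_openSegment hz'
  refine ⟨r⁻¹, inv_pos.mpr hr0, ?_⟩
  -- If `td` is perpendicular to `tb`, then `s`, `c`, `t`, `z` are the corners of a rectangle. If it
  -- is parallel to `tb`, then `sw` lies on the line of `sa`, and the crossing would be `c`.
  have key : z - q s = q t - c := by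
    have k1 := g.perp
    simp only [AxisPerp, Complex.sub_re, Complex.sub_im] at k1
    rcases hP with ⟨h1, h2⟩ | ⟨h1, h2⟩ <;> rcases k1 with ⟨h3, h4⟩ | ⟨h3, h4⟩
    · have e1 := re_eq_of_mem_segment m1 h1
      have e2 := im_eq_of_mem_segment m2 h2
      refine Complex.ext ?_ ?_ <;> simp only [Complex.sub_re, Complex.sub_im] <;> linarith
    · have e1 := re_eq_of_mem_segment m1 h1
      have e2 := im_eq_of_mem_segment m2 h2
      exact absurd (Complex.ext (by linarith) (by linarith)) hzc
    · have e1 := im_eq_of_mem_segment m1 h1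
      have e2 := re_eq_of_mem_segment m2 h2
      exact absurd (Complex.ext (by linarith) (by linarith)) hzc
    · have e1 := im_eq_of_mem_segment m1 h1
      have e2 := re_eq_of_mem_segment m2 h2
      refine Complex.ext ?_ ?_ <;> simp only [Complex.sub_re, Complex.sub_im] <;> linarith
  have hr0' : (r : ℂ) ≠ 0 := by exact_mod_cast hr0.ne'
  rw [← key, hr]
  push_cast
  field_simp

theorem dirNe_left (g : Gadget G q s t a b d c) {w : V} (h : G.Adj s w) (hwa : w ≠ a) :
    DirNe (c - q s) (q w - q s) := by
  obtain ⟨r, h0, e⟩ := g.sub_left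
  rw [e]
  exact (g.drawing.dirNe g.adj_sa h hwa.symm).real_mul_left h0

theorem disjoint_segment_tb (g : Gadget G q s t a b d c) {w : V} (h : G.Adj s w) (hwa : w ≠ a)
    (hwb : w ≠ b) (hwt : w ≠ t) : Disjoint (segment ℝ (q s) (q w)) (segment ℝ (q t) (q b)) := by
  refine (g.drawing.disjoint_segment g.adj_tb h (g.uncrossed_tb h ?_ ?_) g.hst.symm hwt.symm
    g.adj_sb.ne.symm hwb.symm).symm
  · intro e
    rcases Sym2.eq_iff.mp e with ⟨-, e⟩ | ⟨-, e⟩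
    exacts [hwa e.symm, g.adj_sa.ne e.symm]
  · intro e
    rcases Sym2.eq_iff.mp e with ⟨e, -⟩ | ⟨-, e⟩
    exacts [g.hst e.symm, g.adj_sb.ne e.symm]

theorem notMem_sa (g : Gadget G q s t a b d c) {w : V} (hws : w ≠ s) (hwa : w ≠ a) :
    q w ∉ segment ℝ (q s) c := by
  intro hm
  rcases g.drawing.eq_of_mem_segment g.adj_sa (g.segment_subset_sa hm) with e | e
  exacts [hws e, hwa e]

/-- The triangle `scb` lies on one side of every further edge at `s`. -/
theorem cyc_eq (g : Gadget G q s t a b d c) {w : V} (h : G.Adj s w) (hwa : w ≠ a)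
    (hwb : w ≠ b) (hwt : w ≠ t) :
    cyc (q b - q s) (c - q s) (q w - q s) = Complex.arg (-(q b - q s) / (c - q s)) -
      Complex.arg ((q b - q s) / (c - q s)) := by
  have H := g.drawing
  have hd := (g.disjoint_segment_tb h hwa hwb hwt).mono_right g.segment_subset_tb
  have e := windingSum_eq_vertexSum (p := triangle (q s) c (q b)) (m := 1) (z := q w)
    rfl (H.dirNe g.adj_sb h hwb.symm)
    (by rw [segment_symm]; exact g.dirNe_left h hwa)
    (by intro j hj
        obtain rfl : j = 0 := by omega
        exact hd)
  rw [H.outer (triangle (q s) c (q b)) (1 + 2) rfl] at e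
  · have e0 : vertexSum (triangle (q s) c (q b)) 1 = Complex.arg ((q b - q s) / (c - q s)) := by
      rw [vertexSum, Finset.sum_range_one]; rfl
    have e1 : triangle (q s) c (q b) 0 = q s := rfl
    have e2 : triangle (q s) c (q b) 1 = c := rfl
    have e3 : triangle (q s) c (q b) (1 + 1) = q b := rfl
    rw [e0, e1, e2, e3] at e
    rw [cyc]
    linarith
  · intro j hj
    interval_cases j <;> simp only [triangle] <;> norm_num
    exacts [⟨s, a, g.adj_sa, g.segment_subset_sa⟩, ⟨t, b, g.adj_tb, g.segment_subset_tb⟩,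
        ⟨b, s, g.adj_sb.symm, le_rfl⟩]
  · intro j hj
    interval_cases j <;> simp only [triangle] <;> norm_num
    · exact g.notMem_sa h.ne.symm hwa
    · exact Set.disjoint_left.mp hd (right_mem_segment _ _ _)
    · rw [segment_symm]
      intro hm
      rcases H.eq_of_mem_segment g.adj_sb hm with e | e
      exacts [h.ne e.symm, hwb e]

/-- The part of the quadrilateral `sctd` at `s` in terms of an edge at `s` that does not cross
`td`. -/
theorem cyc_quad (g : Gadget G q s t a b d c) {w : V} (h : G.Adj s w) (hwa : w ≠ a) (hwd : w ≠ d)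
    (hwt : w ≠ t) (hx : Disjoint (openSegment ℝ (q s) (q w)) (openSegment ℝ (q t) (q d))) :
    cyc (q d - q s) (c - q s) (q w - q s) = Complex.arg (-(q d - q s) / (c - q s)) -
      vertexSum (quad (q s) c (q t) (q d)) 2 := by
  have H := g.drawing
  have hd1 : Disjoint (segment ℝ (q s) (q w)) (segment ℝ c (q t)) := by
    by_cases hwb : w = b
    · subst hwb
      rw [Set.disjoint_left]
      intro z hz hz'
      have hz2 := g.segment_subset_ct hz'
      rw [segment_symm] at hz hz2
      have := H.eq_of_mem_common g.adj_sb.symm g.adj_tb.symm g.hst hz hz2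
      subst this
      have hm := g.mem_tb
      rw [openSegment_symm] at hm
      exact left_notMem_segment hm (fun e => g.adj_tb.ne (H.injective e).symm) hz'
    · exact (g.disjoint_segment_tb h hwa hwb hwt).mono_right g.segment_subset_ct
  have hd2 : Disjoint (segment ℝ (q s) (q w)) (segment ℝ (q t) (q d)) :=
    H.disjoint_segment h g.adj_td hx g.hst g.adj_sd.ne hwt hwd
  have e := windingSum_eq_vertexSum (p := quad (q s) c (q t) (q d)) (m := 2) (z := q w)
    rfl (H.dirNe g.adj_sd h hwd.symm)
    (by rw [segment_symm]; exact g.dirNe_left h hwa)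
    (by intro j hj
        obtain rfl | rfl : j = 0 ∨ j = 1 := by omega
        exacts [hd1, hd2])
  rw [H.outer (quad (q s) c (q t) (q d)) (2 + 2) rfl] at e
  · have e1 : quad (q s) c (q t) (q d) 0 = q s := rfl
    have e2 : quad (q s) c (q t) (q d) 1 = c := rfl
    have e3 : quad (q s) c (q t) (q d) (2 + 1) = q d := rfl
    rw [e1, e2, e3] at e
    rw [cyc]
    linarith
  · intro j hj
    interval_cases j <;> simp only [quad] <;> norm_num
    exacts [⟨s, a, g.adj_sa, g.segment_subset_sa⟩, ⟨t, b, g.adj_tb, g.segment_subset_ct⟩,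
        ⟨t, d, g.adj_td, le_rfl⟩, ⟨d, s, g.adj_sd.symm, le_rfl⟩]
  · intro j hj
    interval_cases j <;> simp only [quad] <;> norm_num
    · exact g.notMem_sa h.ne.symm hwa
    · exact Set.disjoint_left.mp hd1 (right_mem_segment _ _ _)
    · exact Set.disjoint_left.mp hd2 (right_mem_segment _ _ _)
    · rw [segment_symm]
      intro hm
      rcases H.eq_of_mem_segment g.adj_sd hm with e | e
      exacts [h.ne e.symm, hwd e]

/-- If `b` and `d` are on the same side of a path through `w`, `s`, `c`, then the edge `sw` crosses
the edge `td`. -/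
theorem exists_cross (g : Gadget G q s t a b d c) {w : V} (h : G.Adj s w) (hwa : w ≠ a)
    (hwb : w ≠ b) (hwd : w ≠ d) (hwt : w ≠ t)
    (hc : cyc (q w - q s) (c - q s) (q b - q s) = cyc (q w - q s) (c - q s) (q d - q s)) :
    ∃ z ∈ openSegment ℝ (q t) (q d), z ∈ openSegment ℝ (q s) (q w) := by
  by_contra hcon
  push Not at hcon
  have H := g.drawing
  have hx : Disjoint (openSegment ℝ (q s) (q w)) (openSegment ℝ (q t) (q d)) :=
    Set.disjoint_left.mpr fun z h1 h2 => hcon z h2 h1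
  -- Four order relations at `s`. The triangle `s c b` has `w` and `d` on the same side (`t1`,
  -- `t2`); without a crossing the quadrilateral `s c t d` has `w` and `b` on the same side (`t3`,
  -- `t4`). With `hc` they make `cyc` of the directions to `b`, `c`, `d` equal to its negative.
  have t1 := g.cyc_eq h hwa hwb hwt
  have t2 := g.cyc_eq g.adj_sd g.had.symm g.hbd.symm g.adj_td.ne.symm
  have t3 := g.cyc_quad h hwa hwd hwt hx
  have t4 := g.cyc_quad g.adj_sb g.hab.symm g.hbd g.adj_tb.ne.symm (g.uncrossed_sb g.adj_td (by
    intro e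
    rcases Sym2.eq_iff.mp e with ⟨e, -⟩ | ⟨e, -⟩
    exacts [g.hst e, g.adj_sd.ne e]))
  have dub := g.dirNe_left g.adj_sb g.hab.symm
  have dud := g.dirNe_left g.adj_sd g.had.symm
  have duw := g.dirNe_left h hwa
  have dbd := H.dirNe g.adj_sb g.adj_sd g.hbd
  have dbw := H.dirNe g.adj_sb h hwb.symm
  have ddw := H.dirNe g.adj_sd h hwd.symm
  have k1 := cyc_swap dud.symm duw ddw
  have k2 := cyc_swap dub.symm dud dbd
  have k3 := cyc_swap dub.symm duw dbw
  have r1 := cyc_rotate (c - q s) (q d - q s) (q w - q s)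
  have r2 := cyc_rotate (q d - q s) (q w - q s) (c - q s)
  have r3 := cyc_rotate (c - q s) (q b - q s) (q d - q s)
  have r4 := cyc_rotate (q b - q s) (q d - q s) (c - q s)
  have r5 := cyc_rotate (c - q s) (q b - q s) (q w - q s)
  have r6 := cyc_rotate (q b - q s) (q w - q s) (c - q s)
  have ab := cyc_eq_or dub.symm dud dbd
  have hpi := Real.pi_pos
  rcases ab with ab | ab <;> linarith

end Gadget


theorem zero_notMem_segment {x y z : ℂ} (h : DirNe (x - y) (z - y)) :
    (0 : ℂ) ∉ segment ℝ (y - x) (z - y) := by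
  rw [dirNe_iff] at h
  rwa [mem_segment_iff_sameRay, zero_sub, neg_sub, sub_zero]

theorem AxisPerp.dirNe {x y : ℂ} (h : AxisPerp x y) (hx : x ≠ 0) (hy : y ≠ 0) : DirNe x y := by
  rw [dirNe_iff]
  intro hr
  obtain ⟨r, hr0, rfl⟩ := hr.exists_pos_left hx hy
  rw [Complex.real_smul] at h hy
  rcases h with ⟨h1, h2⟩ | ⟨h1, h2⟩
  · rw [Complex.im_ofReal_mul] at h2
    exact hx (Complex.ext h1 ((mul_eq_zero.mp h2).resolve_left hr0.ne'))
  · rw [Complex.re_ofReal_mul] at h2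
    exact hx (Complex.ext ((mul_eq_zero.mp h2).resolve_left hr0.ne') h1)

theorem Gadget.disjoint_sa {V : Type*} {G : SimpleGraph V} {q : V → ℂ} {s t a b d : V} {c : ℂ}
    (g : Gadget G q s t a b d c) {v w : V} (h : G.Adj v w) (h1 : s ≠ v) (h2 : s ≠ w) (h3 : a ≠ v)
    (h4 : a ≠ w) (hne : s(t, b) ≠ s(v, w)) :
    Disjoint (segment ℝ (q s) c) (segment ℝ (q v) (q w)) := by
  refine (g.drawing.disjoint_segment g.adj_sa h (g.uncrossed_sa h ?_ hne) h1 h2 h3 h4).mono_left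
    g.segment_subset_sa
  intro e
  rcases Sym2.eq_iff.mp e with ⟨e, -⟩ | ⟨e, -⟩ <;> contradiction

/-! ### Cycles of gadgets -/

/-- Copies of `K_{2,3}` in a drawing that are connected in cyclic order by links which do not cross
each other. -/
structure GadgetCycle {V : Type*} (G : SimpleGraph V) (q : V → ℂ) (k : ℕ) (idx : V → ZMod k)
    (s t a b d : ZMod k → V) (c : ZMod k → ℂ) : Prop where
  gadget : ∀ i, Gadget G q (s i) (t i) (a i) (b i) (d i) (c i)
  link : ∀ i, G.Adj (t i) (s (i + 1))
  idx_s : ∀ i, idx (s i) = i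
  idx_t : ∀ i, idx (t i) = i
  idx_a : ∀ i, idx (a i) = i
  idx_b : ∀ i, idx (b i) = i
  idx_d : ∀ i, idx (d i) = i
  links : ∀ i j, i ≠ j → Disjoint (openSegment ℝ (q (t i)) (q (s (i + 1))))
    (openSegment ℝ (q (t j)) (q (s (j + 1))))

namespace GadgetCycle

variable {V : Type*} {G : SimpleGraph V} {q : V → ℂ} {k : ℕ} {idx : V → ZMod k}
  {s t a b d : ZMod k → V} {c : ZMod k → ℂ}

theorem ne_of_idx {v w : V} (h : idx v ≠ idx w) : v ≠ w := fun e => h (e ▸ rfl)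

theorem s_ne_t (g : GadgetCycle G q k idx s t a b d c) (i j : ZMod k) : s i ≠ t j := by
  by_cases h : i = j
  · subst h; exact (g.gadget i).hst
  · exact ne_of_idx (idx := idx) (by rw [g.idx_s, g.idx_t]; exact h)

theorem a_ne_s (g : GadgetCycle G q k idx s t a b d c) (i j : ZMod k) : a i ≠ s j := by
  by_cases h : i = j
  · subst h; exact (g.gadget i).adj_sa.ne.symm
  · exact ne_of_idx (idx := idx) (by rw [g.idx_s, g.idx_a]; exact h)

theorem a_ne_t (g : GadgetCycle G q k idx s t a b d c) (i j : ZMod k) : a i ≠ t j := by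
  by_cases h : i = j
  · subst h; exact (g.gadget i).adj_ta.ne.symm
  · exact ne_of_idx (idx := idx) (by rw [g.idx_t, g.idx_a]; exact h)

theorem b_ne_s (g : GadgetCycle G q k idx s t a b d c) (i j : ZMod k) : b i ≠ s j := by
  by_cases h : i = j
  · subst h; exact (g.gadget i).adj_sb.ne.symm
  · exact ne_of_idx (idx := idx) (by rw [g.idx_s, g.idx_b]; exact h)

theorem b_ne_t (g : GadgetCycle G q k idx s t a b d c) (i j : ZMod k) : b i ≠ t j := by
  by_cases h : i = j
  · subst h; exact (g.gadget i).adj_tb.ne.symm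
  · exact ne_of_idx (idx := idx) (by rw [g.idx_t, g.idx_b]; exact h)

theorem d_ne_s (g : GadgetCycle G q k idx s t a b d c) (i j : ZMod k) : d i ≠ s j := by
  by_cases h : i = j
  · subst h; exact (g.gadget i).adj_sd.ne.symm
  · exact ne_of_idx (idx := idx) (by rw [g.idx_s, g.idx_d]; exact h)

theorem d_ne_t (g : GadgetCycle G q k idx s t a b d c) (i j : ZMod k) : d i ≠ t j := by
  by_cases h : i = j
  · subst h; exact (g.gadget i).adj_td.ne.symm
  · exact ne_of_idx (idx := idx) (by rw [g.idx_t, g.idx_d]; exact h)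

theorem s_ne (g : GadgetCycle G q k idx s t a b d c) {i j : ZMod k} (h : i ≠ j) : s i ≠ s j :=
  ne_of_idx (idx := idx) (by rwa [g.idx_s, g.idx_s])

theorem t_ne (g : GadgetCycle G q k idx s t a b d c) {i j : ZMod k} (h : i ≠ j) : t i ≠ t j :=
  ne_of_idx (idx := idx) (by rwa [g.idx_t, g.idx_t])

/-- The half edge from `s i` to the crossing avoids an edge with vertices in other gadgets. -/
theorem disjoint_sc_of_idx (g : GadgetCycle G q k idx s t a b d c) {i : ZMod k} {v w : V}
    (h : G.Adj v w) (hv : idx v ≠ i) (hw : idx w ≠ i) :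
    Disjoint (segment ℝ (q (s i)) (c i)) (segment ℝ (q v) (q w)) := by
  have e1 := g.idx_s i
  have e2 := g.idx_t i
  have e3 := g.idx_a i
  refine (g.gadget i).disjoint_sa h ?_ ?_ ?_ ?_ ?_
  · exact ne_of_idx (e1 ▸ hv.symm)
  · exact ne_of_idx (e1 ▸ hw.symm)
  · exact ne_of_idx (e3 ▸ hv.symm)
  · exact ne_of_idx (e3 ▸ hw.symm)
  · intro e
    rcases Sym2.eq_iff.mp e with ⟨rfl, -⟩ | ⟨rfl, -⟩ <;> contradiction

theorem disjoint_ct_of_idx (g : GadgetCycle G q k idx s t a b d c) {i : ZMod k} {v w : V}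
    (h : G.Adj v w) (hv : idx v ≠ i) (hw : idx w ≠ i) :
    Disjoint (segment ℝ (c i) (q (t i))) (segment ℝ (q v) (q w)) := by
  have e1 := g.idx_s i
  have e2 := g.idx_t i
  have e3 := g.idx_b i
  rw [segment_symm]
  refine (g.gadget i).symm.disjoint_sa h ?_ ?_ ?_ ?_ ?_
  · exact ne_of_idx (e2 ▸ hv.symm)
  · exact ne_of_idx (e2 ▸ hw.symm)
  · exact ne_of_idx (e3 ▸ hv.symm)
  · exact ne_of_idx (e3 ▸ hw.symm)
  · intro e
    rcases Sym2.eq_iff.mp e with ⟨rfl, -⟩ | ⟨rfl, -⟩ <;> contradiction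

theorem disjoint_sc_link (g : GadgetCycle G q k idx s t a b d c) {i j : ZMod k} (h : i ≠ j + 1) :
    Disjoint (segment ℝ (q (s i)) (c i)) (segment ℝ (q (t j)) (q (s (j + 1)))) := by
  refine (g.gadget i).disjoint_sa (g.link j) (g.s_ne_t i j) (g.s_ne h) (g.a_ne_t i j)
    (g.a_ne_s i _) ?_
  intro e
  rcases Sym2.eq_iff.mp e with ⟨-, e⟩ | ⟨e, -⟩
  exacts [g.b_ne_s _ _ e, g.s_ne_t _ _ e.symm]

theorem disjoint_ct_link (g : GadgetCycle G q k idx s t a b d c) {i j : ZMod k} (h : i ≠ j) :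
    Disjoint (segment ℝ (c i) (q (t i))) (segment ℝ (q (t j)) (q (s (j + 1)))) := by
  rw [segment_symm]
  refine (g.gadget i).symm.disjoint_sa (g.link j) (g.t_ne h) (g.s_ne_t _ i).symm (g.b_ne_t i j)
    (g.b_ne_s i _) ?_
  intro e
  rcases Sym2.eq_iff.mp e with ⟨e, -⟩ | ⟨-, e⟩
  exacts [g.s_ne_t _ _ e, g.a_ne_t _ _ e]

theorem disjoint_link_link (g : GadgetCycle G q k idx s t a b d c) {i j : ZMod k} (h : i ≠ j) :
    Disjoint (segment ℝ (q (t i)) (q (s (i + 1)))) (segment ℝ (q (t j)) (q (s (j + 1)))) :=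
  (g.gadget i).drawing.disjoint_segment (g.link i) (g.link j) (g.links i j h) (g.t_ne h)
    (g.s_ne_t _ _).symm (g.s_ne_t _ _) (g.s_ne fun e => h (add_right_cancel e))

theorem disjoint_sc_sc (g : GadgetCycle G q k idx s t a b d c) {i j : ZMod k} (h : i ≠ j) :
    Disjoint (segment ℝ (q (s i)) (c i)) (segment ℝ (q (s j)) (c j)) :=
  (g.disjoint_sc_of_idx (g.gadget j).adj_sa (by rw [g.idx_s]; exact h.symm)
    (by rw [g.idx_a]; exact h.symm)).mono_right (g.gadget j).segment_subset_sa

theorem disjoint_sc_ct (g : GadgetCycle G q k idx s t a b d c) {i j : ZMod k} (h : i ≠ j) :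
    Disjoint (segment ℝ (q (s i)) (c i)) (segment ℝ (c j) (q (t j))) :=
  (g.disjoint_sc_of_idx (g.gadget j).adj_tb (by rw [g.idx_t]; exact h.symm)
    (by rw [g.idx_b]; exact h.symm)).mono_right (g.gadget j).segment_subset_ct

theorem disjoint_ct_ct (g : GadgetCycle G q k idx s t a b d c) {i j : ZMod k} (h : i ≠ j) :
    Disjoint (segment ℝ (c i) (q (t i))) (segment ℝ (c j) (q (t j))) :=
  (g.disjoint_ct_of_idx (g.gadget j).adj_tb (by rw [g.idx_t]; exact h.symm)
    (by rw [g.idx_b]; exact h.symm)).mono_right (g.gadget j).segment_subset_ct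

end GadgetCycle

/-! ### The polygon through the crossings and along the links -/

/-- The closed polygon `s 0, c 0, t 0, s 1, c 1, t 1, …`. -/
def cyclePolygon {k : ℕ} (s c t : ZMod k → ℂ) : ℕ → ℂ := fun j =>
  if j % 3 = 0 then s (j / 3 : ℕ) else if j % 3 = 1 then c (j / 3 : ℕ) else t (j / 3 : ℕ)

section cyclePolygon

variable {k : ℕ} (s c t : ZMod k → ℂ) (i : ℕ)

theorem cyclePolygon_zero : cyclePolygon s c t (3 * i) = s i := by
  rw [cyclePolygon, if_pos (by omega), show 3 * i / 3 = i by omega]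

theorem cyclePolygon_one : cyclePolygon s c t (3 * i + 1) = c i := by
  rw [cyclePolygon, if_neg (by omega), if_pos (by omega), show (3 * i + 1) / 3 = i by omega]

theorem cyclePolygon_two : cyclePolygon s c t (3 * i + 2) = t i := by
  rw [cyclePolygon, if_neg (by omega), if_neg (by omega), show (3 * i + 2) / 3 = i by omega]

theorem cyclePolygon_three : cyclePolygon s c t (3 * i + 3) = s (i + 1) := by
  rw [show 3 * i + 3 = 3 * (i + 1) by ring, cyclePolygon_zero]; push_cast; rfl

theorem cyclePolygon_four : cyclePolygon s c t (3 * i + 4) = c (i + 1) := by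
  rw [show 3 * i + 4 = 3 * (i + 1) + 1 by ring, cyclePolygon_one]; push_cast; rfl

theorem cyclePolygon_periodic (j : ℕ) :
    cyclePolygon s c t (j + 3 * k) = cyclePolygon s c t j := by
  have h1 : (j + 3 * k) % 3 = j % 3 := by omega
  have h2 : ((j + 3 * k) / 3 : ℕ) = j / 3 + k := by omega
  rw [cyclePolygon, cyclePolygon, h1, h2]
  simp

end cyclePolygon

theorem natCast_ne {k i j : ℕ} (h1 : i < j) (h2 : j < i + k) : (i : ZMod k) ≠ (j : ZMod k) := by
  intro e
  rw [ZMod.natCast_eq_natCast_iff] at e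
  have := (Nat.modEq_iff_dvd' h1.le).mp e
  have := Nat.le_of_dvd (by omega) this
  omega

theorem exists_three_mul (j : ℕ) : ∃ i, j = 3 * i ∨ j = 3 * i + 1 ∨ j = 3 * i + 2 :=
  ⟨j / 3, by omega⟩

namespace GadgetCycle

variable {V : Type*} {G : SimpleGraph V} {q : V → ℂ} {k : ℕ} {idx : V → ZMod k}
  {s t a b d : ZMod k → V} {c : ZMod k → ℂ}

theorem polygon_covered (g : GadgetCycle G q k idx s t a b d c) (j : ℕ) :
    ∃ u v, G.Adj u v ∧ segment ℝ (cyclePolygon (q ∘ s) c (q ∘ t) j)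
      (cyclePolygon (q ∘ s) c (q ∘ t) (j + 1)) ⊆ segment ℝ (q u) (q v) := by
  obtain ⟨i, rfl | rfl | rfl⟩ := exists_three_mul j
  · rw [cyclePolygon_zero, cyclePolygon_one]
    exact ⟨_, _, (g.gadget i).adj_sa, (g.gadget i).segment_subset_sa⟩
  · rw [cyclePolygon_one, cyclePolygon_two]
    exact ⟨_, _, (g.gadget i).adj_tb, (g.gadget i).segment_subset_ct⟩
  · rw [cyclePolygon_two, cyclePolygon_three]
    exact ⟨_, _, g.link i, le_rfl⟩

/-- The half edges `sc` and `ct` lie on edges whose only crossing is the one at `c`, and links do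
not cross each other by assumption, so sides that are not consecutive on the cycle are disjoint. -/
theorem polygon_disjoint (g : GadgetCycle G q k idx s t a b d c) (i j : ℕ) (h1 : i + 2 ≤ j)
    (h2 : j + 2 ≤ i + 3 * k) :
    Disjoint (segment ℝ (cyclePolygon (q ∘ s) c (q ∘ t) i)
      (cyclePolygon (q ∘ s) c (q ∘ t) (i + 1))) (segment ℝ (cyclePolygon (q ∘ s) c (q ∘ t) j)
      (cyclePolygon (q ∘ s) c (q ∘ t) (j + 1))) := by
  obtain ⟨m, rfl | rfl | rfl⟩ := exists_three_mul i <;>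
  obtain ⟨l, rfl | rfl | rfl⟩ := exists_three_mul j <;>
  simp only [add_assoc, Nat.reduceAdd, cyclePolygon_zero, cyclePolygon_one, cyclePolygon_two,
    cyclePolygon_three]
  · exact g.disjoint_sc_sc (natCast_ne (by omega) (by omega))
  · exact g.disjoint_sc_ct (natCast_ne (by omega) (by omega))
  · have := natCast_ne (k := k) (i := m) (j := l + 1) (by omega) (by omega)
    push_cast at this
    exact g.disjoint_sc_link this
  · exact (g.disjoint_sc_ct (natCast_ne (by omega) (by omega)).symm).symm
  · exact g.disjoint_ct_ct (natCast_ne (by omega) (by omega))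
  · exact g.disjoint_ct_link (natCast_ne (by omega) (by omega))
  · have := natCast_ne (k := k) (i := m + 1) (j := l) (by omega) (by omega)
    push_cast at this
    exact (g.disjoint_sc_link this.symm).symm
  · exact (g.disjoint_ct_link (natCast_ne (by omega) (by omega)).symm).symm
  · exact g.disjoint_link_link (natCast_ne (by omega) (by omega))

theorem polygon_turn (g : GadgetCycle G q k idx s t a b d c) (j : ℕ) :
    (0 : ℂ) ∉ segment ℝ (cyclePolygon (q ∘ s) c (q ∘ t) (j + 1) - cyclePolygon (q ∘ s) c (q ∘ t) j)
      (cyclePolygon (q ∘ s) c (q ∘ t) (j + 2) - cyclePolygon (q ∘ s) c (q ∘ t) (j + 1)) := by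
  apply zero_notMem_segment
  obtain ⟨i, rfl | rfl | rfl⟩ := exists_three_mul j <;>
  simp only [add_assoc, Nat.reduceAdd, cyclePolygon_zero, cyclePolygon_one, cyclePolygon_two,
    cyclePolygon_three, cyclePolygon_four, Function.comp]
  · have h := (g.gadget i).perp
    have h1 := (g.gadget i).sub_left_ne
    have h2 := (g.gadget i).symm.sub_left_ne
    have h3 : AxisPerp (q (s i) - c i) (q (t i) - c i) := by
      have := ((h.real_mul_left (-1)).symm.real_mul_left (-1)).symm
      simpa using this
    refine h3.dirNe ?_ ?_
    · rw [← neg_sub]; exact neg_ne_zero.mpr h1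
    · rw [← neg_sub]; exact neg_ne_zero.mpr h2
  · exact (g.gadget i).symm.dirNe_left (g.link i) (g.b_ne_s _ _).symm
  · exact ((g.gadget (i + 1)).dirNe_left (g.link i).symm (g.a_ne_t _ _).symm).symm

end GadgetCycle


/-! ### Turning sums and the counting of quarter turns -/

theorem sum_range_add_of_periodic {f : ℕ → ℝ} {n : ℕ} (hf : ∀ j, f (j + n) = f j) (a : ℕ) :
    ∑ r ∈ Finset.range n, f (r + a) = ∑ r ∈ Finset.range n, f r := by
  induction a with
  | zero => simp
  | succ a ih =>
    have h := Finset.sum_range_succ' (fun r => f (r + a)) n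
    rw [Finset.sum_range_succ] at h
    have e : f (n + a) = f (0 + a) := by rw [add_comm n, hf, zero_add]
    rw [e] at h
    rw [← ih]
    have : ∑ r ∈ Finset.range n, f (r + (a + 1)) = ∑ r ∈ Finset.range n, f (r + 1 + a) :=
      Finset.sum_congr rfl fun r _ => by ring_nf
    linarith

theorem sum_range_three_mul (f : ℕ → ℝ) (n : ℕ) :
    ∑ r ∈ Finset.range (3 * n), f r =
      ∑ i ∈ Finset.range n, (f (3 * i) + f (3 * i + 1) + f (3 * i + 2)) := by
  induction n with
  | zero => simp
  | succ n ih =>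
    rw [show 3 * (n + 1) = 3 * n + 1 + 1 + 1 by ring, Finset.sum_range_succ, Finset.sum_range_succ,
      Finset.sum_range_succ, ih, Finset.sum_range_succ]
    ring

/-- At most four quarter turns fit into a full turn. -/
theorem false_of_quarter_turns {k : ℕ} (hk : 9 ≤ k) {S : ℕ → ℝ} {A : ℕ → Prop}
    (hpos : ∀ m, 0 < S m)
    (hsum : ∀ a, ∑ m ∈ Finset.range k, S (m + a) = 2 * Real.pi) (hA : ∀ m, A m ∨ A (m + 1))
    (hq : ∀ i j, A i → A (i + j) → ∃ z : ℤ, ∑ m ∈ Finset.range j, S (m + i) = z * (Real.pi / 2)) :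
    False := by
  set H : ℕ → ℝ := fun n => ∑ m ∈ Finset.range n, S m with hH
  have hadd : ∀ i j, ∑ m ∈ Finset.range j, S (m + i) = H (i + j) - H i := by
    intro i j
    rw [hH]; simp only
    rw [Finset.sum_range_add, add_sub_cancel_left]
    exact Finset.sum_congr rfl fun m _ => by rw [add_comm]
  have hmono : StrictMono H := strictMono_nat_of_lt_succ fun n => by
    rw [hH]; simp only; rw [Finset.sum_range_succ]; linarith [hpos n]
  -- The turning between two marked indices is a multiple of π/2 and positive, hence at least π/2.
  have step : ∀ i j, i < j → A i → A j → H i + Real.pi / 2 ≤ H j := by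
    intro i j hij hi hj
    obtain ⟨l, rfl⟩ := Nat.exists_eq_add_of_lt hij
    obtain ⟨z, hz⟩ := hq i (l + 1) hi (by rwa [← add_assoc])
    rw [hadd, ← add_assoc] at hz
    have h1 := hmono hij
    have hpi := Real.pi_pos
    have hz0 : (0 : ℝ) < z := by
      by_contra h
      have : (z : ℝ) * (Real.pi / 2) ≤ 0 := mul_nonpos_of_nonpos_of_nonneg (not_lt.mp h) (by linarith)
      linarith
    have hz1 : (1 : ℝ) ≤ z := by exact_mod_cast Int.add_one_le_iff.mpr (by exact_mod_cast hz0 : 0 < z)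
    nlinarith
  have next : ∀ i, ∃ j, i < j ∧ j ≤ i + 2 ∧ A j := by
    intro i
    rcases hA (i + 1) with h | h
    exacts [⟨i + 1, by omega, by omega, h⟩, ⟨i + 2, by omega, by omega, h⟩]
  -- Gaps are at most 2, so five marked indices fit into `n0, …, n0 + 8`. They account for a turning
  -- of 2π, and `9 ≤ k` leaves at least one more positive summand before the period ends.
  obtain ⟨n0, -, -, h0⟩ := next 0
  obtain ⟨n1, l1, m1, h1⟩ := next n0
  obtain ⟨n2, l2, m2, h2⟩ := next n1
  obtain ⟨n3, l3, m3, h3⟩ := next n2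
  obtain ⟨n4, l4, m4, h4⟩ := next n3
  have s1 := step _ _ l1 h0 h1
  have s2 := step _ _ l2 h1 h2
  have s3 := step _ _ l3 h2 h3
  have s4 := step _ _ l4 h3 h4
  have s5 := hsum n0
  rw [hadd] at s5
  have s6 := hmono (show n4 < n0 + k by omega)
  linarith

theorem arg_real_mul_I_of_pos {x : ℝ} (h : 0 < x) : Complex.arg (x * Complex.I) = Real.pi / 2 := by
  rw [Complex.arg_real_mul _ h, Complex.arg_I]

theorem arg_real_mul_I_of_neg {x : ℝ} (h : x < 0) :
    Complex.arg (x * Complex.I) = -(Real.pi / 2) := by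
  have : (x : ℂ) * Complex.I = ((-x : ℝ) : ℂ) * -Complex.I := by push_cast; ring
  rw [this, Complex.arg_real_mul _ (by linarith), Complex.arg_neg_I]

theorem AxisPerp.exists_eq {x y : ℂ} (h : AxisPerp x y) (hx : x ≠ 0) :
    ∃ r : ℝ, y = r * Complex.I * x := by
  rcases h with ⟨h1, h2⟩ | ⟨h1, h2⟩
  · have hx' : x.im ≠ 0 := fun h => hx (Complex.ext h1 h)
    refine ⟨-y.re / x.im, Complex.ext ?_ ?_⟩
    · simp [Complex.mul_re, Complex.mul_im]; field_simp
    · simp [Complex.mul_re, Complex.mul_im, h1, h2]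
  · have hx' : x.re ≠ 0 := fun h => hx (Complex.ext h h1)
    refine ⟨y.im / x.re, Complex.ext ?_ ?_⟩
    · simp [Complex.mul_re, Complex.mul_im, h1, h2]
    · simp [Complex.mul_re, Complex.mul_im]; field_simp

namespace GadgetCycle

variable {V : Type*} {G : SimpleGraph V} {q : V → ℂ} {k : ℕ} {idx : V → ZMod k}
  {s t a b d : ZMod k → V} {c : ZMod k → ℂ}

/-- The total turning angle of the polygon, from a vertex joined to `s (i + 1)` by an edge that does
not cross the polygon. -/
theorem sum_turn (g : GadgetCycle G q k idx s t a b d c) (hk : 2 ≤ k) (i : ℕ) {v : V}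
    (h : G.Adj (s (i + 1)) v) (hi : idx v = i + 1) (hs : ∀ l, v ≠ s l) (ht : ∀ l, v ≠ t l)
    (ha : ∀ l, v ≠ a l)
    (hct : Disjoint (segment ℝ (q (s (i + 1))) (q v))
      (segment ℝ (c (i + 1)) (q (t (i + 1)))))
    (hl : ∀ l, Disjoint (openSegment ℝ (q (s (i + 1))) (q v))
      (openSegment ℝ (q (t l)) (q (s (l + 1))))) :
    ∑ r ∈ Finset.range (3 * k), turn (cyclePolygon (q ∘ s) c (q ∘ t)) r =
      -2 * cyc (q (t i) - q (s (i + 1))) (c (i + 1) - q (s (i + 1))) (q v - q (s (i + 1))) := by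
  set p := cyclePolygon (q ∘ s) c (q ∘ t) with hp
  have hper : ∀ j, p (j + 3 * k) = p j := cyclePolygon_periodic _ _ _
  obtain ⟨m, hm⟩ : ∃ m, m + 2 = 3 * k := ⟨3 * k - 2, by omega⟩
  have H := (g.gadget 0).drawing
  have e0 : p (3 * i + 3) = q (s (i + 1)) := cyclePolygon_three _ _ _ i
  have e1 : p (3 * i + 4) = c (i + 1) := cyclePolygon_four _ _ _ i
  have e2 : p (3 * i + 3 + (m + 1)) = q (t i) := by
    rw [show 3 * i + 3 + (m + 1) = 3 * i + 2 + 3 * k by omega, hper]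
    exact cyclePolygon_two _ _ _ i
  have side : ∀ j, 3 * i + 4 ≤ j → j ≤ 3 * i + 3 * k + 1 →
      Disjoint (segment ℝ (q (s (i + 1))) (q v)) (segment ℝ (p j) (p (j + 1))) := by
    intro j h1 h2
    obtain ⟨l, rfl | rfl | rfl⟩ := exists_three_mul j <;>
    simp only [hp, add_assoc, Nat.reduceAdd, cyclePolygon_zero, cyclePolygon_one, cyclePolygon_two,
      cyclePolygon_three]
    · have hne := natCast_ne (k := k) (i := i + 1) (j := l) (by omega) (by omega)
      push_cast at hne
      exact (g.disjoint_sc_of_idx h (by rwa [g.idx_s]) (by rwa [hi])).symm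
    · by_cases hne : (l : ZMod k) = i + 1
      · rw [hne]; exact hct
      · exact (g.disjoint_ct_of_idx h (by rw [g.idx_s]; exact fun e => hne e.symm)
          (by rw [hi]; exact fun e => hne e.symm)).symm
    · have hne := natCast_ne (k := k) (i := i + 1) (j := l + 1) (by omega) (by omega)
      push_cast at hne
      exact H.disjoint_segment h (g.link l) (hl l) (g.s_ne_t _ _) (g.s_ne hne) (ht _) (hs _)
  -- The polygon is renumbered to begin at `s (i + 1)`, with predecessor `t i` and successor `c (i +
  -- 1)`; periodicity removes the shift afterwards.
  have key := sum_turn_eq_cyc (p := fun j => p (3 * i + 3 + j)) (m := m) (z := q v) (by omega)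
    (by
      show p (3 * i + 3 + (m + 2)) = p (3 * i + 3)
      rw [hm, hper])
    (by
      show p (3 * i + 3 + (m + 3)) = p (3 * i + 3 + 1)
      rw [show 3 * i + 3 + (m + 3) = 3 * i + 3 + 1 + 3 * k by omega, hper])
    (fun r _ => g.polygon_turn (3 * i + 3 + r))
    (fun x y h1 h2 h3 => g.polygon_disjoint _ _ (by omega) (by omega)) ?_ ?_ ?_ ?_
  · rw [hm] at key
    simp only [add_zero, e2, e0] at key
    rw [show 3 * i + 3 + 1 = 3 * i + 4 by ring, e1] at key
    rw [← key, ← sum_range_add_of_periodic (fun j => ?_) (3 * i + 3)]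
    · refine Finset.sum_congr rfl fun r _ => ?_
      rw [turn, turn, add_comm r]; rfl
    · rw [turn, turn, add_right_comm j (3 * k) 2, add_right_comm j (3 * k) 1, hper, hper, hper]
  · show DirNe (p (3 * i + 3 + (m + 1)) - p (3 * i + 3)) (q v - p (3 * i + 3))
    rw [e2, e0]
    exact H.dirNe (g.link i).symm h (ht _).symm
  · show DirNe (p (3 * i + 4) - p (3 * i + 3)) (q v - p (3 * i + 3))
    rw [e0, e1]
    exact (g.gadget _).dirNe_left h (ha _)
  · intro j hj
    show Disjoint (segment ℝ (p (3 * i + 3)) (q v)) _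
    rw [e0]
    exact side _ (by omega) (by omega)
  · refine H.outer (fun j => p (3 * i + 3 + j)) _ (by
      show p (3 * i + 3 + (m + 2)) = p (3 * i + 3)
      rw [hm, hper]) (fun j _ => g.polygon_covered _) v ?_
    intro j hj
    show q v ∉ segment ℝ (p (3 * i + 3 + j)) (p (3 * i + 3 + j + 1))
    generalize 3 * i + 3 + j = x
    obtain ⟨l, rfl | rfl | rfl⟩ := exists_three_mul x <;>
    simp only [hp, add_assoc, Nat.reduceAdd, cyclePolygon_zero, cyclePolygon_one, cyclePolygon_two,
      cyclePolygon_three]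
    · intro hm
      rcases H.eq_of_mem_segment (g.gadget l).adj_sa ((g.gadget l).segment_subset_sa hm) with e | e
      exacts [hs _ e, ha _ e]
    · by_cases hne : (l : ZMod k) = i + 1
      · rw [hne]; exact Set.disjoint_left.mp hct (right_mem_segment _ _ _)
      · exact Set.disjoint_left.mp (g.disjoint_ct_of_idx h
          (by rw [g.idx_s]; exact fun e => hne e.symm)
          (by rw [hi]; exact fun e => hne e.symm)).symm (right_mem_segment _ _ _)
    · intro hm
      rcases H.eq_of_mem_segment (g.link l) hm with e | e
      exacts [ht _ e, hs _ e]

end GadgetCycle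


/-! ### Quarter turns at the gadgets -/

theorem Complex.exists_arg_eq_of_axis {z : ℂ} (h : z.re = 0 ∨ z.im = 0) :
    ∃ n : ℤ, z.arg = n * (Real.pi / 2) := by
  rcases h with h | h
  · have hz : z = z.im * Complex.I := Complex.ext (by simp [h]) (by simp)
    rw [hz]
    rcases lt_trichotomy z.im 0 with h' | h' | h'
    · exact ⟨-1, by rw [arg_real_mul_I_of_neg h']; push_cast; ring⟩
    · exact ⟨0, by rw [h']; simp⟩
    · exact ⟨1, by rw [arg_real_mul_I_of_pos h']; push_cast; ring⟩
  · have hz : z = z.re := Complex.ext (by simp) (by simp [h])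
    rw [hz]
    rcases le_or_gt 0 z.re with h' | h'
    · exact ⟨0, by rw [Complex.arg_ofReal_of_nonneg h']; push_cast; ring⟩
    · exact ⟨2, by rw [Complex.arg_ofReal_of_neg h']; push_cast; ring⟩

/-- Modulo 2π each turn is a difference of two direction arguments, so the sum telescopes. -/
theorem sum_turn_coe {p : ℕ → ℂ} (hp : ∀ j, p (j + 1) - p j ≠ 0) (a n : ℕ) :
    ((∑ r ∈ Finset.range n, turn p (r + a) : ℝ) : Real.Angle) =
      Complex.arg (p (a + n + 1) - p (a + n)) - Complex.arg (p (a + 1) - p a) := by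
  induction n with
  | zero => simp
  | succ n ih =>
    rw [Finset.sum_range_succ, Real.Angle.coe_add, ih, turn, Complex.arg_div_coe_angle]
    · rw [add_comm n a, ← add_assoc]; abel
    · exact hp (n + a + 1)
    · exact hp (n + a)

namespace Gadget

variable {V : Type*} {G : SimpleGraph V} {q : V → ℂ} {s t a b d : V} {c : ℂ}

theorem exists_sub_eq (g : Gadget G q s t a b d c) :
    ∃ r : ℝ, r ≠ 0 ∧ q t - c = r * Complex.I * (c - q s) := by
  obtain ⟨r, h⟩ := g.perp.exists_eq g.sub_left_ne
  refine ⟨-r, ?_, ?_⟩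
  · rw [neg_ne_zero]
    rintro rfl
    exact g.symm.sub_left_ne (by rw [h]; simp)
  · rw [← neg_sub, h]; push_cast; ring

theorem arg_eq_or (g : Gadget G q s t a b d c) :
    Complex.arg ((q t - c) / (c - q s)) = Real.pi / 2 ∨
      Complex.arg ((q t - c) / (c - q s)) = -(Real.pi / 2) := by
  obtain ⟨r, h0, h⟩ := g.exists_sub_eq
  rw [h, mul_div_assoc, div_self g.sub_left_ne, mul_one]
  rcases lt_or_gt_of_ne h0 with h0 | h0
  exacts [.inr (arg_real_mul_I_of_neg h0), .inl (arg_real_mul_I_of_pos h0)]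

theorem arg_of_parallel_left (g : Gadget G q s t a b d c) {r : ℝ} (hr : 0 < r) :
    Complex.arg (r * (q s - c) / (q t - c)) = Complex.arg ((q t - c) / (c - q s)) := by
  obtain ⟨r', h0, h⟩ := g.exists_sub_eq
  have hu := g.sub_left_ne
  have e1 : (q t - c) / (c - q s) = r' * Complex.I := by
    rw [h, mul_div_assoc, div_self hu, mul_one]
  have h0' : (r' : ℂ) ≠ 0 := by exact_mod_cast h0
  have e2 : r * (q s - c) / (q t - c) = ((r / r' ^ 2 : ℝ) : ℂ) * (r' * Complex.I) := by
    rw [h, ← neg_sub c (q s)]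
    push_cast
    field_simp
    rw [Complex.I_sq, mul_neg_one]
  rw [e2, e1, Complex.arg_real_mul _ (by positivity)]

theorem arg_of_parallel_right (g : Gadget G q s t a b d c) {r : ℝ} (hr : 0 < r) :
    Complex.arg ((c - q s) / -(r * (q t - c))) = Complex.arg ((q t - c) / (c - q s)) := by
  rw [← g.arg_of_parallel_left (inv_pos.mpr hr)]
  have h1 := g.symm.sub_left_ne
  have h2 : q t - c ≠ 0 := by rw [← neg_sub]; exact neg_ne_zero.mpr h1
  have h0' : (r : ℂ) ≠ 0 := by exact_mod_cast hr.ne'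
  congr 1
  rw [Complex.ofReal_inv, ← neg_sub c (q s)]
  field_simp

/-- As `c` lies between `t` and `b`, these two are on opposite sides of the line `sa`. So the turn
from `sc` to `ct` fixes the side of `b`, and `cyc_eq` then fixes the cyclic order with any further
edge at `s`. -/
theorem cyc_eq_arg (g : Gadget G q s t a b d c) {w : V} (h : G.Adj s w) (hwa : w ≠ a)
    (hwb : w ≠ b) (hwt : w ≠ t) :
    cyc (q w - q s) (c - q s) (q b - q s) = -2 * Complex.arg ((q t - c) / (c - q s)) := by
  have H := g.drawing
  have hu := g.sub_left_ne
  have k := cyc_swap (g.dirNe_left g.adj_sb g.hab.symm) (H.dirNe g.adj_sb h hwb.symm)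
    (g.dirNe_left h hwa)
  rw [cyc_rotate, k, g.cyc_eq h hwa hwb hwt]
  obtain ⟨r, h0, e⟩ := g.exists_sub_eq
  obtain ⟨ρ, p0, p1, e1, e2⟩ := exists_of_mem_openSegment g.mem_tb
  have hρ : (ρ : ℂ) ≠ 0 := by exact_mod_cast p0.ne'
  have e3 : (q t - c) / (c - q s) = r * Complex.I := by
    rw [e, mul_div_assoc, div_self hu, mul_one]
  have e4 : (q b - q s) / (c - q s) = 1 + ((-((1 - ρ) / ρ * r) : ℝ) : ℂ) * Complex.I := by
    rw [div_eq_iff hu]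
    have : (q b - q t) = -(r * Complex.I * (c - q s)) / ρ := by
      rw [eq_div_iff hρ, ← e]; linear_combination -e1
    have e5 : q b - q s = (q b - c) + (c - q s) := by ring
    rw [e5, e2, this]; push_cast; field_simp; ring
  have him : ((q b - q s) / (c - q s)).im = -((1 - ρ) / ρ * r) := by rw [e4]; simp
  have hpos : 0 < (1 - ρ) / ρ := div_pos (by linarith) p0
  rw [neg_div, e3]
  rcases lt_or_gt_of_ne h0 with h0 | h0
  · rw [Complex.arg_neg_eq_arg_sub_pi_of_im_pos (by rw [him]; nlinarith), arg_real_mul_I_of_neg h0]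
    ring
  · rw [Complex.arg_neg_eq_arg_add_pi_of_im_neg (by rw [him]; nlinarith), arg_real_mul_I_of_pos h0]
    ring

theorem disjoint_sb_ct (g : Gadget G q s t a b d c) :
    Disjoint (segment ℝ (q s) (q b)) (segment ℝ c (q t)) := by
  have H := g.drawing
  rw [Set.disjoint_left]
  intro z hz hz'
  have hz2 := g.segment_subset_ct hz'
  have e := H.eq_of_mem_common g.adj_sb.symm g.adj_tb.symm g.hst (z := z)
    (by rwa [segment_symm]) (by rwa [segment_symm])
  subst e
  refine left_notMem_segment (c := c) (x := q b) (y := q t) (by rw [openSegment_symm]; exact g.mem_tb)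
    (fun e => g.adj_tb.ne (H.injective e).symm) hz'

end Gadget

namespace GadgetCycle

variable {V : Type*} {G : SimpleGraph V} {q : V → ℂ} {k : ℕ} {idx : V → ZMod k}
  {s t a b d : ZMod k → V} {c : ZMod k → ℂ}

theorem b_uncrossed (g : GadgetCycle G q k idx s t a b d c) (i l : ZMod k) :
    Disjoint (openSegment ℝ (q (s i)) (q (b i))) (openSegment ℝ (q (t l)) (q (s (l + 1)))) := by
  refine (g.gadget i).uncrossed_sb (g.link l) fun e => ?_
  rcases Sym2.eq_iff.mp e with ⟨-, e⟩ | ⟨-, e⟩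
  exacts [g.b_ne_s _ _ e, g.b_ne_t _ _ e]

/-- The edge `sb` does not meet the polygon again, so its position at `s` gives the total turning.
The left-hand side does not depend on `i`: the right angles at all crossings turn in the same sense.
-/
theorem sum_turn_eq_four (g : GadgetCycle G q k idx s t a b d c) (hk : 2 ≤ k) (i : ℕ) :
    ∑ r ∈ Finset.range (3 * k), turn (cyclePolygon (q ∘ s) c (q ∘ t)) r =
      4 * Complex.arg ((q (t (i + 1)) - c (i + 1)) / (c (i + 1) - q (s (i + 1)))) := by
  have gi := g.gadget (i + 1)
  rw [g.sum_turn hk i gi.adj_sb (g.idx_b _) (fun l => g.b_ne_s _ _) (fun l => g.b_ne_t _ _)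
    (fun l => ?_) gi.disjoint_sb_ct (g.b_uncrossed _), gi.cyc_eq_arg (g.link i).symm (g.a_ne_t _ _).symm (g.b_ne_t _ _).symm]
  · ring
  · have h1 := natCast_ne (k := k) (i := i) (j := i + 1) (by omega) (by omega)
    push_cast at h1
    exact g.t_ne h1
  · by_cases hl : l = i + 1
    · rw [hl]; exact gi.hab.symm
    · exact ne_of_idx (idx := idx) (by rw [g.idx_a, g.idx_b]; exact Ne.symm hl)

/-- One of the two links at a gadget is parallel to an edge of its crossing. -/
theorem exists_parallel (g : GadgetCycle G q k idx s t a b d c) (hk : 2 ≤ k) (i : ℕ) :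
    (∃ r : ℝ, 0 < r ∧ q (s (i + 1 + 1)) - q (t (i + 1)) = r * (q (s (i + 1)) - c (i + 1))) ∨
    (∃ r : ℝ, 0 < r ∧ q (t i) - q (s (i + 1)) = r * (q (t (i + 1)) - c (i + 1))) := by
  have gi := g.gadget (i + 1)
  have hd : ∀ l, d (i + 1) ≠ a l := fun l => by
    by_cases hl : l = i + 1
    · rw [hl]; exact gi.had.symm
    · exact ne_of_idx (idx := idx) (by rw [g.idx_a, g.idx_d]; exact Ne.symm hl)
  have hii : (i : ZMod k) ≠ i + 1 := by
    have h1 := natCast_ne (k := k) (i := i) (j := i + 1) (by omega) (by omega)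
    push_cast at h1
    exact h1
  by_cases hl : ∀ l, Disjoint (openSegment ℝ (q (s (i + 1))) (q (d (i + 1))))
      (openSegment ℝ (q (t l)) (q (s (l + 1))))
  -- If `sd` misses all links, then `d` serves as an outer vertex just as `b` does. Both give the
  -- same total turning, so they lie on the same side of the path along the link, `s` and `c`, and
  -- the link at `s` must cross `td`.
  · right
    have T1 := g.sum_turn hk i gi.adj_sd (g.idx_d _) (fun l => g.d_ne_s _ _) (fun l => g.d_ne_t _ _)
      hd ((gi.disjoint_segment_tb gi.adj_sd gi.had.symm gi.hbd.symm gi.adj_td.ne.symm).mono_right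
        gi.segment_subset_ct) hl
    rw [g.sum_turn_eq_four hk i] at T1
    have C := gi.cyc_eq_arg (g.link i).symm (g.a_ne_t _ _).symm (g.b_ne_t _ _).symm (g.t_ne hii)
    obtain ⟨z, h1, h2⟩ := gi.exists_cross (g.link i).symm (g.a_ne_t _ _).symm (g.b_ne_t _ _).symm
      (g.d_ne_t _ _).symm (g.t_ne hii) (by linarith)
    exact gi.sub_eq_of_cross (g.link i).symm h1 h2
  -- With `s` and `t` exchanged, only edges at `t` cross `sd`; the only such link is the one that
  -- leaves this gadget.
  · left
    push Not at hl
    obtain ⟨l, hl⟩ := hl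
    obtain ⟨z, h1, h2⟩ := Set.not_disjoint_iff.mp hl
    have : l = i + 1 := by
      rcases gi.symm.eq_of_cross_td (g.link l) (fun e => by
        rcases Sym2.eq_iff.mp e with ⟨-, e⟩ | ⟨-, e⟩
        exacts [g.d_ne_s _ _ e, g.d_ne_t _ _ e]) h1 h2 with e | e
      · rw [← g.idx_t l, ← e, g.idx_t]
      · exact absurd e.symm (g.s_ne_t _ _)
    subst this
    exact gi.symm.sub_eq_of_cross (g.link _) h1 h2

/-- A cycle of at least nine gadgets has crossing links. -/
theorem false_of_nine_le (g : GadgetCycle G q k idx s t a b d c) (hk : 9 ≤ k) : False := by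
  set p := cyclePolygon (q ∘ s) c (q ∘ t) with hp
  have hper : ∀ j, p (j + 3 * k) = p j := cyclePolygon_periodic _ _ _
  have hk2 : 2 ≤ k := by omega
  have hpi := Real.pi_pos
  obtain ⟨σ, hσ, hσT⟩ : ∃ σ : ℝ, (σ = 1 ∨ σ = -1) ∧
      ∑ r ∈ Finset.range (3 * k), turn p r = 2 * Real.pi * σ := by
    rw [hp, g.sum_turn_eq_four hk2 0]
    rcases (g.gadget (0 + 1)).arg_eq_or with e | e
    · exact ⟨1, .inl rfl, by push_cast; rw [e]; ring⟩
    · exact ⟨-1, .inr rfl, by push_cast; rw [e]; ring⟩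
  have hσ2 : σ * σ = 1 := by rcases hσ with rfl | rfl <;> norm_num
  have harg : ∀ i : ℕ, Complex.arg ((q (t (i + 1)) - c (i + 1)) / (c (i + 1) - q (s (i + 1)))) =
      Real.pi / 2 * σ := fun i => by
    have := g.sum_turn_eq_four hk2 i
    rw [← hp, hσT] at this
    linarith
  have hne : ∀ j, p (j + 1) - p j ≠ 0 := fun j e =>
    g.polygon_turn j (by rw [← hp, e]; exact left_mem_segment _ _ _)
  have hturn : ∀ j, |turn p j| < Real.pi := fun j => by
    have h := div_mem_slitPlane (p := 0) (g.polygon_turn j)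
    rw [sub_zero, sub_zero] at h
    exact abs_lt.mpr ⟨Complex.neg_pi_lt_arg _,
      lt_of_le_of_ne (Complex.arg_le_pi _) (Complex.mem_slitPlane_iff_arg.mp h).1⟩
  have p2 : ∀ i : ℕ, p (3 * i + 2) = q (t i) := cyclePolygon_two _ _ _
  have p3 : ∀ i : ℕ, p (3 * i + 3) = q (s (i + 1)) := cyclePolygon_three _ _ _
  have p4 : ∀ i : ℕ, p (3 * i + 4) = c (i + 1) := cyclePolygon_four _ _ _
  have p5 : ∀ i : ℕ, p (3 * i + 5) = q (t (i + 1)) := fun i => by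
    have := p2 (i + 1)
    push_cast at this
    exact this
  have p6 : ∀ i : ℕ, p (3 * i + 6) = q (s (i + 1 + 1)) := fun i => by
    have := p3 (i + 1)
    push_cast at this
    exact this
  have t2 : ∀ i : ℕ, turn p (3 * i + 2) =
      Complex.arg ((c (i + 1) - q (s (i + 1))) / (q (s (i + 1)) - q (t i))) := fun i => by
    rw [← p2, ← p3, ← p4]; rfl
  have t3 : ∀ i : ℕ, turn p (3 * i + 3) = Real.pi / 2 * σ := fun i => by
    rw [← harg i, ← p5, ← p3, ← p4]; rfl
  have t4 : ∀ i : ℕ, turn p (3 * i + 4) =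
      Complex.arg ((q (s (i + 1 + 1)) - q (t (i + 1))) / (q (t (i + 1)) - c (i + 1))) := fun i => by
    rw [← p4, ← p5, ← p6]; rfl
  -- Since `turn p r` is the turn at `p (r + 1)`, the indices `3 * i + 2`, `3 * i + 3`, `3 * i + 4`
  -- belong to `s`, `c`, `t` of gadget `i + 1`. A parallel link repeats the quarter turn made at
  -- `c`.
  have hpar : ∀ i : ℕ,
      (turn p (3 * i + 4) = Real.pi / 2 * σ ∧
        ((p (3 * i + 6) - p (3 * i + 5)).re = 0 ∨ (p (3 * i + 6) - p (3 * i + 5)).im = 0)) ∨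
      (turn p (3 * i + 2) = Real.pi / 2 * σ ∧
        ((p (3 * i + 3) - p (3 * i + 2)).re = 0 ∨ (p (3 * i + 3) - p (3 * i + 2)).im = 0)) := by
    intro i
    have gi := g.gadget (i + 1)
    rcases g.exists_parallel hk2 i with ⟨r, h0, h⟩ | ⟨r, h0, h⟩
    · left
      refine ⟨?_, ?_⟩
      · rw [t4, h, gi.arg_of_parallel_left h0, harg]
      · rw [p6, p5, h, Complex.re_ofReal_mul, Complex.im_ofReal_mul]
        rcases gi.perp with ⟨e, -⟩ | ⟨e, -⟩
        · left; rw [← neg_sub, Complex.neg_re, e]; simp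
        · right; rw [← neg_sub, Complex.neg_im, e]; simp
    · right
      rw [← neg_sub] at h
      have h := neg_eq_iff_eq_neg.mp h
      refine ⟨?_, ?_⟩
      · rw [t2, h, gi.arg_of_parallel_right h0, harg]
      · rw [p3, p2, h, Complex.neg_re, Complex.neg_im, Complex.re_ofReal_mul, Complex.im_ofReal_mul]
        rcases gi.perp with ⟨-, e⟩ | ⟨-, e⟩
        · right; rw [← neg_sub, Complex.neg_im, e]; simp
        · left; rw [← neg_sub, Complex.neg_re, e]; simp
  -- `S i` is the turning in gadget `i + 1`, made positive by the orientation `σ`, and `A i` says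
  -- that the link from gadget `i` to gadget `i + 1` is axis-parallel.
  refine false_of_quarter_turns hk
    (S := fun i => σ * (turn p (3 * i + 2) + turn p (3 * i + 3) + turn p (3 * i + 4)))
    (A := fun i => (p (3 * i + 3) - p (3 * i + 2)).re = 0 ∨ (p (3 * i + 3) - p (3 * i + 2)).im = 0)
    ?_ ?_ ?_ ?_
  · intro i
    rw [t3]
    have h2 := abs_lt.mp (hturn (3 * i + 2))
    have h4 := abs_lt.mp (hturn (3 * i + 4))
    -- Two quarter turns give π, and the third turn has absolute value less than π.
    rcases hpar i with ⟨h, -⟩ | ⟨h, -⟩ <;> rw [h] <;> rcases hσ with rfl | rfl <;> linarith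
  · intro a
    rw [← Finset.mul_sum]
    have h1 := sum_range_three_mul (fun r => turn p (r + (3 * a + 2))) k
    rw [sum_range_add_of_periodic (fun j => ?_), hσT] at h1
    · have : ∑ m ∈ Finset.range k, (turn p (3 * (m + a) + 2) + turn p (3 * (m + a) + 3) +
          turn p (3 * (m + a) + 4)) = 2 * Real.pi * σ := by
        rw [h1]
        refine Finset.sum_congr rfl fun m _ => ?_
        rw [show 3 * m + (3 * a + 2) = 3 * (m + a) + 2 by ring,
          show 3 * m + 1 + (3 * a + 2) = 3 * (m + a) + 3 by ring,
          show 3 * m + 2 + (3 * a + 2) = 3 * (m + a) + 4 by ring]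
      rw [this]
      linear_combination 2 * Real.pi * hσ2
    · rw [turn, turn, add_right_comm j (3 * k) 2, add_right_comm j (3 * k) 1, hper, hper, hper]
  · intro i
    rcases hpar i with ⟨-, h⟩ | ⟨-, h⟩
    exacts [.inr h, .inl h]
  · intro i j hi hj
    obtain ⟨n, hn⟩ := Complex.exists_arg_eq_of_axis hi
    obtain ⟨n', hn'⟩ := Complex.exists_arg_eq_of_axis hj
    have h1 := sum_range_three_mul (fun r => turn p (r + (3 * i + 2))) j
    have h2 := sum_turn_coe hne (3 * i + 2) (3 * j)
    rw [show 3 * i + 2 + 3 * j + 1 = 3 * (i + j) + 3 by ring,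
      show 3 * i + 2 + 3 * j = 3 * (i + j) + 2 by ring, show 3 * i + 2 + 1 = 3 * i + 3 by ring, hn, hn',
      ← Real.Angle.coe_sub, Real.Angle.angle_eq_iff_two_pi_dvd_sub] at h2
    obtain ⟨z, hz⟩ := h2
    -- Both links have directions that are multiples of π/2, and the 2π-ambiguity `z` counts four
    -- quarter turns.
    have h3 : ∑ m ∈ Finset.range j, (turn p (3 * (m + i) + 2) + turn p (3 * (m + i) + 3) +
        turn p (3 * (m + i) + 4)) = (n' - n + 4 * z : ℤ) * (Real.pi / 2) := by
      have : ∑ m ∈ Finset.range j, (turn p (3 * (m + i) + 2) + turn p (3 * (m + i) + 3) +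
        turn p (3 * (m + i) + 4)) = ∑ r ∈ Finset.range (3 * j), turn p (r + (3 * i + 2)) := by
        rw [h1]
        refine Finset.sum_congr rfl fun m _ => ?_
        rw [show 3 * m + (3 * i + 2) = 3 * (m + i) + 2 by ring,
          show 3 * m + 1 + (3 * i + 2) = 3 * (m + i) + 3 by ring,
          show 3 * m + 2 + (3 * i + 2) = 3 * (m + i) + 4 by ring]
      rw [this]
      push_cast
      linarith
    rw [← Finset.mul_sum, h3]
    rcases hσ with rfl | rfl
    · exact ⟨_, one_mul _⟩
    · exact ⟨-(n' - n + 4 * z), by push_cast; ring⟩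

end GadgetCycle


/-! ### The linked `K_{2,3}` graph -/

namespace LinkedVertex

variable {k : ℕ}

/-- The index of the copy of `K_{2,3}` that contains a vertex. -/
def idx : LinkedVertex k → ZMod k
  | .s i => i
  | .t i => i
  | .x i => i
  | .y i => i
  | .z i => i

/-- The three vertices of degree two in a copy of `K_{2,3}`. -/
def mid (i : ZMod k) : Fin 3 → LinkedVertex k := ![.x i, .y i, .z i]

theorem mid_injective (i : ZMod k) : Function.Injective (mid i) := by
  intro j l h
  fin_cases j <;> fin_cases l <;> first | rfl | cases h

theorem idx_mid (i : ZMod k) (j : Fin 3) : (mid i j).idx = i := by fin_cases j <;> rfl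

end LinkedVertex

open LinkedVertex in
theorem linkedGraph_adj_s_mid {k : ℕ} (i : ZMod k) (j : Fin 3) :
    (linkedGraph k).Adj (.s i) (mid i j) := by
  fin_cases j
  exacts [⟨nofun, .inl (.sx i)⟩, ⟨nofun, .inl (.sy i)⟩, ⟨nofun, .inl (.sz i)⟩]

open LinkedVertex in
theorem linkedGraph_adj_t_mid {k : ℕ} (i : ZMod k) (j : Fin 3) :
    (linkedGraph k).Adj (.t i) (mid i j) := by
  fin_cases j
  exacts [⟨nofun, .inr (.xt i)⟩, ⟨nofun, .inr (.yt i)⟩, ⟨nofun, .inr (.zt i)⟩]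

open LinkedVertex in
theorem linkedGraph_mid_adj {k : ℕ} (i : ZMod k) (j : Fin 3) (w : LinkedVertex k)
    (h : (linkedGraph k).Adj (mid i j) w) : w = .s i ∨ w = .t i := by
  have h2 := h.2
  fin_cases j <;> rcases h2 with h2 | h2 <;> cases h2 <;> first | exact .inl rfl | exact .inr rfl

theorem linkedGraph_adj_link {k : ℕ} (i : ZMod k) : (linkedGraph k).Adj (.t i) (.s (i + 1)) :=
  ⟨nofun, .inl (.link i)⟩

-- Each copy of K_{2,3} becomes a `Gadget` after its middle vertices are relabelled according to the
-- crossing that `AxisDrawing.exists_crossing` provides.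
open LinkedVertex in
theorem hasCrossing_of_isOuterApRAC {k : ℕ} (hk : 9 ≤ k) (D : StraightLineDrawing (linkedGraph k))
    (hD : D.IsOuterApRAC) : HasCrossing (sigmaSkeleton k) (fun v => D.pos v.toLinked) := by
  by_contra hcon
  have H := hD.axisDrawing
  set q : LinkedVertex k → ℂ := fun v => rotatePlane (D.pos v) with hq
  have key : ∀ i : ZMod k, ∃ (l m n : Fin 3) (c : ℂ), l ≠ m ∧ l ≠ n ∧ m ≠ n ∧
      c ∈ openSegment ℝ (q (.s i)) (q (mid i l)) ∧ c ∈ openSegment ℝ (q (.t i)) (q (mid i m)) := by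
    intro i
    have A1 := linkedGraph_adj_s_mid i
    have A2 := linkedGraph_adj_t_mid i
    have N : ∀ {j l : Fin 3}, j ≠ l → mid i j ≠ mid i l := fun h => (mid_injective i).ne h
    obtain ⟨a, b, ha, hb, hab, c, hc, hc'⟩ := H.exists_crossing (A1 0) (A2 0) (A1 1) (A2 1) (A1 2)
      (A2 2) nofun (N (by decide)) (N (by decide)) (N (by decide))
    obtain ⟨l, rfl⟩ : ∃ l, a = mid i l := by
      rcases ha with h | h | h
      exacts [⟨0, h⟩, ⟨1, h⟩, ⟨2, h⟩]
    obtain ⟨m, rfl⟩ : ∃ m, b = mid i m := by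
      rcases hb with h | h | h
      exacts [⟨0, h⟩, ⟨1, h⟩, ⟨2, h⟩]
    have hlm : l ≠ m := fun e => hab (by rw [e])
    have third : ∀ l m : Fin 3, l ≠ m → ∃ n, l ≠ n ∧ m ≠ n := by decide
    obtain ⟨n, h1, h2⟩ := third l m hlm
    exact ⟨l, m, n, c, hlm, h1, h2, hc, hc'⟩
  choose l m n c h1 h2 h3 h4 h5 using key
  refine GadgetCycle.false_of_nine_le (G := linkedGraph k) (q := q) (idx := idx) (s := .s) (t := .t)
    (a := fun i => mid i (l i)) (b := fun i => mid i (m i)) (d := fun i => mid i (n i)) (c := c)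
    ⟨fun i => ⟨H, linkedGraph_adj_s_mid i _, linkedGraph_adj_t_mid i _, linkedGraph_adj_s_mid i _,
      linkedGraph_adj_t_mid i _, linkedGraph_adj_s_mid i _, linkedGraph_adj_t_mid i _, nofun,
      (mid_injective i).ne (h1 i), (mid_injective i).ne (h2 i), (mid_injective i).ne (h3 i),
      linkedGraph_mid_adj i _, linkedGraph_mid_adj i _, linkedGraph_mid_adj i _, h4 i, h5 i⟩,
      linkedGraph_adj_link, fun _ => rfl, fun _ => rfl, fun i => idx_mid i _, fun i => idx_mid i _,
      fun i => idx_mid i _, ?_⟩ hk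
  -- Only the absence of crossings between two links is needed; the virtual edges play no role.
  intro i j hij
  rw [Set.disjoint_left]
  intro z hz hz'
  obtain ⟨z, rfl⟩ := rotatePlane.surjective z
  rw [hq, rotatePlane_mem_openSegment] at hz hz'
  refine hcon ⟨.t i, .s (i + 1), .t j, .s (j + 1), ⟨nofun, .inl (.link i)⟩, ⟨nofun, .inl (.link j)⟩,
    ?_, z, hz, hz'⟩
  intro e
  rcases Sym2.eq_iff.mp e with ⟨e, -⟩ | ⟨e, -⟩
  · cases e; exact hij rfl
  · cases e


/-! ### Frames for a drawing of the linked graph -/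

/-- Whether the frame of the `m`-th copy of `K_{2,3}` is placed below the diagonal. -/
abbrev IsLower (k m : ℕ) : Prop := (m + 3 * ((k + 1) % 2)) % 4 < 2

/-- The point with the given coordinates in the `m`-th frame. -/
noncomputable def framePoint (k m : ℕ) (x y : ℝ) : ℂ :=
  -- Copies below the diagonal have their frame reflected. The spacing 20 keeps copies apart, and
  -- the extra 1 compensates for the second coordinate −1 of the corner p: this p is then aligned
  -- with the corner o of copy `m + 2` on the other side. Copy 0 is enlarged to have p at (20, 20),
  -- which is aligned with either choice for copy 2.
  if m = 0 then ⟨-20 * y, 20 * x⟩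
  else if IsLower k m then ⟨20 * (m + 1) + 1 + y, 20 * (m - 1) + x⟩
  else ⟨20 * (m - 1) + x, 20 * (m + 1) + 1 + y⟩

/-- The first coordinate in the `m`-th frame. -/
noncomputable def frameX (k m : ℕ) (z : ℂ) : ℝ :=
  if m = 0 then z.im / 20 else if IsLower k m then z.im - 20 * (m - 1) else z.re - 20 * (m - 1)

/-- The second coordinate in the `m`-th frame. -/
noncomputable def frameY (k m : ℕ) (z : ℂ) : ℝ :=
  if m = 0 then -z.re / 20
  else if IsLower k m then z.re - (20 * (m + 1) + 1) else z.im - (20 * (m + 1) + 1)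

section Frame

variable {k m : ℕ}

theorem frameX_framePoint (x y : ℝ) : frameX k m (framePoint k m x y) = x := by
  unfold frameX framePoint; split_ifs <;> simp

theorem frameY_framePoint (x y : ℝ) : frameY k m (framePoint k m x y) = y := by
  unfold frameY framePoint; split_ifs <;> simp

theorem frameX_add_mul (z w : ℂ) (r : ℝ) :
    frameX k m (z + r * (w - z)) = frameX k m z + r * (frameX k m w - frameX k m z) := by
  unfold frameX
  split_ifs <;> simp only [Complex.add_re, Complex.add_im, Complex.re_ofReal_mul,
    Complex.im_ofReal_mul, Complex.sub_re, Complex.sub_im] <;> ring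

theorem frameY_add_mul (z w : ℂ) (r : ℝ) :
    frameY k m (z + r * (w - z)) = frameY k m z + r * (frameY k m w - frameY k m z) := by
  unfold frameY
  split_ifs <;> simp only [Complex.add_re, Complex.add_im, Complex.re_ofReal_mul,
    Complex.im_ofReal_mul, Complex.sub_re, Complex.sub_im] <;> ring

theorem axisPerp_of_frame {z w z' w' : ℂ} (h : frameX k m z = frameX k m w)
    (h' : frameY k m z' = frameY k m w') : AxisPerp (w - z) (w' - z') := by
  unfold frameX at h
  unfold frameY at h'
  split_ifs at h h'
  · exact .inr ⟨by rw [Complex.sub_im]; linarith, by rw [Complex.sub_re]; linarith⟩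
  · exact .inr ⟨by rw [Complex.sub_im]; linarith, by rw [Complex.sub_re]; linarith⟩
  · exact .inl ⟨by rw [Complex.sub_re]; linarith, by rw [Complex.sub_im]; linarith⟩

theorem exists_eq_add_of_mem_openSegment {z u v : ℂ} (h : z ∈ openSegment ℝ u v) :
    ∃ r : ℝ, 0 < r ∧ r < 1 ∧ z = u + r * (v - u) := by
  obtain ⟨r, h0, h1, h, -⟩ := exists_of_mem_openSegment h
  exact ⟨r, h0, h1, by rw [← h]; ring⟩

/-- The sides have period 4 and change at every second step, so a link from copy `m` to copy `m + 2`
always changes sides. -/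
theorem isLower_add_two : IsLower k (m + 2) ↔ ¬ IsLower k m := by
  unfold IsLower; omega

theorem isLower_one : IsLower k 1 := by
  unfold IsLower
  rcases Nat.mod_two_eq_zero_or_one (k + 1) with h | h <;> rw [h] <;> decide

theorem two_le_of_not_isLower (h : m ≠ 0) (h' : ¬ IsLower k m) : (2 : ℝ) ≤ m := by
  have : m ≠ 1 := by rintro rfl; exact h' isLower_one
  exact_mod_cast (by omega : 2 ≤ m)

/-- The shift by the parity of `k` in `IsLower` is made for this: the last two copies are on
opposite sides for every `k`, while copy 1 stays below. -/
theorem isLower_add_one (h : m + 2 = k) : IsLower k (m + 1) ↔ ¬ IsLower k m := by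
  unfold IsLower; omega

/-- A copy of `K_{2,3}` with smaller index lies below the `m`-th frame. -/
theorem frameY_lt {j : ℕ} (h : j < m) {x y : ℝ} (h2 : x ≤ 2) (h3 : -1 ≤ y)
    (h4 : y ≤ 1) : frameY k m (framePoint k j x y) < -1 := by
  have hm : (j : ℝ) + 1 ≤ m := by exact_mod_cast h
  have hj : (0 : ℝ) ≤ j := by positivity
  unfold frameY framePoint
  split_ifs with c1 c2 c3 c4 c5 c6 <;> try omega
  all_goals simp only
  all_goals try linarith
  -- The enlarged copy 0 reaches height 40, which an upper frame only clears from `m = 2` on.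
  all_goals
    have := two_le_of_not_isLower ‹¬ m = 0› ‹¬ IsLower k m›
    linarith

/-- A copy of `K_{2,3}` with larger index lies to the right of the `m`-th frame. -/
theorem le_frameX (hm0 : m ≠ 0) {j : ℕ} (h : m < j) {x y : ℝ} (h1 : -1 ≤ x) (h3 : -1 ≤ y) :
    3 ≤ frameX k m (framePoint k j x y) := by
  have hm : (m : ℝ) + 1 ≤ j := by exact_mod_cast h
  unfold frameX framePoint
  split_ifs <;> try omega
  all_goals simp only
  all_goals linarith

/-- The frame of copy 0 sits at the diagonal itself: upper copies are to its right, and lower copies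
are below it. -/
theorem far_zero {j : ℕ} (h : j ≠ 0) {x y : ℝ} (h3 : -1 ≤ y) :
    3 ≤ frameX k 0 (framePoint k j x y) ∧ ¬ IsLower k j ∨
      frameY k 0 (framePoint k j x y) < -1 ∧ IsLower k j := by
  have hj : (1 : ℝ) ≤ j := by exact_mod_cast (by omega : 1 ≤ j)
  unfold frameX frameY framePoint
  rw [if_pos rfl, if_pos rfl, if_neg h]
  split_ifs with c2
  · right; refine ⟨?_, c2⟩; simp only; linarith
  · left
    refine ⟨?_, c2⟩
    have := two_le_of_not_isLower h c2
    simp only; linarith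

end Frame

/-- The vertices of a copy of `K_{2,3}` in its frame. -/
inductive Corner
  | o
  | p
  | a
  | b
  | d

namespace Corner

/-- The first coordinate of a vertex in its frame. -/
def x : Corner → ℝ
  -- The edges oa and pb cross at (1, 0) in frame coordinates. The edge pd passes horizontally under
  -- o, where a link arriving at o along the second axis crosses it at (0, −1).
  | o => 0
  | p => 1
  | a => 2
  | b => 1
  | d => -1

/-- The second coordinate of a vertex in its frame. -/
def y : Corner → ℝ
  | o => 0
  | p => -1
  | a => 0
  | b => 1
  | d => -1

theorem bounds (c : Corner) : -1 ≤ c.x ∧ c.x ≤ 2 ∧ -1 ≤ c.y ∧ c.y ≤ 1 := by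
  cases c <;> simp only [x, y] <;> norm_num

/-- The edges of a copy of `K_{2,3}`. -/
inductive Edge : Corner → Corner → Prop
  | oa : Edge o a
  | ob : Edge o b
  | od : Edge o d
  | pa : Edge p a
  | pb : Edge p b
  | pd : Edge p d

end Corner

/-- The position of a vertex of the `m`-th copy of `K_{2,3}`. -/
noncomputable def cornerPoint (k : ℕ) (v : ℕ × Corner) : ℂ := framePoint k v.1 v.2.x v.2.y

/-- The links between the copies of `K_{2,3}`, in the order of the drawing. -/
inductive FrameLink (k : ℕ) : ℕ × Corner → ℕ × Corner → Prop
  | first : FrameLink k (0, .o) (1, .o)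
  | step (j : ℕ) (h : j + 2 < k) : FrameLink k (j, .p) (j + 2, .o)
  | last (j : ℕ) (h : j + 2 = k) : FrameLink k (j, .p) (j + 1, .p)

/-! ### Points away from a copy -/

section Drawing

variable {k : ℕ}

theorem frameX_cornerPoint (m : ℕ) (c : Corner) : frameX k m (cornerPoint k (m, c)) = c.x :=
  frameX_framePoint _ _

theorem frameY_cornerPoint (m : ℕ) (c : Corner) : frameY k m (cornerPoint k (m, c)) = c.y :=
  frameY_framePoint _ _

/-- A point that is not on an edge of the `m`-th copy of `K_{2,3}`, or below it. -/
def Away (k m : ℕ) (z : ℂ) : Prop :=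
  -- The third alternative is for links that leave p by prolonging the edge dp.
  3 ≤ frameX k m z ∨ frameY k m z < -1 ∨ (frameY k m z = -1 ∧ 1 < frameX k m z)

theorem away_of_ne {m j : ℕ} (h : j ≠ m) (c : Corner) : Away k m (cornerPoint k (j, c)) := by
  obtain ⟨h1, h2, h3, h4⟩ := c.bounds
  rcases lt_or_gt_of_ne h with h | h
  · exact .inr (.inl (frameY_lt h h2 h3 h4))
  · by_cases hm : m = 0
    · subst hm
      rcases far_zero (k := k) h.ne' h3 with h | h
      exacts [.inl h.1, .inr (.inl h.1)]
    · exact .inl (le_frameX hm h h1 h3)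

theorem away_of_frameX {m : ℕ} {u v z : ℂ} (hu : 3 ≤ frameX k m u) (hv : 3 ≤ frameX k m v)
    (hz : z ∈ openSegment ℝ u v) : Away k m z := by
  obtain ⟨r, h0, h1, rfl⟩ := exists_eq_add_of_mem_openSegment hz
  left
  rw [frameX_add_mul]
  nlinarith

theorem away_of_frameY {m : ℕ} {u v z : ℂ} (hu : frameY k m u < -1) (hv : frameY k m v < -1)
    (hz : z ∈ openSegment ℝ u v) : Away k m z := by
  obtain ⟨r, h0, h1, rfl⟩ := exists_eq_add_of_mem_openSegment hz
  right; left
  rw [frameY_add_mul]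
  nlinarith

theorem away_of_p {m : ℕ} {v z : ℂ} (h1 : frameY k m v ≤ -1)
    (h3 : frameY k m v < -1 ∨ 1 < frameX k m v)
    (hz : z ∈ openSegment ℝ (cornerPoint k (m, .p)) v) : Away k m z := by
  obtain ⟨r, h0, h1', rfl⟩ := exists_eq_add_of_mem_openSegment hz
  right
  rw [frameX_add_mul, frameY_add_mul, frameX_cornerPoint, frameY_cornerPoint]
  simp only [Corner.x, Corner.y]
  rcases lt_or_eq_of_le h1 with h | h
  · left; nlinarith
  · right
    have := h3.resolve_left (by linarith)
    constructor
    · rw [h]; ring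
    · nlinarith

theorem away_of_edge {m j : ℕ} (h : j ≠ m) (c c' : Corner) {z : ℂ}
    (hz : z ∈ openSegment ℝ (cornerPoint k (j, c)) (cornerPoint k (j, c'))) : Away k m z := by
  obtain ⟨h1, h2, h3, h4⟩ := c.bounds
  obtain ⟨h1', h2', h3', h4'⟩ := c'.bounds
  rcases lt_or_gt_of_ne h with h | h
  · exact away_of_frameY (frameY_lt h h2 h3 h4) (frameY_lt h h2' h3' h4') hz
  · by_cases hm : m = 0
    · subst hm
      rcases far_zero (k := k) h.ne' h3 with h | h <;>
      rcases far_zero (k := k) (ne_of_gt ‹0 < j›) h3' with h' | h'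
      · exact away_of_frameX h.1 h'.1 hz
      · exact absurd h'.2 h.2
      · exact absurd h.2 h'.2
      · exact away_of_frameY h.1 h'.1 hz
    · exact away_of_frameX (le_frameX hm h h1 h3) (le_frameX hm h h1' h3') hz

/-- A point that lies in the lower part of the second axis of the `m`-th frame, on a segment in the
direction of this axis. -/
def OnAxis (k m : ℕ) (u v z : ℂ) : Prop :=
  frameX k m u = frameX k m v ∧ frameX k m z = 0 ∧ frameY k m z < 0

theorem onAxis_of_o {m : ℕ} {v z : ℂ} (h1 : frameX k m v = 0) (h2 : frameY k m v < 0)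
    (hz : z ∈ openSegment ℝ (cornerPoint k (m, .o)) v) :
    OnAxis k m (cornerPoint k (m, .o)) v z := by
  obtain ⟨r, h0, h1', rfl⟩ := exists_eq_add_of_mem_openSegment hz
  rw [OnAxis, frameX_add_mul, frameY_add_mul, frameX_cornerPoint, frameY_cornerPoint, h1]
  simp only [Corner.x, Corner.y]
  exact ⟨trivial, by ring, by nlinarith⟩

theorem OnAxis.symm {m : ℕ} {u v z : ℂ} (h : OnAxis k m u v z) : OnAxis k m v u z :=
  ⟨h.1.symm, h.2⟩

end Drawing


/-! ### Position of the links relative to the copies -/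

section Drawing

variable {k : ℕ}

theorem cornerPoint_o_of_isLower {m : ℕ} (h : m ≠ 0) (h' : IsLower k m) :
    cornerPoint k (m, .o) = ⟨20 * (m + 1) + 1, 20 * (m - 1)⟩ := by
  simp [cornerPoint, framePoint, h, h', Corner.x, Corner.y]

theorem cornerPoint_o_of_not_isLower {m : ℕ} (h : m ≠ 0) (h' : ¬ IsLower k m) :
    cornerPoint k (m, .o) = ⟨20 * (m - 1), 20 * (m + 1) + 1⟩ := by
  simp [cornerPoint, framePoint, h, h', Corner.x, Corner.y]

theorem cornerPoint_zero_o : cornerPoint k (0, .o) = 0 := by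
  apply Complex.ext <;> simp [cornerPoint, framePoint, Corner.x, Corner.y]

theorem cornerPoint_zero_p : cornerPoint k (0, .p) = ⟨20, 20⟩ := by
  simp [cornerPoint, framePoint, Corner.x, Corner.y]

theorem cornerPoint_p_of_isLower {m : ℕ} (h : m ≠ 0) (h' : IsLower k m) :
    cornerPoint k (m, .p) = ⟨20 * (m + 1), 20 * (m - 1) + 1⟩ := by
  simp [cornerPoint, framePoint, h, h', Corner.x, Corner.y]

theorem cornerPoint_p_of_not_isLower {m : ℕ} (h : m ≠ 0) (h' : ¬ IsLower k m) :
    cornerPoint k (m, .p) = ⟨20 * (m - 1) + 1, 20 * (m + 1)⟩ := by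
  simp [cornerPoint, framePoint, h, h', Corner.x, Corner.y]

/-- The links in the interior of the drawing are axis-parallel. -/
theorem step_axis (j : ℕ) :
    (IsLower k (j + 2) ∧ (cornerPoint k (j, .p)).im = 20 * (j + 1) ∧
      (cornerPoint k (j + 2, .o)).im = 20 * (j + 1)) ∨
    (¬ IsLower k (j + 2) ∧ (cornerPoint k (j, .p)).re = 20 * (j + 1) ∧
      (cornerPoint k (j + 2, .o)).re = 20 * (j + 1)) := by
  by_cases h : IsLower k (j + 2)
  · refine .inl ⟨h, ?_, ?_⟩
    · by_cases hj : j = 0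
      · subst hj; rw [cornerPoint_zero_p]; norm_num
      · rw [cornerPoint_p_of_not_isLower hj (isLower_add_two.mp h)]
    · rw [cornerPoint_o_of_isLower (by omega) h]; push_cast; ring
  · refine .inr ⟨h, ?_, ?_⟩
    · by_cases hj : j = 0
      · subst hj; rw [cornerPoint_zero_p]; norm_num
      · rw [cornerPoint_p_of_isLower hj (by rwa [isLower_add_two, not_not] at h)]
    · rw [cornerPoint_o_of_not_isLower (by omega) h]; push_cast; ring

/-- The link leaves copy `j` at p, along or below the line of pd, passes copy `j + 1` on the right
or below, and arrives at o of copy `j + 2` along the axis from below. It is to the right of or below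
the earlier copies, and below the later ones. -/
theorem step_away (j m : ℕ) {z : ℂ}
    (hz : z ∈ openSegment ℝ (cornerPoint k (j, .p)) (cornerPoint k (j + 2, .o))) :
    Away k m z ∨ OnAxis k m (cornerPoint k (j, .p)) (cornerPoint k (j + 2, .o)) z := by
  have hj0 : (0 : ℝ) ≤ j := by positivity
  have hP := Corner.p.bounds
  have hO := Corner.o.bounds
  rcases lt_trichotomy m j with h | rfl | h
  · left
    by_cases hm : m = 0
    · subst hm
      have hj : (1 : ℝ) ≤ j := by exact_mod_cast h
      rcases step_axis (k := k) j with ⟨h0, h1, h2⟩ | ⟨h0, h1, h2⟩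
      · have := two_le_of_not_isLower h.ne' (isLower_add_two.mp h0)
        exact away_of_frameX (by rw [frameX, if_pos rfl, h1]; linarith)
          (by rw [frameX, if_pos rfl, h2]; linarith) hz
      · exact away_of_frameY (by rw [frameY, if_pos rfl, h1]; linarith)
          (by rw [frameY, if_pos rfl, h2]; linarith) hz
    · exact away_of_frameX (le_frameX hm h hP.1 hP.2.2.1)
        (le_frameX hm (by omega) hO.1 hO.2.2.1) hz
  · left
    by_cases hm : m = 0
    · subst hm
      by_cases hl : IsLower k (0 + 2)
      · refine away_of_p ?_ ?_ hz <;> rw [cornerPoint_o_of_isLower (by omega) hl, frameY] <;> norm_num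
      · refine away_of_p ?_ ?_ hz <;> rw [cornerPoint_o_of_not_isLower (by omega) hl, frameY]
        · norm_num
        · rw [frameX]; norm_num
    · by_cases hl : IsLower k (m + 2)
      · have hl' := isLower_add_two.mp hl
        refine away_of_p ?_ ?_ hz <;>
          rw [cornerPoint_o_of_isLower (by omega) hl, frameY, if_neg hm, if_neg hl'] <;> push_cast
        · linarith
        · right; rw [frameX, if_neg hm, if_neg hl']; simp only; linarith
      · have hl' : IsLower k m := by rwa [isLower_add_two, not_not] at hl
        refine away_of_p ?_ ?_ hz <;>
          rw [cornerPoint_o_of_not_isLower (by omega) hl, frameY, if_neg hm, if_pos hl'] <;> push_cast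
        · linarith
        · right; rw [frameX, if_neg hm, if_pos hl']; simp only; linarith
  · rcases (by omega : m = j + 1 ∨ m = j + 2 ∨ j + 2 < m) with rfl | rfl | h2
    · left
      have hm : j + 1 ≠ 0 := by omega
      rcases step_axis (k := k) j with ⟨-, h1, h2⟩ | ⟨-, h1, h2⟩ <;> by_cases hl : IsLower k (j + 1)
      · exact away_of_frameX (by rw [frameX, if_neg hm, if_pos hl, h1]; push_cast; linarith)
          (by rw [frameX, if_neg hm, if_pos hl, h2]; push_cast; linarith) hz
      · exact away_of_frameY (by rw [frameY, if_neg hm, if_neg hl, h1]; push_cast; linarith)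
          (by rw [frameY, if_neg hm, if_neg hl, h2]; push_cast; linarith) hz
      · exact away_of_frameY (by rw [frameY, if_neg hm, if_pos hl, h1]; push_cast; linarith)
          (by rw [frameY, if_neg hm, if_pos hl, h2]; push_cast; linarith) hz
      · exact away_of_frameX (by rw [frameX, if_neg hm, if_neg hl, h1]; push_cast; linarith)
          (by rw [frameX, if_neg hm, if_neg hl, h2]; push_cast; linarith) hz
    · right
      rw [openSegment_symm] at hz
      refine (onAxis_of_o ?_ ?_ hz).symm
      · have hm : j + 2 ≠ 0 := by omega
        rcases step_axis (k := k) j with ⟨h0, h1, -⟩ | ⟨h0, h1, -⟩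
        · rw [frameX, if_neg hm, if_pos h0, h1]; push_cast; ring
        · rw [frameX, if_neg hm, if_neg h0, h1]; push_cast; ring
      · linarith [frameY_lt (k := k) (m := j + 2) (j := j) (by omega) hP.2.1 hP.2.2.1 hP.2.2.2,
          show frameY k (j + 2) (cornerPoint k (j, .p)) =
            frameY k (j + 2) (framePoint k j Corner.p.x Corner.p.y) from rfl]
    · left
      exact away_of_frameY (frameY_lt h hP.2.1 hP.2.2.1 hP.2.2.2)
        (frameY_lt h2 hO.2.1 hO.2.2.1 hO.2.2.2) hz

theorem first_away (m : ℕ) {z : ℂ}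
    (hz : z ∈ openSegment ℝ (cornerPoint k (0, .o)) (cornerPoint k (1, .o))) :
    Away k m z ∨ OnAxis k m (cornerPoint k (0, .o)) (cornerPoint k (1, .o)) z := by
  have hO := Corner.o.bounds
  rcases (by omega : m = 0 ∨ m = 1 ∨ 1 < m) with rfl | rfl | h
  · right
    refine onAxis_of_o ?_ ?_ hz <;> rw [cornerPoint_o_of_isLower one_ne_zero isLower_one]
    · rw [frameX]; norm_num
    · rw [frameY]; norm_num
  · right
    rw [openSegment_symm] at hz
    refine (onAxis_of_o ?_ ?_ hz).symm <;> rw [cornerPoint_zero_o]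
    · rw [frameX, if_neg one_ne_zero, if_pos isLower_one]; simp
    · rw [frameY, if_neg one_ne_zero, if_pos isLower_one]; norm_num
  · left
    exact away_of_frameY (frameY_lt (by omega) hO.2.1 hO.2.2.1 hO.2.2.2)
      (frameY_lt h hO.2.1 hO.2.2.1 hO.2.2.2) hz

/-- The last link joins two corners p and runs downwards from p in both frames, so it crosses
neither copy. -/
theorem last_away {j : ℕ} (hj : j + 2 = k) {m : ℕ} (hm : m < k) {z : ℂ}
    (hz : z ∈ openSegment ℝ (cornerPoint k (j, .p)) (cornerPoint k (j + 1, .p))) :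
    Away k m z := by
  have hj0 : (0 : ℝ) ≤ j := by positivity
  have hP := Corner.p.bounds
  have hl := isLower_add_one hj
  have key : ∀ i, i ≠ j + 1 → frameY k (j + 1) (cornerPoint k (i, .p)) < -1 ∨ j + 1 < i := fun i hi =>
    (lt_or_gt_of_ne hi).imp_left fun h => frameY_lt h hP.2.1 hP.2.2.1 hP.2.2.2
  rcases (by omega : m = j + 1 ∨ m = j ∨ m < j) with rfl | rfl | h
  · rw [openSegment_symm] at hz
    have := (key j (by omega)).resolve_right (by omega)
    exact away_of_p this.le (.inl this) hz
  · have : frameY k m (cornerPoint k (m + 1, .p)) < -1 := by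
      by_cases h0 : m = 0
      · subst h0
        rw [zero_add, cornerPoint_p_of_isLower one_ne_zero isLower_one, frameY]; norm_num
      · by_cases h1 : IsLower k m
        · rw [cornerPoint_p_of_not_isLower (by omega) (fun h => hl.mp h h1), frameY, if_neg h0,
            if_pos h1]
          push_cast; linarith
        · rw [cornerPoint_p_of_isLower (by omega) (hl.mpr h1), frameY, if_neg h0, if_neg h1]
          push_cast; linarith
    exact away_of_p this.le (.inl this) hz
  · by_cases h0 : m = 0
    · subst h0
      have hj1 : (1 : ℝ) ≤ j := by exact_mod_cast h
      by_cases h1 : IsLower k j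
      · refine away_of_frameY ?_ ?_ hz
        · rw [cornerPoint_p_of_isLower (by omega) h1, frameY, if_pos rfl]; simp only; linarith
        · rw [cornerPoint_p_of_not_isLower (by omega) (fun h => hl.mp h h1), frameY, if_pos rfl]
          push_cast; linarith
      · refine away_of_frameY ?_ ?_ hz
        · have := two_le_of_not_isLower h.ne' h1
          rw [cornerPoint_p_of_not_isLower (by omega) h1, frameY, if_pos rfl]; simp only; linarith
        · rw [cornerPoint_p_of_isLower (by omega) (hl.mpr h1), frameY, if_pos rfl]
          push_cast; linarith
    · exact away_of_frameX (le_frameX h0 h hP.1 hP.2.2.1)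
        (le_frameX h0 (by omega) hP.1 hP.2.2.1) hz

/-- A link avoids a copy of `K_{2,3}` with the possible exception of a crossing on the second axis of
its frame. -/
theorem FrameLink.away_or_onAxis {u v : ℕ × Corner} (h : FrameLink k u v) {m : ℕ} (hm : m < k) {z : ℂ}
    (hz : z ∈ openSegment ℝ (cornerPoint k u) (cornerPoint k v)) :
    Away k m z ∨ OnAxis k m (cornerPoint k u) (cornerPoint k v) z := by
  cases h with
  | first => exact first_away m hz
  | step j h => exact step_away j m hz
  | last j h => exact .inl (last_away h hm hz)

theorem mem_openSegment_re {u v z : ℂ} {r : ℝ} (hz : z ∈ openSegment ℝ u v) :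
    (u.re = r → v.re = r → z.re = r) ∧ (r < u.re → r < v.re → r < z.re) := by
  obtain ⟨t, h0, h1, rfl⟩ := exists_eq_add_of_mem_openSegment hz
  rw [Complex.add_re, Complex.re_ofReal_mul, Complex.sub_re]
  constructor
  · rintro rfl h; rw [h]; ring
  · intro h h'; nlinarith

theorem mem_openSegment_im {u v z : ℂ} {r : ℝ} (hz : z ∈ openSegment ℝ u v) :
    (u.im = r → v.im = r → z.im = r) ∧ (r < u.im → r < v.im → r < z.im) := by
  obtain ⟨t, h0, h1, rfl⟩ := exists_eq_add_of_mem_openSegment hz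
  rw [Complex.add_im, Complex.im_ofReal_mul, Complex.sub_im]
  constructor
  · rintro rfl h; rw [h]; ring
  · intro h h'; nlinarith

/-- The last link lies above all horizontal links and to the right of all vertical ones. -/
theorem last_bounds {j : ℕ} (hj : j + 2 = k) {z : ℂ}
    (hz : z ∈ openSegment ℝ (cornerPoint k (j, .p)) (cornerPoint k (j + 1, .p))) :
    0 < z.im ∧ ∀ i, i + 2 < k →
      (IsLower k (i + 2) → (20 * (i + 1) : ℝ) < z.im) ∧
      (¬ IsLower k (i + 2) → (20 * (i + 1) : ℝ) < z.re) := by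
  have hj0 : (0 : ℝ) ≤ j := by positivity
  have hl := isLower_add_one hj
  have hi : ∀ i, i + 2 < k → i + 2 ≠ j + 1 → i + 2 ≤ j := by omega
  have hi' : ∀ i, i + 2 ≤ j → (i : ℝ) + 2 ≤ j := fun i h => by exact_mod_cast h
  have hi'' : ∀ i, i + 2 < k → (i : ℝ) + 1 ≤ j := fun i h => by
    exact_mod_cast (by omega : i + 1 ≤ j)
  by_cases h0 : j = 0
  · subst h0
    refine ⟨(mem_openSegment_im hz).2 ?_ ?_, fun i h => absurd h (by omega)⟩
    · rw [cornerPoint_zero_p]; norm_num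
    · rw [zero_add, cornerPoint_p_of_isLower one_ne_zero isLower_one]; norm_num
  have hj1 : (1 : ℝ) ≤ j := by exact_mod_cast (by omega : 1 ≤ j)
  by_cases h1 : IsLower k j
  · have e1 := cornerPoint_p_of_isLower h0 h1
    have e2 := cornerPoint_p_of_not_isLower (k := k) (m := j + 1) (by omega) (fun h => hl.mp h h1)
    push_cast at e2
    rw [e1, e2] at hz
    refine ⟨(mem_openSegment_im hz).2 (by simp only; linarith) (by simp only; linarith),
      fun i h => ⟨fun h2 => ?_, fun h2 => ?_⟩⟩
    · have := hi' i (hi i h (fun e => hl.mp (e ▸ h2) h1))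
      exact (mem_openSegment_im hz).2 (by simp only; linarith) (by simp only; linarith)
    · have := hi'' i h
      exact (mem_openSegment_re hz).2 (by simp only; linarith) (by simp only; linarith)
  · have e1 := cornerPoint_p_of_not_isLower h0 h1
    have e2 := cornerPoint_p_of_isLower (k := k) (m := j + 1) (by omega) (hl.mpr h1)
    push_cast at e2
    rw [e1, e2] at hz
    refine ⟨(mem_openSegment_im hz).2 (by simp only; linarith) (by simp only; linarith),
      fun i h => ⟨fun h2 => ?_, fun h2 => ?_⟩⟩
    · have := hi'' i h
      exact (mem_openSegment_im hz).2 (by simp only; linarith) (by simp only; linarith)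
    · have := hi' i (hi i h (fun e => h2 (e ▸ hl.mpr h1)))
      exact (mem_openSegment_re hz).2 (by simp only; linarith) (by simp only; linarith)

theorem first_im {z : ℂ} (hz : z ∈ openSegment ℝ (cornerPoint k (0, .o)) (cornerPoint k (1, .o))) :
    z.im = 0 := by
  refine (mem_openSegment_im hz).1 ?_ ?_
  · rw [cornerPoint_zero_o]; rfl
  · rw [cornerPoint_o_of_isLower one_ne_zero isLower_one]; norm_num

theorem first_sub_im : (cornerPoint k (1, .o) - cornerPoint k (0, .o)).im = 0 := by
  rw [cornerPoint_zero_o, cornerPoint_o_of_isLower one_ne_zero isLower_one]; norm_num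

theorem step_mem {j : ℕ} {z : ℂ}
    (hz : z ∈ openSegment ℝ (cornerPoint k (j, .p)) (cornerPoint k (j + 2, .o))) :
    (IsLower k (j + 2) ∧ (cornerPoint k (j + 2, .o) - cornerPoint k (j, .p)).im = 0 ∧
      z.im = 20 * (j + 1)) ∨
    (¬ IsLower k (j + 2) ∧ (cornerPoint k (j + 2, .o) - cornerPoint k (j, .p)).re = 0 ∧
      z.re = 20 * (j + 1)) := by
  rcases step_axis (k := k) j with ⟨h, h1, h2⟩ | ⟨h, h1, h2⟩
  · exact .inl ⟨h, by rw [Complex.sub_im, h1, h2, sub_self], (mem_openSegment_im hz).1 h1 h2⟩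
  · exact .inr ⟨h, by rw [Complex.sub_re, h1, h2, sub_self], (mem_openSegment_re hz).1 h1 h2⟩

/-- Crossing links are perpendicular. -/
theorem FrameLink.axisPerp {u v u' v' : ℕ × Corner} (h : FrameLink k u v) (h' : FrameLink k u' v')
    (hne : (u, v) ≠ (u', v')) {z : ℂ} (hz : z ∈ openSegment ℝ (cornerPoint k u) (cornerPoint k v))
    (hz' : z ∈ openSegment ℝ (cornerPoint k u') (cornerPoint k v')) :
    AxisPerp (cornerPoint k v - cornerPoint k u) (cornerPoint k v' - cornerPoint k u') := by
  have fs : ∀ j, z ∈ openSegment ℝ (cornerPoint k (0, .o)) (cornerPoint k (1, .o)) →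
      z ∈ openSegment ℝ (cornerPoint k (j, .p)) (cornerPoint k (j + 2, .o)) →
      AxisPerp (cornerPoint k (1, .o) - cornerPoint k (0, .o))
        (cornerPoint k (j + 2, .o) - cornerPoint k (j, .p)) := by
    intro j h1 h2
    rcases step_mem h2 with ⟨-, -, e⟩ | ⟨-, e, -⟩
    · have hj0 : (0 : ℝ) ≤ j := by positivity
      rw [first_im h1] at e
      linarith
    · exact .inr ⟨first_sub_im, e⟩
  have sl : ∀ i j, i + 2 < k → j + 2 = k →
      z ∈ openSegment ℝ (cornerPoint k (i, .p)) (cornerPoint k (i + 2, .o)) →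
      z ∈ openSegment ℝ (cornerPoint k (j, .p)) (cornerPoint k (j + 1, .p)) → False := by
    intro i j hi hj h1 h2
    obtain ⟨-, hb⟩ := last_bounds hj h2
    rcases step_mem h1 with ⟨e0, -, e⟩ | ⟨e0, -, e⟩
    · linarith [(hb i hi).1 e0]
    · linarith [(hb i hi).2 e0]
  cases h with
  | first =>
    cases h' with
    | first => exact absurd rfl hne
    | step j h => exact fs j hz hz'
    | last j h => linarith [(last_bounds h hz').1, first_im hz]
  | step j h =>
    cases h' with
    | first => exact (fs j hz' hz).symm
    | step i h' =>
      -- Distinct parallel links lie on different lines.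
      have key : (20 * (j + 1) : ℝ) ≠ 20 * (i + 1) := by
        intro e
        have : (j : ℝ) = i := by linarith
        have : j = i := by exact_mod_cast this
        subst this
        exact hne rfl
      rcases step_mem hz with ⟨-, e1, e2⟩ | ⟨-, e1, e2⟩ <;>
      rcases step_mem hz' with ⟨-, e1', e2'⟩ | ⟨-, e1', e2'⟩
      · exact absurd (e2.symm.trans e2') key
      · exact .inr ⟨e1, e1'⟩
      · exact .inl ⟨e1, e1'⟩
      · exact absurd (e2.symm.trans e2') key
    | last i h' => exact (sl j i h h' hz hz').elim
  | last j h =>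
    cases h' with
    | first => linarith [(last_bounds h hz).1, first_im hz']
    | step i h' => exact (sl i j h' h hz' hz).elim
    | last i h' =>
      obtain rfl : i = j := by omega
      exact absurd rfl hne

end Drawing


/-! ### All edges of the drawing -/

section Drawing

variable {k : ℕ}

theorem mem_openSegment_frame {m : ℕ} {c c' : Corner} {z : ℂ}
    (hz : z ∈ openSegment ℝ (cornerPoint k (m, c)) (cornerPoint k (m, c'))) :
    ∃ r : ℝ, 0 < r ∧ r < 1 ∧ frameX k m z = c.x + r * (c'.x - c.x) ∧
      frameY k m z = c.y + r * (c'.y - c.y) := by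
  obtain ⟨r, h0, h1, rfl⟩ := exists_eq_add_of_mem_openSegment hz
  refine ⟨r, h0, h1, ?_, ?_⟩
  · rw [frameX_add_mul, frameX_cornerPoint, frameX_cornerPoint]
  · rw [frameY_add_mul, frameY_cornerPoint, frameY_cornerPoint]

theorem not_away_corner (m : ℕ) (c : Corner) : ¬ Away k m (cornerPoint k (m, c)) := by
  rw [Away, frameX_cornerPoint, frameY_cornerPoint]
  cases c <;> simp only [Corner.x, Corner.y] <;> norm_num

theorem not_onAxis_corner (m : ℕ) (c : Corner) (u v : ℂ) :
    ¬ OnAxis k m u v (cornerPoint k (m, c)) := by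
  rw [OnAxis, frameX_cornerPoint, frameY_cornerPoint]
  cases c <;> simp only [Corner.x, Corner.y] <;> norm_num

theorem cornerPoint_injective {v w : ℕ × Corner} (h : cornerPoint k v = cornerPoint k w) : v = w := by
  obtain ⟨m, c⟩ := v
  obtain ⟨j, c'⟩ := w
  by_cases hm : j = m
  · subst hm
    have h1 := frameX_cornerPoint (k := k) j c
    have h2 := frameY_cornerPoint (k := k) j c
    rw [h, frameX_cornerPoint] at h1
    rw [h, frameY_cornerPoint] at h2
    cases c <;> cases c' <;> first
      | rfl
      | (simp only [Corner.x, Corner.y] at h1 h2 <;> linarith)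
  · have := away_of_ne (k := k) hm c'
    rw [← h] at this
    exact absurd this (not_away_corner m c)

theorem Corner.Edge.not_away {m : ℕ} {c c' : Corner} (h : Corner.Edge c c') {z : ℂ}
    (hz : z ∈ openSegment ℝ (cornerPoint k (m, c)) (cornerPoint k (m, c'))) : ¬ Away k m z := by
  obtain ⟨r, h0, h1, e1, e2⟩ := mem_openSegment_frame hz
  rw [Away, e1, e2]
  rintro (h | h | ⟨h, h'⟩) <;> cases ‹Corner.Edge c c'› <;> simp only [Corner.x, Corner.y] at * <;>
    linarith

/-- Only pd meets the negative part of the second axis in its relative interior, and pd is parallel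
to the first axis. -/
theorem Corner.Edge.axisPerp_of_onAxis {m : ℕ} {c c' : Corner} (h : Corner.Edge c c') {u v z : ℂ}
    (hz : z ∈ openSegment ℝ (cornerPoint k (m, c)) (cornerPoint k (m, c')))
    (hz' : OnAxis k m u v z) :
    AxisPerp (v - u) (cornerPoint k (m, c') - cornerPoint k (m, c)) := by
  obtain ⟨r, h0, h1, e1, e2⟩ := mem_openSegment_frame hz
  obtain ⟨h2, h3, h4⟩ := hz'
  rw [e1] at h3
  rw [e2] at h4
  cases h <;> simp only [Corner.x, Corner.y] at h3 h4
  case pd =>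
    refine axisPerp_of_frame h2 ?_
    rw [frameY_cornerPoint, frameY_cornerPoint]; rfl
  all_goals linarith

theorem Corner.Edge.axisPerp {m : ℕ} {c c' e e' : Corner} (h : Corner.Edge c c')
    (h' : Corner.Edge e e') (hne : (c, c') ≠ (e, e')) {z : ℂ}
    (hz : z ∈ openSegment ℝ (cornerPoint k (m, c)) (cornerPoint k (m, c')))
    (hz' : z ∈ openSegment ℝ (cornerPoint k (m, e)) (cornerPoint k (m, e'))) :
    AxisPerp (cornerPoint k (m, c') - cornerPoint k (m, c))
      (cornerPoint k (m, e') - cornerPoint k (m, e)) := by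
  obtain ⟨r, h0, h1, e1, e2⟩ := mem_openSegment_frame hz
  obtain ⟨r', h0', h1', e1', e2'⟩ := mem_openSegment_frame hz'
  rw [e1] at e1'
  rw [e2] at e2'
  have oapb : AxisPerp (cornerPoint k (m, .b) - cornerPoint k (m, .p))
      (cornerPoint k (m, .a) - cornerPoint k (m, .o)) := by
    refine axisPerp_of_frame (k := k) (m := m) ?_ ?_
    · rw [frameX_cornerPoint, frameX_cornerPoint]; rfl
    · rw [frameY_cornerPoint, frameY_cornerPoint]; rfl
  cases h <;> cases h' <;> simp only [Corner.x, Corner.y] at e1' e2' <;>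
    first
    | exact absurd rfl hne
    | exact oapb
    | exact oapb.symm
    | (exfalso; linarith)

theorem Corner.Edge.notMem {m : ℕ} {c c' : Corner} (h : Corner.Edge c c') (e : Corner) :
    cornerPoint k (m, e) ∉ openSegment ℝ (cornerPoint k (m, c)) (cornerPoint k (m, c')) := by
  intro hz
  obtain ⟨r, h0, h1, e1, e2⟩ := mem_openSegment_frame hz
  rw [frameX_cornerPoint] at e1
  rw [frameY_cornerPoint] at e2
  cases h <;> cases e <;> simp only [Corner.x, Corner.y] at e1 e2 <;> linarith

/-- The edges of the drawing. -/
inductive FrameEdge (k : ℕ) : ℕ × Corner → ℕ × Corner → Prop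
  | corner (m : ℕ) (hm : m < k) {c c' : Corner} (h : Corner.Edge c c') : FrameEdge k (m, c) (m, c')
  | link {u v : ℕ × Corner} (h : FrameLink k u v) : FrameEdge k u v

theorem FrameEdge.axisPerp {u v u' v' : ℕ × Corner} (h : FrameEdge k u v) (h' : FrameEdge k u' v')
    (hne : (u, v) ≠ (u', v')) {z : ℂ} (hz : z ∈ openSegment ℝ (cornerPoint k u) (cornerPoint k v))
    (hz' : z ∈ openSegment ℝ (cornerPoint k u') (cornerPoint k v')) :
    AxisPerp (cornerPoint k v - cornerPoint k u) (cornerPoint k v' - cornerPoint k u') := by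
  cases h with
  | @corner m hm c c' h =>
    cases h' with
    | @corner j hj e e' h' =>
      by_cases hjm : j = m
      · subst hjm
        exact h.axisPerp h' (fun he => hne (by cases he; rfl)) hz hz'
      · exact absurd (away_of_edge hjm _ _ hz') (h.not_away hz)
    | link h' =>
      rcases h'.away_or_onAxis hm hz' with h1 | h1
      · exact absurd h1 (h.not_away hz)
      · exact (h.axisPerp_of_onAxis hz h1).symm
  | link h =>
    cases h' with
    | @corner j hj e e' h' =>
      rcases h.away_or_onAxis hj hz with h1 | h1
      · exact absurd h1 (h'.not_away hz')
      · exact h'.axisPerp_of_onAxis hz' h1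
    | link h' => exact h.axisPerp h' hne hz hz'

theorem FrameEdge.notMem {u v : ℕ × Corner} (h : FrameEdge k u v) {w : ℕ × Corner} (hw : w.1 < k) :
    cornerPoint k w ∉ openSegment ℝ (cornerPoint k u) (cornerPoint k v) := by
  obtain ⟨m, e⟩ := w
  intro hz
  cases h with
  | @corner j hj c c' h =>
    by_cases hjm : j = m
    · subst hjm; exact h.notMem e hz
    · exact not_away_corner m e (away_of_edge hjm _ _ hz)
  | link h =>
    rcases h.away_or_onAxis hw hz with h1 | h1
    exacts [not_away_corner m e h1, not_onAxis_corner m e _ _ h1]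

/-! ### Leaving the drawing -/

/-- The turning point of the path from a vertex to infinity. -/
noncomputable def Corner.exit : Corner → ℝ × ℝ
  -- From each corner a segment leads clear of its own copy. For p the value 5/2 passes between a at
  -- 2 and the other copies, which are at 3 or beyond; for d the segment goes left before rising.
  | .o => (-1, 1)
  | .p => (5 / 2, -1 / 2)
  | .a => (2, 1)
  | .b => (1, 2)
  | .d => (-2, 0)

/-- The direction in which the path from a vertex leaves the drawing. -/
noncomputable def Corner.dir : Corner → ℝ × ℝ
  | .o => (-1, 1)
  | .p => (0, 1)
  | .a => (0, 1)
  | .b => (0, 1)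
  | .d => (-1, 1)

/-- A point off the drawing, in coordinates of a frame. -/
def FreePoint (x y : ℝ) : Prop :=
  -- The first two conditions exclude `Away`, hence all other copies and most links. The third
  -- excludes links arriving along the axis. The rest excludes the copy itself.
  x ≤ 5 / 2 ∧ -1 < y ∧ (x ≠ 0 ∨ 0 < y) ∧ (∀ c : Corner, x ≠ c.x ∨ y ≠ c.y) ∧
    ∀ c c' : Corner, Corner.Edge c c' → ∀ r : ℝ, 0 < r → r < 1 →
      x ≠ c.x + r * (c'.x - c.x) ∨ y ≠ c.y + r * (c'.y - c.y)

theorem Corner.freePoint_segment (c : Corner) {t : ℝ} (h0 : 0 < t) (h1 : t ≤ 1) :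
    FreePoint (c.x + t * (c.exit.1 - c.x)) (c.y + t * (c.exit.2 - c.y)) := by
  refine ⟨?_, ?_, ?_, ?_, ?_⟩
  · cases c <;> simp only [Corner.x, Corner.exit] <;> linarith
  · cases c <;> simp only [Corner.y, Corner.exit] <;> linarith
  · by_contra h
    push Not at h
    obtain ⟨e1, e2⟩ := h
    cases c <;> simp only [Corner.x, Corner.y, Corner.exit] at e1 e2 <;> linarith
  · intro e
    by_contra h
    push Not at h
    obtain ⟨e1, e2⟩ := h
    cases c <;> cases e <;> simp only [Corner.x, Corner.y, Corner.exit] at e1 e2 <;> linarith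
  · intro e e' he r h2 h3
    by_contra h
    push Not at h
    obtain ⟨e1, e2⟩ := h
    cases c <;> cases he <;> simp only [Corner.x, Corner.y, Corner.exit] at e1 e2 <;> linarith

theorem Corner.freePoint_ray (c : Corner) {t : ℝ} (h0 : 0 ≤ t) :
    FreePoint (c.exit.1 + t * c.dir.1) (c.exit.2 + t * c.dir.2) := by
  refine ⟨?_, ?_, ?_, ?_, ?_⟩
  · cases c <;> simp only [Corner.dir, Corner.exit] <;> linarith
  · cases c <;> simp only [Corner.dir, Corner.exit] <;> linarith
  · by_contra h
    push Not at h
    obtain ⟨e1, e2⟩ := h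
    cases c <;> simp only [Corner.dir, Corner.exit] at e1 e2 <;> linarith
  · intro e
    by_contra h
    push Not at h
    obtain ⟨e1, e2⟩ := h
    cases c <;> cases e <;> simp only [Corner.x, Corner.y, Corner.exit, Corner.dir] at e1 e2 <;>
      linarith
  · intro e e' he r h2 h3
    by_contra h
    push Not at h
    obtain ⟨e1, e2⟩ := h
    cases c <;> cases he <;> simp only [Corner.x, Corner.y, Corner.exit, Corner.dir] at e1 e2 <;>
      linarith

theorem FreePoint.not_away {m : ℕ} {x y : ℝ} (h : FreePoint x y) :
    ¬ Away k m (framePoint k m x y) := by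
  rw [Away, frameX_framePoint, frameY_framePoint]
  obtain ⟨h1, h2, -⟩ := h
  rintro (h | h | ⟨h, -⟩) <;> linarith

theorem FreePoint.ne_cornerPoint {m : ℕ} {x y : ℝ} (h : FreePoint x y) (v : ℕ × Corner) :
    cornerPoint k v ≠ framePoint k m x y := by
  obtain ⟨j, c⟩ := v
  intro e
  by_cases hjm : j = m
  · subst hjm
    have h1 := frameX_framePoint (k := k) (m := j) x y
    have h2 := frameY_framePoint (k := k) (m := j) x y
    rw [← e, frameX_cornerPoint] at h1
    rw [← e, frameY_cornerPoint] at h2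
    rcases h.2.2.2.1 c with h | h
    exacts [h h1.symm, h h2.symm]
  · exact h.not_away (e ▸ away_of_ne hjm c)

theorem FreePoint.notMem {m : ℕ} (hm : m < k) {x y : ℝ} (h : FreePoint x y) {u v : ℕ × Corner}
    (he : FrameEdge k u v) :
    framePoint k m x y ∉ openSegment ℝ (cornerPoint k u) (cornerPoint k v) := by
  intro hz
  cases he with
  | @corner j hj c c' he =>
    by_cases hjm : j = m
    · subst hjm
      obtain ⟨r, h0, h1, e1, e2⟩ := mem_openSegment_frame hz
      rw [frameX_framePoint] at e1
      rw [frameY_framePoint] at e2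
      rcases h.2.2.2.2 _ _ he r h0 h1 with h | h
      exacts [h e1, h e2]
    · exact h.not_away (away_of_edge hjm _ _ hz)
  | link he =>
    rcases he.away_or_onAxis hm hz with h1 | ⟨-, h1, h2⟩
    · exact h.not_away h1
    · rw [frameX_framePoint] at h1
      rw [frameY_framePoint] at h2
      rcases h.2.2.1 with h | h
      exacts [h h1, by linarith]

end Drawing


/-! ### Folding the cycle into the drawing -/

section Placement

variable {k : ℕ}

/-- The position in the drawing of the copy of `K_{2,3}` with a given index: the even positions are
taken in ascending order and then the odd ones in descending order. -/
def place (r : ZMod k) : ℕ := if 2 * r.val ≤ k - 1 then 2 * r.val else 2 * (k - r.val) - 1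

theorem place_lt [NeZero k] (r : ZMod k) : place r < k := by
  have := ZMod.val_lt r
  unfold place
  split_ifs <;> omega

theorem place_injective [NeZero k] : Function.Injective (place : ZMod k → ℕ) := by
  intro r r' h
  have h1 := ZMod.val_lt r
  have h2 := ZMod.val_lt r'
  unfold place at h
  exact ZMod.val_injective k (by split_ifs at h <;> omega)

/-- The vertices of the linked graph in the drawing. -/
def toFrame : LinkedVertex k → ℕ × Corner
  -- On the way back, at odd positions, the cycle runs through the copies in the opposite direction,
  -- so the roles of o and p are exchanged.
  | .s r => (place r, if place r % 2 = 0 then .o else .p)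
  | .t r => (place r, if place r % 2 = 0 then .p else .o)
  | .x r => (place r, .a)
  | .y r => (place r, .b)
  | .z r => (place r, .d)

theorem toFrame_fst_lt [NeZero k] (v : LinkedVertex k) : (toFrame v).1 < k := by
  cases v <;> exact place_lt _

theorem toFrame_injective [NeZero k] : Function.Injective (toFrame : LinkedVertex k → ℕ × Corner) := by
  intro u v h
  have h1 := congrArg Prod.fst h
  have h2 := congrArg Prod.snd h
  cases u <;> cases v <;> simp only [toFrame] at h1 h2 <;> have h3 := place_injective h1 <;>
    subst h3 <;> first
    | rfl
    | cases h2
    | (split_ifs at h2)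

theorem frameEdge_s [NeZero k] (r : ZMod k) {c : Corner} (ho : Corner.Edge .o c)
    (hp : Corner.Edge .p c) : FrameEdge k (toFrame (.s r)) (place r, c) := by
  simp only [toFrame]
  split_ifs
  exacts [.corner _ (place_lt r) ho, .corner _ (place_lt r) hp]

theorem frameEdge_t [NeZero k] (r : ZMod k) {c : Corner} (ho : Corner.Edge .o c)
    (hp : Corner.Edge .p c) : FrameEdge k (toFrame (.t r)) (place r, c) := by
  simp only [toFrame]
  split_ifs
  exacts [.corner _ (place_lt r) hp, .corner _ (place_lt r) ho]

/-- The link closing the cycle joins positions 1 and 0 and is `first`; at the fold the link joins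
the two largest positions and is `last`. All others join positions that differ by 2, and are
traversed in reverse at odd positions. -/
theorem frameLink_toFrame (hk : 2 ≤ k) (r : ZMod k) :
    FrameLink k (toFrame (.t r)) (toFrame (.s (r + 1))) ∨
      FrameLink k (toFrame (.s (r + 1))) (toFrame (.t r)) := by
  have : NeZero k := ⟨by omega⟩
  have hr := ZMod.val_lt r
  have hv : (r + 1).val = (r.val + 1) % k := by
    rw [ZMod.val_add, ZMod.val_one_eq_one_mod, Nat.add_mod_mod]
  simp only [toFrame]
  by_cases h : r.val + 1 = k
  · have e1 : place r = 1 := by unfold place; split_ifs <;> omega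
    have e2 : place (r + 1) = 0 := by unfold place; rw [hv, h, Nat.mod_self]; simp
    rw [e1, e2]
    exact .inr .first
  · rw [Nat.mod_eq_of_lt (by omega)] at hv
    by_cases h1 : 2 * r.val + 2 ≤ k - 1
    · have e1 : place r = 2 * r.val := by unfold place; split_ifs <;> omega
      have e2 : place (r + 1) = 2 * r.val + 2 := by unfold place; rw [hv]; split_ifs <;> omega
      rw [e1, e2, if_pos (by omega), if_pos (by omega)]
      exact .inl (.step _ (by omega))
    · by_cases h2 : 2 * r.val ≤ k - 1
      · have e1 : place r = 2 * r.val := by unfold place; split_ifs <;> omega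
        have e2 : place (r + 1) = 2 * (k - (r.val + 1)) - 1 := by
          unfold place; rw [hv]; split_ifs <;> omega
        rw [e1, e2, if_pos (by omega), if_neg (by omega)]
        rcases (by omega : k = 2 * r.val + 1 ∨ k = 2 * r.val + 2) with h3 | h3
        · right
          have := FrameLink.last (k := k) (2 * (k - (r.val + 1)) - 1) (by omega)
          rwa [show 2 * (k - (r.val + 1)) - 1 + 1 = 2 * r.val by omega] at this
        · left
          have := FrameLink.last (k := k) (2 * r.val) (by omega)
          rwa [show 2 * r.val + 1 = 2 * (k - (r.val + 1)) - 1 by omega] at this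
      · have e1 : place r = 2 * (k - r.val) - 1 := by unfold place; split_ifs <;> omega
        have e2 : place (r + 1) = 2 * (k - (r.val + 1)) - 1 := by
          unfold place; rw [hv]; split_ifs <;> omega
        rw [e1, e2, if_neg (by omega), if_neg (by omega)]
        right
        have := FrameLink.step (k := k) (2 * (k - (r.val + 1)) - 1) (by omega)
        rwa [show 2 * (k - (r.val + 1)) - 1 + 2 = 2 * (k - r.val) - 1 by omega] at this

theorem frameEdge_toFrame (hk : 2 ≤ k) {u v : LinkedVertex k} (h : (linkedGraph k).Adj u v) :
    FrameEdge k (toFrame u) (toFrame v) ∨ FrameEdge k (toFrame v) (toFrame u) := by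
  have : NeZero k := ⟨by omega⟩
  have key : ∀ {u v : LinkedVertex k}, LinkedRel k u v →
      FrameEdge k (toFrame u) (toFrame v) ∨ FrameEdge k (toFrame v) (toFrame u) := by
    intro u v h
    cases h with
    | sx i => exact .inl (frameEdge_s i .oa .pa)
    | xt i => exact .inr (frameEdge_t i .oa .pa)
    | sy i => exact .inl (frameEdge_s i .ob .pb)
    | yt i => exact .inr (frameEdge_t i .ob .pb)
    | sz i => exact .inl (frameEdge_s i .od .pd)
    | zt i => exact .inr (frameEdge_t i .od .pd)
    | link i => exact (frameLink_toFrame hk i).imp .link .link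
  rcases h.2 with h | h
  exacts [key h, (key h).symm]

end Placement

/-! ### Incidence to the outer cell and verification of the drawing -/

/-- A connected unbounded set off the drawing lies in a single component, which is then unbounded
too. -/
theorem StraightLineDrawing.mem_closure_outerCell {V : Type*} {G : SimpleGraph V}
    (D : StraightLineDrawing G) {S : Set Plane} (hS : IsPreconnected S) (hsub : S ⊆ D.carrierᶜ)
    (hb : ¬ Bornology.IsBounded S) {p : Plane} (hp : p ∈ closure S) : p ∈ closure D.outerCell :=
  closure_mono (t := D.outerCell) (fun _ hz => ⟨hsub hz, fun h =>
    hb (h.subset (hS.subset_connectedComponentIn hz hsub))⟩) hp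

theorem continuous_framePoint (k m : ℕ) : Continuous fun p : ℝ × ℝ => framePoint k m p.1 p.2 := by
  unfold framePoint
  split_ifs
  all_goals
    refine Complex.equivRealProdCLM.symm.continuous.comp (Continuous.prodMk ?_ ?_) <;> fun_prop

theorem continuous_frameY (k m : ℕ) : Continuous (frameY k m) := by
  unfold frameY
  split_ifs
  · exact (Complex.continuous_re.neg).div_const _
  · exact Complex.continuous_re.sub continuous_const
  · exact Complex.continuous_im.sub continuous_const

theorem Corner.dir_snd (c : Corner) : c.dir.2 = 1 := by cases c <;> rfl

theorem Corner.exit_snd (c : Corner) : -1 ≤ c.exit.2 := by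
  cases c <;> simp only [Corner.exit] <;> norm_num

section LinkedDrawing

variable {k : ℕ}

theorem AxisPerp.swap_left {x y z : ℂ} (h : AxisPerp (x - y) z) : AxisPerp (y - x) z := by
  have := h.real_mul_left (-1)
  rwa [Complex.ofReal_neg, Complex.ofReal_one, neg_one_mul, neg_sub] at this

theorem axisPerp_toFrame (hk : 2 ≤ k) {u v u' v' : LinkedVertex k} (h : (linkedGraph k).Adj u v)
    (h' : (linkedGraph k).Adj u' v') (hne : s(u, v) ≠ s(u', v')) {z : ℂ}
    (hz : z ∈ openSegment ℝ (cornerPoint k (toFrame u)) (cornerPoint k (toFrame v)))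
    (hz' : z ∈ openSegment ℝ (cornerPoint k (toFrame u')) (cornerPoint k (toFrame v'))) :
    AxisPerp (cornerPoint k (toFrame v) - cornerPoint k (toFrame u))
      (cornerPoint k (toFrame v') - cornerPoint k (toFrame u')) := by
  have : NeZero k := ⟨by omega⟩
  have key : ∀ {u v u' v' : LinkedVertex k}, FrameEdge k (toFrame u) (toFrame v) →
      FrameEdge k (toFrame u') (toFrame v') → s(u, v) ≠ s(u', v') →
      z ∈ openSegment ℝ (cornerPoint k (toFrame u)) (cornerPoint k (toFrame v)) →
      z ∈ openSegment ℝ (cornerPoint k (toFrame u')) (cornerPoint k (toFrame v')) →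
      AxisPerp (cornerPoint k (toFrame v) - cornerPoint k (toFrame u))
        (cornerPoint k (toFrame v') - cornerPoint k (toFrame u')) := by
    intro u v u' v' h h' hne hz hz'
    refine h.axisPerp h' (fun e => hne ?_) hz hz'
    rw [toFrame_injective (congrArg Prod.fst e), toFrame_injective (congrArg Prod.snd e)]
  rcases frameEdge_toFrame hk h with e | e <;> rcases frameEdge_toFrame hk h' with e' | e'
  · exact key e e' hne hz hz'
  · rw [openSegment_symm] at hz'
    exact (key e e' (by rwa [Sym2.eq_swap (a := v')]) hz hz').symm.swap_left.symm
  · rw [openSegment_symm] at hz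
    exact (key e e' (by rwa [Sym2.eq_swap (a := v)]) hz hz').swap_left
  · rw [openSegment_symm] at hz hz'
    exact (key e e' (by rwa [Sym2.eq_swap (a := v), Sym2.eq_swap (a := v')]) hz
      hz').swap_left.symm.swap_left.symm

theorem notMem_toFrame (hk : 2 ≤ k) {u v : LinkedVertex k} (h : (linkedGraph k).Adj u v)
    {z : ℂ} (hz : ∀ u' v', FrameEdge k u' v' → z ∉ openSegment ℝ (cornerPoint k u') (cornerPoint k v')) :
    z ∉ openSegment ℝ (cornerPoint k (toFrame u)) (cornerPoint k (toFrame v)) := by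
  rcases frameEdge_toFrame hk h with e | e
  · exact hz _ _ e
  · rw [openSegment_symm]; exact hz _ _ e

theorem rotatePlane_symm_mem_openSegment {z : Plane} {x y : ℂ} :
    z ∈ openSegment ℝ (rotatePlane.symm x) (rotatePlane.symm y) ↔ rotatePlane z ∈ openSegment ℝ x y := by
  rw [← rotatePlane_mem_openSegment, rotatePlane.apply_symm_apply, rotatePlane.apply_symm_apply]

/-- The drawing of the linked graph. -/
noncomputable def linkedDrawing (hk : 2 ≤ k) : StraightLineDrawing (linkedGraph k) where
  pos v := rotatePlane.symm (cornerPoint k (toFrame v))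
  pos_injective := by
    have : NeZero k := ⟨by omega⟩
    intro u v h
    exact toFrame_injective (cornerPoint_injective (rotatePlane.symm.injective h))
  vertex_notMem_edge := by
    have : NeZero k := ⟨by omega⟩
    intro u v w h
    rw [rotatePlane_symm_mem_openSegment, rotatePlane.apply_symm_apply]
    exact notMem_toFrame hk h fun u' v' h => h.notMem (toFrame_fst_lt w)

theorem notMem_carrier (hk : 2 ≤ k) {m : ℕ} (hm : m < k) {x y : ℝ} (h : FreePoint x y) :
    rotatePlane.symm (framePoint k m x y) ∈ (linkedDrawing hk).carrierᶜ := by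
  rintro (⟨v, hv⟩ | ⟨u, v, huv, hz⟩)
  · exact h.ne_cornerPoint _ (rotatePlane.symm.injective hv)
  · rw [← insert_endpoints_openSegment] at hz
    rcases hz with e | e | hz
    · exact h.ne_cornerPoint _ (rotatePlane.symm.injective e.symm)
    · exact h.ne_cornerPoint _ (rotatePlane.symm.injective e.symm)
    · have hz : rotatePlane.symm (framePoint k m x y) ∈
          openSegment ℝ (rotatePlane.symm (cornerPoint k (toFrame u)))
            (rotatePlane.symm (cornerPoint k (toFrame v))) := hz
      rw [rotatePlane_symm_mem_openSegment, rotatePlane.apply_symm_apply] at hz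
      exact notMem_toFrame hk huv (fun u' v' he => h.notMem hm he) hz

theorem linkedDrawing_outer (hk : 2 ≤ k) (v : LinkedVertex k) :
    (linkedDrawing hk).pos v ∈ closure (linkedDrawing hk).outerCell := by
  have : NeZero k := ⟨by omega⟩
  obtain ⟨⟨m, c⟩, hv⟩ : ∃ p, toFrame v = p := ⟨_, rfl⟩
  have hm : m < k := by have := toFrame_fst_lt v; rwa [hv] at this
  set f : ℝ × ℝ → Plane := fun p => rotatePlane.symm (framePoint k m p.1 p.2) with hf
  have hfc : Continuous f := rotatePlane.symm.continuous.comp (continuous_framePoint k m)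
  set g : ℝ → Plane := fun t => f (c.x + t * (c.exit.1 - c.x), c.y + t * (c.exit.2 - c.y)) with hg
  set h : ℝ → Plane := fun t => f (c.exit.1 + t * c.dir.1, c.exit.2 + t * c.dir.2) with hh
  have hgc : Continuous g := hfc.comp (by fun_prop)
  have hhc : Continuous h := hfc.comp (by fun_prop)
  have hgh : g 1 = h 0 := by simp [hg, hh]
  refine (linkedDrawing hk).mem_closure_outerCell (S := g '' Set.Ioc 0 1 ∪ h '' Set.Ici 0) ?_ ?_ ?_ ?_
  · refine IsPreconnected.union (g 1) ⟨1, by norm_num, rfl⟩ ⟨0, Set.self_mem_Ici, hgh.symm⟩ ?_ ?_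
    · exact isPreconnected_Ioc.image _ hgc.continuousOn
    · exact isPreconnected_Ici.image _ hhc.continuousOn
  · rintro _ (⟨t, ht, rfl⟩ | ⟨t, ht, rfl⟩)
    · exact notMem_carrier hk hm (c.freePoint_segment ht.1 ht.2)
    · exact notMem_carrier hk hm (c.freePoint_ray ht)
  · intro hb
    obtain ⟨C, hC⟩ := hb.isCompact_closure.exists_bound_of_continuousOn
      (f := fun z => frameY k m (rotatePlane z))
      ((continuous_frameY k m).comp rotatePlane.continuous).continuousOn
    -- The ray rises with unit speed in frame coordinates from height at least −1, so at time `|C| +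
    -- 2` it is above the supposed bound `C`.
    have h0 := hC (h (|C| + 2)) (subset_closure (.inr ⟨_, by
      rw [Set.mem_Ici]; positivity, rfl⟩))
    simp only [hh, hf, rotatePlane.apply_symm_apply, frameY_framePoint, c.dir_snd] at h0
    have h1 := c.exit_snd
    have h2 := le_abs_self C
    have h3 := (le_abs_self _).trans h0
    linarith
  · have e : (linkedDrawing hk).pos v = g 0 := by
      show rotatePlane.symm (cornerPoint k (toFrame v)) = _
      rw [hv]
      simp [hg, hf, cornerPoint]
    rw [e]
    have : g 0 ∈ closure (g '' Set.Ioc 0 1) := by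
      refine image_closure_subset_closure_image hgc ⟨0, ?_, rfl⟩
      rw [closure_Ioc one_ne_zero.symm]
      exact ⟨le_rfl, zero_le_one⟩
    exact closure_mono Set.subset_union_left this

theorem isOuterApRAC_linkedDrawing (hk : 2 ≤ k) : (linkedDrawing hk).IsOuterApRAC := by
  have key : ∀ u v u' v' : LinkedVertex k, (linkedGraph k).Adj u v → (linkedGraph k).Adj u' v' →
      EdgesCross (linkedDrawing hk).pos u v u' v' →
      AxisPerp (rotatePlane ((linkedDrawing hk).pos v - (linkedDrawing hk).pos u))
        (rotatePlane ((linkedDrawing hk).pos v' - (linkedDrawing hk).pos u')) := by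
    rintro u v u' v' h h' ⟨hne, z, hz, hz'⟩
    have hz : z ∈ openSegment ℝ (rotatePlane.symm _) (rotatePlane.symm _) := hz
    have hz' : z ∈ openSegment ℝ (rotatePlane.symm _) (rotatePlane.symm _) := hz'
    rw [rotatePlane_symm_mem_openSegment] at hz hz'
    have := axisPerp_toFrame hk h h' hne hz hz'
    simp only [linkedDrawing, map_sub, rotatePlane.apply_symm_apply]
    exact this
  refine ⟨⟨?_, linkedDrawing_outer hk⟩, ?_⟩
  · intro u v u' v' h h' hc
    have hP := key u v u' v' h h' hc
    rw [AxisPerp, rotatePlane_re, rotatePlane_im, rotatePlane_re, rotatePlane_im] at hP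
    rw [PiLp.inner_apply, Fin.sum_univ_two]
    simp only [RCLike.inner_apply, conj_trivial]
    rcases hP with ⟨h1, h2⟩ | ⟨h1, h2⟩
    · rw [eq_neg_of_add_eq_zero_left h1, sub_eq_zero.mp h2]; ring
    · rw [sub_eq_zero.mp h1, eq_neg_of_add_eq_zero_left h2]; ring
  · intro u v u' v' h h' hc
    have hP := key u v u' v' h h' hc
    have hne := (linkedDrawing hk).pos_injective.ne h.ne
    rw [AxisPerp, rotatePlane_re, rotatePlane_im, rotatePlane_re, rotatePlane_im] at hP
    simp only [PiLp.sub_apply] at hP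
    have h0 : (linkedDrawing hk).pos v 1 - (linkedDrawing hk).pos u 1 =
        (linkedDrawing hk).pos v 0 - (linkedDrawing hk).pos u 0 ∨
        (linkedDrawing hk).pos v 1 - (linkedDrawing hk).pos u 1 =
        -((linkedDrawing hk).pos v 0 - (linkedDrawing hk).pos u 0) := by
      rcases hP with ⟨h1, -⟩ | ⟨h1, -⟩
      · right; linarith
      · left; linarith
    have hx : (linkedDrawing hk).pos u 0 ≠ (linkedDrawing hk).pos v 0 := by
      intro e
      apply hne
      ext i
      fin_cases i
      · exact e
      · show (linkedDrawing hk).pos u 1 = (linkedDrawing hk).pos v 1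
        rcases h0 with h0 | h0 <;> linarith
    rcases h0 with h0 | h0
    · exact .inl ⟨hx, by rw [h0, one_mul]⟩
    · exact .inr ⟨hx, by rw [h0, neg_one_mul]⟩

end LinkedDrawing

theorem mainTheorem8 :
    (∀ k : ℕ, 9 ≤ k → ∀ D : StraightLineDrawing (linkedGraph k), D.IsOuterApRAC →
      HasCrossing (sigmaSkeleton k) (fun v => D.pos v.toLinked)) ∧
    (∀ k : ℕ, 2 ≤ k → ∃ D : StraightLineDrawing (linkedGraph k), D.IsOuterApRAC) :=
  ⟨fun _ hk D hD => hasCrossing_of_isOuterApRAC hk D hD,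
    fun _ hk => ⟨linkedDrawing hk, isOuterApRAC_linkedDrawing hk⟩⟩
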